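/- **Setting.** Let $(W,S)$ be a Coxeter system with $S$ finite, with length function $\ell$, and let $m_{s,t}$ be the order of $st$. For $I\subseteq S$ let $W_I=\langle I\rangle$, and let $\Lambda$ be the set of all $I\subseteq S$ with $W_I$ finite; $w_I$ is the longest element of $W_I$ ($I\in\Lambda$). Write $I\sqsubset J$ if $I\subset J$ and $|I|=|J|-1$. Let $H_q$ be the Hecke algebra over $\mathbb Z[q]$, generated by $T_s$ ($s\in S$) subject to $T_s^2=(q-1)T_s+q$ and the braid relations $T_sT_tT_s\cdots=T_tT_sT_t\cdots$ ($m_{s,t}$ factors on each side, $s\ne t$, $m_{s,t}<\infty$), and let $T_w=T_{s_1}\cdots T_{s_l}$ for a reduced expression $w=s_1\cdots s_l$. For $I\in\Lambda$ put $x_I=\sum_{w\in W_I}T_w$ and $\pi(I)=\sum_{w\in W_I}q^{\ell(w)}$, and put $x_s=T_s+1$. Let $E_q(W)=\operatorname{End}_{H_q}\bigl(\bigoplus_{I\in\Lambda}x_IH_q\bigr)$ (right modules). Let $R$ be the localisation of $\mathbb Z[q]$ at the polynomials with constant term $1$, and $RE_q(W)=R\otimes_{\mathbb Z[q]}E_q(W)$.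 For $I\sqsubset J$ in $\Lambda$ let $u_{I,J}\in RE_q(W)$ be the inclusion $x_JH_q\hookrightarrow x_IH_q$; let $d_{J,I}\in RE_q(W)$ be $\frac{\pi(I)}{\pi(J)}$ times the map $x_IH_q\to x_JH_q$ given by left multiplication with $h_{J,I}=\sum T_w$, where $w$ runs over the elements of $W_J$ such that $w^{-1}$ is a shortest element of its right coset $W_Iw^{-1}$; and for $K\in\Lambda$ let $1_K$ be the identity map of $x_KH_q$ (each of these maps is extended by $0$ to the other summands). Let $\tilde Q$ be the quiver with vertex set $\Lambda$ and, for each $I\sqsubset J$ in $\Lambda$, an arrow $\tilde\delta_{J,I}$ from $I$ to $J$ and an arrow $\tilde\upsilon_{I,J}$ from $J$ to $I$. Let $R\tilde Q$ be its path algebra (a product $\alpha\beta$ of paths is nonzero only if $\alpha$ starts where $\beta$ ends), with trivial paths $\tilde e_K$. Put $\tilde\chi_s=(q+1)\tilde\upsilon_{\emptyset,\{s\}}\tilde\delta_{\{s\},\emptyset}$. For a sequence $\underline y=(s_k,\dots,s_1)$ in $S$ put $x_{\underline y}=x_{s_k}\cdots x_{s_1}$ and $\tilde\chi_{\underline y}=\tilde\chi_{s_k}\cdots\tilde\chi_{s_1}$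 (for the empty sequence these are $1$ and $\tilde e_\emptyset$). For every $I\in\Lambda$ and every chain $I_\bullet:\emptyset=I_0\sqsubset I_1\sqsubset\dots\sqsubset I_m=I$ there are a reduced expression $\underline w=(s_l,\dots,s_1)$ of $w_I$ having, for each $i$, a final segment $(s_{j_i},\dots,s_1)$ that is a reduced expression of $w_{I_i}$, and polynomials $a_{\underline y}\in\mathbb Z[q]$, indexed by the proper subsequences $\underline y$ of $\underline w$, such that $x_I=x_{\underline w}+q\sum_{\underline y<\underline w}a_{\underline y}x_{\underline y}$ in $H_q$. Fix any such choice for every chain $I_\bullet$, and put $\tilde\rho_{I_\bullet}=\frac1{\pi(I)}\bigl(\tilde\chi_{\underline w}+q\sum_{\underline y<\underline w}a_{\underline y}\tilde\chi_{\underline y}\bigr)$. Let $\tilde{\mathcal J}$ be the set of the relations * ($\tilde{\rm J}1$) $\tilde\delta_{J,I}\tilde\upsilon_{I,J}=\tilde e_J$ for all $I\sqsubset J$ in $\Lambda$; * ($\tilde{\rm J}2$) $\tilde\upsilon_{I,J}\tilde\upsilon_{J,K}=\tilde\upsilon_{I,J'}\tilde\upsilon_{J',K}$ and $\tilde\delta_{K,J}\tilde\delta_{J,I}=\tilde\delta_{K,J'}\tilde\delta_{J',I}$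 for all $I\sqsubset J\sqsubset K$ and $I\sqsubset J'\sqsubset K$ in $\Lambda$; * ($\tilde{\rm J}3$) $\tilde\upsilon_{\emptyset,I_1}\cdots\tilde\upsilon_{I_{m-1},I}\,\tilde\delta_{I,I_{m-1}}\cdots\tilde\delta_{I_1,\emptyset}=\tilde\rho_{I_\bullet}$ for all $I\in\Lambda$ with $|I|>1$ and all chains $I_\bullet:\emptyset=I_0\sqsubset I_1\sqsubset\dots\sqsubset I_m=I$. **Statement.** There is an isomorphism of $R$-algebras $\hbar:R\tilde Q/\langle\tilde{\mathcal J}\rangle\to RE_q(W)$ sending $\tilde\upsilon_{I,J}\mapsto u_{I,J}$, $\tilde\delta_{J,I}\mapsto d_{J,I}$ and $\tilde e_K\mapsto 1_K$ for all $I,J,K\in\Lambda$ with $I\sqsubset J$. In other words, $RE_q(W)$ is the unital $R$-algebra generated by $u_{I,J}$, $d_{J,I}$, $1_K$ ($I,J,K\in\Lambda$, $I\sqsubset J$), with $1=\sum_{K\in\Lambda}1_K$, subject to the relations obtained from ($\tilde{\rm J}1$)–($\tilde{\rm J}3$) by replacing $\tilde\upsilon_{I,J},\tilde\delta_{J,I},\tilde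 e_K$ with $u_{I,J},d_{J,I},1_K$, and the quiver relations * ($\tilde{\rm J}4$) $u_{I,J}1_J=u_{I,J}=1_Iu_{I,J}$, $d_{J,I}1_I=d_{J,I}=1_Jd_{J,I}$ for $I\sqsubset J$; $1_I^2=1_I$; and $1_I1_J=0$ for $I\neq J$. -/

import Mathlib

open scoped TensorProduct Polynomial

noncomputable section

namespace HeckeEnd

/-! ### Path algebras

A path from `a` to `b` is composed as functions are: `p * q` is "first `q`, then `p`", and it is `0`
unless the starting vertex of `p` is the ending vertex of `q`. -/

section PathAlgebra

variable (R : Type*) [CommRing R] (V : Type*) [Quiver V]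

/-- All paths of the quiver: `⟨a, b, p⟩` is a path `p` from `a` to `b`. -/
abbrev AnyPath : Type _ := Σ a b : V, Quiver.Path a b

/-- The path algebra: the free `R`-module on the set of all paths. -/
def PathAlgebra : Type _ := AnyPath V →₀ R

instance : AddCommGroup (PathAlgebra R V) := inferInstanceAs (AddCommGroup (AnyPath V →₀ R))

instance : Module R (PathAlgebra R V) := inferInstanceAs (Module R (AnyPath V →₀ R))

variable {V}

/-- A path as a basis element of the path algebra. -/
def PathAlgebra.of (p : AnyPath V) : PathAlgebra R V := Finsupp.single p 1

open Classical in
/-- The product of two paths: their concatenation if they can be composed, and zero otherwise. -/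
def PathAlgebra.pathMul (p q : AnyPath V) : PathAlgebra R V :=
  if h : q.2.1 = p.1 then PathAlgebra.of R ⟨q.1, p.2.1, q.2.2.comp (p.2.2.cast h.symm rfl)⟩ else 0

variable (V)

/-- Bilinear extension of the product of paths. -/
def PathAlgebra.mulHom : PathAlgebra R V →ₗ[R] PathAlgebra R V →ₗ[R] PathAlgebra R V :=
  Finsupp.linearCombination R fun p : AnyPath V =>
    (Finsupp.linearCombination R fun q : AnyPath V => PathAlgebra.pathMul R p q :
      (AnyPath V →₀ R) →ₗ[R] PathAlgebra R V)

instance : Mul (PathAlgebra R V) := ⟨fun x y => PathAlgebra.mulHom R V x y⟩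

/-- The trivial path at a vertex. -/
def PathAlgebra.vertex {V : Type*} [Quiver V] (v : V) : PathAlgebra R V :=
  PathAlgebra.of R ⟨v, v, Quiver.Path.nil⟩

/-- The path of length one given by an arrow. -/
def PathAlgebra.arrow {V : Type*} [Quiver V] {v w : V} (f : v ⟶ w) : PathAlgebra R V :=
  PathAlgebra.of R ⟨v, w, f.toPath⟩

instance [Fintype V] : One (PathAlgebra R V) := ⟨∑ v : V, PathAlgebra.vertex R v⟩

namespace PathAlgebra

variable {R V}

theorem mul_def (x y : PathAlgebra R V) : x * y = mulHom R V x y := rfl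

theorem of_mul_of (p q : AnyPath V) : of R p * of R q = pathMul R p q := by
  rw [mul_def, mulHom, of, of]
  erw [Finsupp.linearCombination_single, one_smul, Finsupp.linearCombination_single, one_smul]

theorem pathMul_comp {a b c : V} (p : Quiver.Path b c) (q : Quiver.Path a b) :
    pathMul R ⟨b, c, p⟩ ⟨a, b, q⟩ = of R ⟨a, c, q.comp p⟩ := by
  simp [pathMul]

theorem pathMul_ne (p q : AnyPath V) (h : q.2.1 ≠ p.1) : pathMul R p q = 0 := by
  simp [pathMul, h]

theorem mul_add' (x y z : PathAlgebra R V) : x * (y + z) = x * y + x * z := by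
  simp [mul_def]

theorem add_mul' (x y z : PathAlgebra R V) : (x + y) * z = x * z + y * z := by
  simp [mul_def]

theorem zero_mul' (x : PathAlgebra R V) : 0 * x = 0 := by simp [mul_def]

theorem mul_zero' (x : PathAlgebra R V) : x * 0 = 0 := by simp [mul_def]

theorem smul_mul' (r : R) (x y : PathAlgebra R V) : (r • x) * y = r • (x * y) := by
  simp [mul_def]

theorem mul_smul' (r : R) (x y : PathAlgebra R V) : x * (r • y) = r • (x * y) := by
  simp [mul_def]

theorem induct {P : PathAlgebra R V → Prop} (x : PathAlgebra R V) (h0 : P 0)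
    (hadd : ∀ x y, P x → P y → P (x + y)) (hs : ∀ (r : R) (p : AnyPath V), P (r • of R p)) :
    P x := by
  refine Finsupp.induction_linear (motive := P) x h0 hadd fun p r => ?_
  have h := hs r p
  have e : r • of R p = (Finsupp.single p r : AnyPath V →₀ R) := by
    rw [of]; erw [Finsupp.smul_single]; rw [smul_eq_mul, mul_one]
  rwa [e] at h

theorem of_assoc (p q r : AnyPath V) :
    of R p * of R q * of R r = of R p * (of R q * of R r) := by
  obtain ⟨a, b, p⟩ := p
  obtain ⟨c, d, q⟩ := q
  obtain ⟨e, f, r⟩ := r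
  rw [of_mul_of, of_mul_of]
  by_cases h1 : d = a
  · subst h1
    rw [pathMul_comp, of_mul_of]
    by_cases h2 : f = c
    · subst h2
      rw [pathMul_comp, pathMul_comp, of_mul_of, pathMul_comp, Quiver.Path.comp_assoc]
    · rw [pathMul_ne _ _ (by exact h2), pathMul_ne _ _ (by exact h2), mul_zero']
  · rw [pathMul_ne _ _ (by exact h1), zero_mul']
    by_cases h2 : f = c
    · subst h2
      rw [pathMul_comp, of_mul_of, pathMul_ne _ _ (by exact h1)]
    · rw [pathMul_ne _ _ (by exact h2), mul_zero']

theorem mul_assoc' (x y z : PathAlgebra R V) : x * y * z = x * (y * z) := by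
  induction x using induct with
  | h0 => simp only [zero_mul']
  | hadd x x' hx hx' => simp only [add_mul', hx, hx']
  | hs a p =>
    induction y using induct with
    | h0 => simp only [zero_mul', mul_zero']
    | hadd y y' hy hy' => simp only [add_mul', mul_add', hy, hy']
    | hs b q =>
      induction z using induct with
      | h0 => simp only [mul_zero']
      | hadd z z' hz hz' => simp only [mul_add', hz, hz']
      | hs c r => simp only [smul_mul', mul_smul', of_assoc]

variable [Fintype V]

theorem one_def : (1 : PathAlgebra R V) = ∑ v : V, vertex R v := rfl

theorem one_mul' (x : PathAlgebra R V) : 1 * x = x := by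
  induction x using induct with
  | h0 => simp only [mul_zero']
  | hadd x x' hx hx' => simp only [mul_add', hx, hx']
  | hs a p =>
    obtain ⟨b, c, p⟩ := p
    rw [mul_smul', one_def, mul_def, map_sum, LinearMap.sum_apply, Finset.sum_eq_single c]
    · rw [← mul_def, vertex, of_mul_of, pathMul_comp, Quiver.Path.comp_nil]
    · intro v _ hv
      rw [← mul_def, vertex, of_mul_of, pathMul_ne _ _ (by exact hv.symm)]
    · intro h
      exact absurd (Finset.mem_univ c) h

theorem mul_one' (x : PathAlgebra R V) : x * 1 = x := by
  induction x using induct with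
  | h0 => simp only [zero_mul']
  | hadd x x' hx hx' => simp only [add_mul', hx, hx']
  | hs a p =>
    obtain ⟨b, c, p⟩ := p
    rw [smul_mul', one_def, mul_def, map_sum, Finset.sum_eq_single b]
    · rw [← mul_def, vertex, of_mul_of, pathMul_comp, Quiver.Path.nil_comp]
    · intro v _ hv
      rw [← mul_def, vertex, of_mul_of, pathMul_ne _ _ (by exact hv)]
    · intro h
      exact absurd (Finset.mem_univ b) h

instance : Ring (PathAlgebra R V) :=
  { (inferInstance : AddCommGroup (PathAlgebra R V)) with
    mul := (· * ·)
    one := 1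
    left_distrib := mul_add'
    right_distrib := add_mul'
    zero_mul := zero_mul'
    mul_zero := mul_zero'
    mul_assoc := mul_assoc'
    one_mul := one_mul'
    mul_one := mul_one' }

instance : Algebra R (PathAlgebra R V) := Algebra.ofModule smul_mul' mul_smul'

end PathAlgebra

end PathAlgebra

/-! ### The ground ring -/

/-- The multiplicative set of the polynomials in `ℤ[q]` with constant term `1`. -/
def constOne : Submonoid ℤ[X] where
  carrier := {f | f.coeff 0 = 1}
  one_mem' := by simp
  mul_mem' := by
    intro f g hf hg
    simp only [Set.mem_ofPred_eq] at *
    rw [Polynomial.mul_coeff_zero, hf, hg, one_mul]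

/-- `ℤ[q]` localised at the polynomials with constant term `1`. -/
abbrev GroundRing : Type := Localization constOne

/-! ### The Hecke algebra -/

section Hecke

variable {B : Type*} (M : CoxeterMatrix B)

/-- The Hecke relations on the free `ℤ[q]`-algebra on the `T_s`. For `M s t = 0` (infinite order)
and for `s = t` the two sides of `braid s t` are the same word, so the relation is void. -/
inductive HeckeRel : FreeAlgebra ℤ[X] B → FreeAlgebra ℤ[X] B → Prop
  | quad (s : B) : HeckeRel (FreeAlgebra.ι ℤ[X] s * FreeAlgebra.ι ℤ[X] s)
      (((Polynomial.X : ℤ[X]) - 1) • FreeAlgebra.ι ℤ[X] s + (Polynomial.X : ℤ[X]) • 1)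
  | braid (s t : B) : HeckeRel
      (((CoxeterSystem.braidWord M s t).map (FreeAlgebra.ι ℤ[X])).prod)
      (((CoxeterSystem.braidWord M t s).map (FreeAlgebra.ι ℤ[X])).prod)

/-- The Hecke algebra `H_q` over `ℤ[q]`. -/
def Hecke : Type _ := RingQuot (HeckeRel M)

instance : Ring (Hecke M) := inferInstanceAs (Ring (RingQuot (HeckeRel M)))

instance : Algebra ℤ[X] (Hecke M) := inferInstanceAs (Algebra ℤ[X] (RingQuot (HeckeRel M)))

/-- The generator `T_s`. -/
def Hecke.gen (s : B) : Hecke M :=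
  RingQuot.mkAlgHom ℤ[X] (HeckeRel M) (FreeAlgebra.ι ℤ[X] s)

/-- The Kazhdan–Lusztig generator `x_s = T_s + 1`. -/
def Hecke.klGen (s : B) : Hecke M := Hecke.gen M s + 1

end Hecke

section Coxeter

variable {B W : Type*} [Group W] {M : CoxeterMatrix B} (cs : CoxeterSystem M W)

/-- `T_w = T_{s₁} ⋯ T_{s_l}` for a reduced expression `w = s₁ ⋯ s_l`; by the braid relations the
choice of the reduced expression does not matter. -/
def basisT (w : W) : Hecke M :=
  ((cs.exists_isReduced w).choose.map (Hecke.gen M)).prod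

/-- The parabolic subgroup `W_I`. -/
def parabolic (I : Finset B) : Subgroup W := Subgroup.closure (cs.simple '' (I : Set B))

/-- The set `Λ` of finitary subsets of `S`. -/
@[ext]
structure Finitary where
  carrier : Finset B
  finite : Finite (parabolic cs carrier)

variable {cs}

/-- The parabolic subgroup of a finitary subset. -/
abbrev Finitary.group (I : Finitary cs) : Subgroup W := parabolic cs I.carrier

variable (cs)

/-- The empty set, as a finitary subset. -/
def emptyΛ : Finitary cs where
  carrier := ∅
  finite := by
    have h : parabolic cs (∅ : Finset B) = ⊥ := by simp [parabolic]
    rw [h]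
    infer_instance

instance [Finite B] : Finite (Finitary cs) :=
  Finite.of_injective Finitary.carrier fun _ _ h => Finitary.ext h

instance [Finite B] : Fintype (Finitary cs) := Fintype.ofFinite _

instance : DecidableEq (Finitary cs) := Classical.decEq _

instance (I : Finitary cs) : Fintype I.group :=
  haveI := I.finite
  Fintype.ofFinite _

variable {cs}

/-- `I ⊏ J`: `I ⊂ J` and `|I| = |J| - 1`. -/
def Finitary.Below (I J : Finitary cs) : Prop :=
  I.carrier ⊂ J.carrier ∧ I.carrier.card + 1 = J.carrier.card

/-- The singleton `{s}`, as a finitary subset. -/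
def singletonΛ (cs : CoxeterSystem M W) (s : B) : Finitary cs where
  carrier := {s}
  finite := by
    have h : parabolic cs ({s} : Finset B) = Subgroup.zpowers (cs.simple s) := by
      simp [parabolic, Subgroup.zpowers_eq_closure]
    rw [h]
    have : IsOfFinOrder (cs.simple s) :=
      isOfFinOrder_iff_pow_eq_one.2 ⟨2, by norm_num, by simp [pow_two]⟩
    exact this.finite_zpowers

theorem empty_below_singleton (cs : CoxeterSystem M W) (s : B) :
    (emptyΛ cs).Below (singletonΛ cs s) := by
  constructor <;> simp [emptyΛ, singletonΛ]

/-- The Poincaré polynomial `π(I) = ∑_{w ∈ W_I} q^{ℓ(w)}`. -/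
def poincare (I : Finitary cs) : ℤ[X] := ∑ w : I.group, Polynomial.X ^ cs.length (w : W)

theorem poincare_mem (I : Finitary cs) : poincare I ∈ constOne := by
  change (poincare I).coeff 0 = 1
  rw [poincare, Polynomial.finsetSum_coeff, Finset.sum_eq_single (1 : I.group)]
  · simp
  · intro w _ hw
    rw [Polynomial.coeff_X_pow, if_neg]
    intro h
    exact hw (Subtype.ext (cs.length_eq_zero_iff.1 h.symm))
  · intro h
    exact absurd (Finset.mem_univ _) h

/-- `x_I = ∑_{w ∈ W_I} T_w`. -/
def xElt (I : Finitary cs) : Hecke M := ∑ w : I.group, basisT cs (w : W)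

/-- `D_I`: the shortest representatives of the right cosets `W_I w`. -/
def shortest (I : Finitary cs) : Set W := {w | ∀ v ∈ I.group, cs.length w ≤ cs.length (v * w)}

open Classical in
/-- `h_{J,I} = ∑ T_w`, the sum over the `w` with `w⁻¹ ∈ D_I ∩ W_J`. -/
def hElt (J I : Finitary cs) : Hecke M :=
  ∑ w : J.group with (w : W)⁻¹ ∈ shortest I, basisT cs (w : W)

/-! ### The Hecke endomorphism algebra -/

/-- The right ideal `x_I H_q`, as a right `H_q`-module. -/
abbrev xIdeal (I : Finitary cs) : Submodule (Hecke M)ᵐᵒᵖ (Hecke M) :=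
  Submodule.span (Hecke M)ᵐᵒᵖ {xElt I}

variable (cs)

/-- The right `H_q`-module `⨁_{I ∈ Λ} x_I H_q`. -/
abbrev xSum : Type _ := DirectSum (Finitary cs) fun I => xIdeal I

/-- The Hecke endomorphism algebra `E_q(W)` over `ℤ[q]`. -/
abbrev HeckeEndAlg : Type _ := Module.End (Hecke M)ᵐᵒᵖ (xSum cs)

/-- `R E_q(W) = R ⊗ E_q(W)`. -/
abbrev RHeckeEndAlg : Type _ := GroundRing ⊗[ℤ[X]] HeckeEndAlg cs

variable {cs}

/-- A homomorphism `x_I H_q → x_J H_q` as an element of `E_q(W)`, zero on the other summands. -/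
def extend {I J : Finitary cs} (f : xIdeal I →ₗ[(Hecke M)ᵐᵒᵖ] xIdeal J) : HeckeEndAlg cs :=
  DirectSum.lof (Hecke M)ᵐᵒᵖ (Finitary cs) (fun I => xIdeal I) J ∘ₗ f ∘ₗ
    DirectSum.component (Hecke M)ᵐᵒᵖ (Finitary cs) (fun I => xIdeal I) I

/-- `f : x_J H_q → x_I H_q` is the natural inclusion. -/
def IsInclusion {I J : Finitary cs} (f : xIdeal J →ₗ[(Hecke M)ᵐᵒᵖ] xIdeal I) : Prop :=
  ∀ y, (f y : Hecke M) = y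

/-- `f : x_I H_q → x_J H_q` is the left multiplication with `a`. -/
def IsLeftMul {I J : Finitary cs} (a : Hecke M) (f : xIdeal I →ₗ[(Hecke M)ᵐᵒᵖ] xIdeal J) : Prop :=
  ∀ y, (f y : Hecke M) = a * y

/-- A homomorphism `f : x_J H_q → x_I H_q` in `R E_q(W)`; this is `u_{I,J}` if `f` is the
inclusion. -/
def uElt {I J : Finitary cs} (f : xIdeal J →ₗ[(Hecke M)ᵐᵒᵖ] xIdeal I) : RHeckeEndAlg cs :=
  1 ⊗ₜ extend f

/-- `(π(I) / π(J)) f` in `R E_q(W)`, for a homomorphism `f : x_I H_q → x_J H_q`; this is the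
splitting map `d_{J,I}` if `f` is the left multiplication with `h_{J,I}`. -/
def dElt {I J : Finitary cs} (f : xIdeal I →ₗ[(Hecke M)ᵐᵒᵖ] xIdeal J) : RHeckeEndAlg cs :=
  Localization.mk (poincare I) ⟨poincare J, poincare_mem J⟩ ⊗ₜ extend f

/-- The identity map `1_K` of `x_K H_q` in `R E_q(W)`. -/
def oneElt (K : Finitary cs) : RHeckeEndAlg cs :=
  1 ⊗ₜ extend (LinearMap.id : xIdeal K →ₗ[(Hecke M)ᵐᵒᵖ] xIdeal K)

/-! ### Orderings of a finitary subset and expansions of `x_I` -/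

variable (cs)

/-- The chains `∅ = I₀ ⊏ I₁ ⊏ ⋯ ⊏ I_m = I`, that is, the total orderings of `I`. -/
inductive Ordering : Finitary cs → Type _
  | nil : Ordering (emptyΛ cs)
  | snoc {I J : Finitary cs} (c : Ordering I) (h : I.Below J) : Ordering J

variable {cs}

/-- `w` is the longest element of `W_I`. -/
def IsLongest (I : Finitary cs) (w : W) : Prop :=
  w ∈ I.group ∧ ∀ v ∈ I.group, cs.length v ≤ cs.length w

/-- `word = (s_l, …, s₁)` is a reduced expression of the longest element of `W_I` such that, for
every `i`, some final segment `(s_{j_i}, …, s₁)` is an expression of the longest element of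
`W_{I_i}`. -/
def IsAdapted : {I : Finitary cs} → Ordering cs I → List B → Prop
  | _, .nil, word => word = []
  | J, .snoc c _, word => cs.IsReduced word ∧ IsLongest J (cs.wordProd word) ∧
      ∃ left right : List B, word = left ++ right ∧ IsAdapted c right

/-- A reduced expression adapted to the ordering `c` of `I`, and coefficients `a_y ∈ ℤ[q]`, zero
unless `y` is a subsequence of the word that arises by removing some (at least one) of its terms,
with `x_I = x_word + q ∑_y a_y x_y`, where `x_y` is the product of the `x_s` along `y`. -/
structure Expansion {I : Finitary cs} (c : Ordering cs I) where
  word : List B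
  adapted : IsAdapted c word
  coeff : List B →₀ ℤ[X]
  sublist : ∀ y ∈ coeff.support, y.Sublist word ∧ y ≠ word
  expansion : xElt I = (word.map (Hecke.klGen M)).prod +
    (Polynomial.X : ℤ[X]) • coeff.sum fun y a => a • (y.map (Hecke.klGen M)).prod

/-! ### The relations

The relations are written down for elements `u h` (for `υ_{I,J}`), `d h` (for `δ_{J,I}`), where
`h : I ⊏ J`, and `e K` of an arbitrary algebra `A` over the ground ring. -/

section Relations

variable {A : Type*} [Ring A] [Algebra GroundRing A]
  (u d : {I J : Finitary cs} → I.Below J → A) (e : Finitary cs → A)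

/-- `υ_{∅,I₁} υ_{I₁,I₂} ⋯ υ_{I_{m-1},I}`. -/
def uProd : {I : Finitary cs} → Ordering cs I → A
  | _, .nil => e (emptyΛ cs)
  | _, .snoc c h => uProd c * u h

/-- `δ_{I,I_{m-1}} ⋯ δ_{I₂,I₁} δ_{I₁,∅}`. -/
def dProd : {I : Finitary cs} → Ordering cs I → A
  | _, .nil => e (emptyΛ cs)
  | _, .snoc c h => d h * dProd c

/-- `χ_s = (q + 1) υ_{∅,{s}} δ_{{s},∅}`. -/
def chi (s : B) : A :=
  algebraMap ℤ[X] GroundRing (Polynomial.X + 1) •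
    (u (empty_below_singleton cs s) * d (empty_below_singleton cs s))

/-- The product of the `χ_s` along a word, at the vertex `∅`. -/
def chiWord (w : List B) : A := (w.map (chi u d)).prod * e (emptyΛ cs)

/-- `ρ_{I_•} = π(I)⁻¹ (χ_word + q ∑_y a_y χ_y)`. -/
def rho {I : Finitary cs} {c : Ordering cs I} (E : Expansion c) : A :=
  (Localization.mk 1 ⟨poincare I, poincare_mem I⟩ : GroundRing) •
    (chiWord u d e E.word + algebraMap ℤ[X] GroundRing Polynomial.X •
      E.coeff.sum fun y a => algebraMap ℤ[X] GroundRing a • chiWord u d e y)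

/-- The idempotent, sandwich and extended braid relations; the last ones are imposed for all
orderings of all finitary `I` with `|I| > 1`. -/
inductive HasseRel (E : (I : Finitary cs) → (c : Ordering cs I) → Expansion c) : A → A → Prop
  | idempotent {I J : Finitary cs} (h : I.Below J) : HasseRel E (d h * u h) (e J)
  | sandwich_u {I J J' K : Finitary cs} (h₁ : I.Below J) (h₂ : J.Below K)
      (h₁' : I.Below J') (h₂' : J'.Below K) : HasseRel E (u h₁ * u h₂) (u h₁' * u h₂')
  | sandwich_d {I J J' K : Finitary cs} (h₁ : I.Below J) (h₂ : J.Below K)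
      (h₁' : I.Below J') (h₂' : J'.Below K) : HasseRel E (d h₂ * d h₁) (d h₂' * d h₁')
  | braid {I : Finitary cs} (hI : 1 < I.carrier.card) (c : Ordering cs I) :
      HasseRel E (uProd u e c * dProd d e c) (rho u d e (E I c))

/-- The quiver relations, with the relation that the `1_K` sum up to the identity. -/
inductive QuiverRel [Fintype (Finitary cs)] : A → A → Prop
  | u_one {I J : Finitary cs} (h : I.Below J) : QuiverRel (u h * e J) (u h)
  | one_u {I J : Finitary cs} (h : I.Below J) : QuiverRel (e I * u h) (u h)
  | d_one {I J : Finitary cs} (h : I.Below J) : QuiverRel (d h * e I) (d h)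
  | one_d {I J : Finitary cs} (h : I.Below J) : QuiverRel (e J * d h) (d h)
  | idem (I : Finitary cs) : QuiverRel (e I * e I) (e I)
  | orth {I J : Finitary cs} (h : I ≠ J) : QuiverRel (e I * e J) 0
  | sum_one : QuiverRel (∑ K, e K) 1

end Relations

/-! ### The Hasse quiver and its algebra -/

/-- The arrows of the Hasse quiver: for `I ⊏ J` an arrow `δ_{J,I}` from `I` to `J` and an arrow
`υ_{I,J}` from `J` to `I`. -/
inductive HasseArrow : Finitary cs → Finitary cs → Type _
  | delta {I J : Finitary cs} (h : I.Below J) : HasseArrow I J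
  | upsilon {I J : Finitary cs} (h : I.Below J) : HasseArrow J I

instance : Quiver (Finitary cs) := ⟨HasseArrow⟩

/-- The arrow `υ_{I,J}` in the path algebra. -/
def upsilon {I J : Finitary cs} (h : I.Below J) : PathAlgebra GroundRing (Finitary cs) :=
  PathAlgebra.arrow GroundRing (HasseArrow.upsilon h : J ⟶ I)

/-- The arrow `δ_{J,I}` in the path algebra. -/
def delta {I J : Finitary cs} (h : I.Below J) : PathAlgebra GroundRing (Finitary cs) :=
  PathAlgebra.arrow GroundRing (HasseArrow.delta h : I ⟶ J)

section Algebras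

variable [Finite B] (E : (I : Finitary cs) → (c : Ordering cs I) → Expansion c)

/-- The path algebra of the Hasse quiver modulo the ideal generated by the idempotent, sandwich
and extended braid relations. -/
abbrev HasseAlg : Type _ :=
  RingQuot (HasseRel (A := PathAlgebra GroundRing (Finitary cs)) upsilon delta
    (PathAlgebra.vertex GroundRing) E)

/-- The quotient map from the path algebra. -/
def HasseAlg.mk : PathAlgebra GroundRing (Finitary cs) →ₐ[GroundRing] HasseAlg E :=
  RingQuot.mkAlgHom GroundRing _

/-- The generators of the presentation. -/
inductive Generator (cs : CoxeterSystem M W) : Type _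
  | u {I J : Finitary cs} (h : I.Below J) : Generator cs
  | d {I J : Finitary cs} (h : I.Below J) : Generator cs
  | one (K : Finitary cs) : Generator cs

/-- A generator, as an element of the free algebra. -/
abbrev freeGen (g : Generator cs) : FreeAlgebra GroundRing (Generator cs) :=
  FreeAlgebra.ι GroundRing g

/-- All the relations of the presentation, on the free algebra. -/
def PresentationRel (x y : FreeAlgebra GroundRing (Generator cs)) : Prop :=
  HasseRel (fun h => freeGen (.u h)) (fun h => freeGen (.d h)) (fun K => freeGen (.one K)) E x y ∨
    QuiverRel (fun h => freeGen (.u h)) (fun h => freeGen (.d h)) (fun K => freeGen (.one K)) x y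

/-- The unital algebra over the ground ring that is generated by the `u_{I,J}`, `d_{J,I}`, `1_K`
subject to the idempotent, sandwich, extended braid and quiver relations. -/
abbrev PresentedAlg : Type _ := RingQuot (PresentationRel E)

/-- A generator, as an element of the presented algebra. -/
def PresentedAlg.gen (g : Generator cs) : PresentedAlg E :=
  RingQuot.mkAlgHom GroundRing (PresentationRel E) (freeGen g)

end Algebras

end Coxeter

end HeckeEnd

end

open scoped TensorProduct Polynomial

noncomputable section

namespace HeckeEnd

/-! ### Coxeter groups: the orders of the products of two simple reflections -/

section Geometric

variable {B W : Type*} [Group W] {M : CoxeterMatrix B} (cs : CoxeterSystem M W)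

open Module Polynomial.Chebyshev

/-! Let `A` be an algebra over the ground ring, generated by elements `u`, `d`, `e` that satisfy all
the relations (`IsHasseFamily`). Such an algebra is controlled by its corner at the vertex `∅`.
Along a chain `c` from `∅` to `I` the relations give `dProd d e c * uProd u e c = e I`, so every
Peirce component `e J * a * e I` can be recovered from `uProd u e c * a * dProd d e c'`, which lies
in the corner `e_∅ A e_∅`. The theorem thus reduces to identifying this corner with `R ⊗ H_q`,
compatibly with the same identification in `R E_q(W)`.

A homomorphism from `H_q` to `A` sends `T_s` to `χ_s - 1`. The quadratic relation follows from `χ_s²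
= (q + 1) χ_s`. For the braid relation of `s`, `t` (`prod_braidWord_chi_sub_one`), the sandwich
relations show that the two chains from `∅` to `{s,t}` give the same product of `u`'s and `d`'s. By
the extended braid relation, the two expansions of `x_{s,t}`, with `χ` in place of `x`, then agree
at the vertex `∅`. Each expansion is the alternating product of the `χ_s - 1` of full length plus
shorter alternating products. The shorter terms of the two expansions cancel, because they cancel in
`H_q`, where the `T_w` are linearly independent (`linearIndependent_basisT`). Off the vertex `∅`
both sides of the braid relation are the same sign.

The image of `R ⊗ H_q` exhausts what is needed of the corner (`uProd_mul_mul_dProd_mem_corner`):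
inserting `1 = ∑ e K` between generators reduces everything to products `uProd * dProd` along
chains, and these are `e_∅`, a scalar multiple of `χ_s`, or `ρ`.

On the other side, the inclusions and splitting maps satisfy the relations (`isHasseFamily_endAlg`),
mainly because `h_{J,I} x_I = x_J`. The corner of `R E_q(W)` at `∅` is the endomorphism algebra of
the regular right module, that is, left multiplications. A homomorphism that respects the families
turns `T_s` into left multiplication by `T_s` on this corner, hence is bijective
(`IsHasseFamily.bijective`). The quotient of the path algebra and the presented algebra are both
instances of `A`.

The existence of the expansions (`nonempty_expansion`) is a triangularity statement: modulo `q`, the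
product of the `x_s` along a word is the sum of the `T_v` over the products `v` of its subsequences.
The Coxeter theory behind all this is the exact order of `st`, the exchange condition and
Matsumoto's theorem. -/

/-- The coroot of a simple reflection in the geometric representation. -/
def coroot (M : CoxeterMatrix B) (i : B) : Dual ℝ (B →₀ ℝ) :=
  Finsupp.linearCombination ℝ fun j => -2 * Real.cos (Real.pi / M i j)

theorem coroot_single (i j : B) :
    coroot M i (Finsupp.single j 1) = -2 * Real.cos (Real.pi / M i j) := by
  simp [coroot]

theorem coroot_self (i : B) : coroot M i (Finsupp.single i 1) = 2 := by
  simp [coroot_single]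

/-- A simple reflection in the geometric representation. -/
def geomReflection (M : CoxeterMatrix B) (i : B) : (B →₀ ℝ) ≃ₗ[ℝ] (B →₀ ℝ) :=
  reflection (coroot_self (M := M) i)

theorem trace_eq (i j : B) :
    2 * Real.cos (2 * Real.pi / M i j) = coroot M i (Finsupp.single j 1) *
      coroot M j (Finsupp.single i 1) - 2 := by
  rw [coroot_single, coroot_single, M.symmetric j i, mul_div_assoc, Real.cos_two_mul]
  ring

theorem sin_pos_of_three_le {m : ℕ} (hm : 3 ≤ m) : 0 < Real.sin (2 * Real.pi / m) := by
  have h3 : (3 : ℝ) ≤ m := by exact_mod_cast hm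
  apply Real.sin_pos_of_pos_of_lt_pi
  · positivity
  · rw [div_lt_iff₀ (by linarith)]
    nlinarith [Real.pi_pos]

/-- The powers of a product of two reflections are given by Chebyshev polynomials `S` evaluated at
`2 cos θ`, where `θ = 2π/m`. Since `S_n(2 cos θ) sin θ = sin ((n+1)θ)`, the factor `S_{k-1}` that
occurs for `m = 2k`, and the factor `S_k + S_{k-1}` that occurs for `m = 2k+1`, both vanish. -/
theorem geomReflection_mul_pow (i j : B) :
    (geomReflection M i * geomReflection M j) ^ M i j = 1 := by
  by_cases hij : i = j
  · subst hij
    rw [M.diagonal, pow_one]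
    exact LinearEquiv.ext fun z => involutive_reflection (coroot_self (M := M) i) z
  have h1 : M i j ≠ 1 := M.off_diagonal i j hij
  have ht := trace_eq (M := M) i j
  apply LinearEquiv.ext
  intro z
  rw [geomReflection, geomReflection,
    reflection_mul_reflection_pow_apply (coroot_self i) (coroot_self j) (M i j) z _ ht]
  generalize hm : M i j = m at *
  have hcos := coroot_single (M := M) i j
  have hcos' := coroot_single (M := M) j i
  rw [M.symmetric j i] at hcos'
  rw [hm] at hcos hcos'
  -- The Chebyshev argument divides by `sin (2π/m)`, which is nonzero only from `m = 3` on.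
  obtain rfl | rfl | h3 : m = 0 ∨ m = 2 ∨ 3 ≤ m := by omega
  · norm_num
  · have e1 : Real.cos (2 * Real.pi / (2 : ℕ)) = -1 := by
      rw [Nat.cast_ofNat, mul_div_cancel_left₀ _ (by norm_num), Real.cos_pi]
    have e2 : Real.cos (Real.pi / (2 : ℕ)) = 0 := by rw [Nat.cast_ofNat, Real.cos_pi_div_two]
    rw [e1, hcos, hcos', e2]
    norm_num
    abel
  · have hs := sin_pos_of_three_le h3
    set θ := 2 * Real.pi / m with hθ
    have hmθ : m * θ = 2 * Real.pi := by
      rw [hθ]; field_simp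
    have hS := S_two_mul_real_cos θ
    obtain ⟨k, rfl | rfl⟩ := Nat.even_or_odd' m
    · have i1 : (((2 * k : ℕ) : ℤ) - 2) / 2 = (k : ℤ) - 1 := by omega
      have i2 : (((2 * k : ℕ) : ℤ) - 1) / 2 = (k : ℤ) - 1 := by omega
      have z1 : (S ℝ ((k : ℤ) - 1)).eval (2 * Real.cos θ) = 0 := by
        have := hS ((k : ℤ) - 1)
        push_cast at this hmθ
        rw [sub_add_cancel, show (k : ℝ) * θ = Real.pi by linarith, Real.sin_pi] at this
        exact (mul_eq_zero.1 this).resolve_right hs.ne'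
      rw [i1, i2, z1]
      simp
    · have i1 : (((2 * k + 1 : ℕ) : ℤ) - 2) / 2 = (k : ℤ) - 1 := by omega
      have i2 : (((2 * k + 1 : ℕ) : ℤ) - 1) / 2 = (k : ℤ) := by omega
      have i3 : (((2 * k + 1 : ℕ) : ℤ) - 3) / 2 = (k : ℤ) - 1 := by omega
      have i4 : (((2 * k + 1 : ℕ) : ℤ)) / 2 = (k : ℤ) := by omega
      have z1 : (S ℝ (k : ℤ)).eval (2 * Real.cos θ) + (S ℝ ((k : ℤ) - 1)).eval (2 * Real.cos θ)
          = 0 := by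
        have a := hS ((k : ℤ) - 1)
        have b := hS (k : ℤ)
        push_cast at a b hmθ
        rw [sub_add_cancel] at a
        rw [show ((k : ℝ) + 1) * θ = 2 * Real.pi - k * θ by linarith, Real.sin_two_pi_sub] at b
        have : ((S ℝ (k : ℤ)).eval (2 * Real.cos θ) + (S ℝ ((k : ℤ) - 1)).eval (2 * Real.cos θ)) *
          Real.sin θ = 0 := by rw [add_mul, a, b]; ring
        exact (mul_eq_zero.1 this).resolve_right hs.ne'
      rw [i1, i2, i3, i4, z1]
      simp

/-- It suffices to look at one basis vector `e_i`. If a power with exponent `r` fixes it, its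
`j`-coordinate gives `S_{r-1} = 0` and its `i`-coordinate then gives `S_r = 1`. For `m ≥ 3` this
means `cos (rθ) = 1`, which is impossible for `0 < r < m`. -/
theorem dvd_of_geomReflection_mul_pow {i j : B} (hij : i ≠ j) {n : ℕ}
    (h : (geomReflection M i * geomReflection M j) ^ n = 1) : M i j ∣ n := by
  have h1 : M i j ≠ 1 := M.off_diagonal i j hij
  by_contra hn
  obtain ⟨r, hr, hrm, hr1⟩ : ∃ r, 0 < r ∧ (M i j ≠ 0 → r < M i j) ∧
      (geomReflection M i * geomReflection M j) ^ r = 1 := by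
    by_cases h0 : M i j = 0
    · refine ⟨n, ?_, by simp [h0], h⟩
      rcases Nat.eq_zero_or_pos n with rfl | h'
      · simp at hn
      · exact h'
    · refine ⟨n % M i j, Nat.pos_of_ne_zero fun h' => hn (Nat.dvd_of_mod_eq_zero h'),
        fun _ => Nat.mod_lt _ (Nat.pos_of_ne_zero h0), ?_⟩
      rw [← h]
      conv_rhs => rw [← Nat.mod_add_div n (M i j), pow_add, pow_mul, geomReflection_mul_pow,
        one_pow, mul_one]
  have ht := trace_eq (M := M) i j
  have key := reflection_mul_reflection_pow_apply_self (coroot_self (M := M) i)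
    (coroot_self (M := M) j) r _ ht
  have hx : ((geomReflection M i * geomReflection M j) ^ r) (Finsupp.single i 1) =
      Finsupp.single i 1 := by rw [hr1]; rfl
  have hcj := coroot_single (M := M) j i
  rw [M.symmetric j i] at hcj
  rw [hcj] at key
  replace key := hx.symm.trans key
  have ki := DFunLike.congr_fun key i
  have kj := DFunLike.congr_fun key j
  simp [hij, hij.symm] at ki kj
  generalize hm : M i j = m at *
  obtain rfl | rfl | h3 : m = 0 ∨ m = 2 ∨ 3 ≤ m := by omega
  -- For `m = 0` the convention `π / 0 = 0` makes the argument of `S` equal to `2`, where `S_{r-1}`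
  -- has the value `r`; so the `j`-coordinate is nonzero.
  · simp at kj
    omega
  · obtain rfl : r = 1 := by have := hrm (by norm_num); omega
    have e1 : Real.cos (2 * Real.pi / (2 : ℕ)) = -1 := by
      rw [Nat.cast_ofNat, mul_div_cancel_left₀ _ (by norm_num), Real.cos_pi]
    norm_num at ki
  · have hs := sin_pos_of_three_le h3
    have hm0 : (0 : ℝ) < m := by positivity
    have hrm' := hrm (by omega)
    have hc : Real.cos (Real.pi / m) ≠ 0 := by
      intro h0
      rw [mul_div_assoc, Real.sin_two_mul, h0] at hs
      simp at hs
    have k0 : (S ℝ ((r : ℤ) - 1)).eval (2 * Real.cos (2 * Real.pi / m)) = 0 := by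
      tauto
    rw [k0, add_zero] at ki
    have a := S_two_mul_real_cos (2 * Real.pi / m) ((r : ℤ) - 1)
    have b := S_two_mul_real_cos (2 * Real.pi / m) (r : ℤ)
    rw [k0] at a
    rw [← ki] at b
    push_cast at a b
    rw [zero_mul, sub_add_cancel] at a
    rw [one_mul, add_mul, one_mul, Real.sin_add, ← a, zero_mul, zero_add] at b
    have hcr : Real.cos (r * (2 * Real.pi / m)) = 1 := by
      have : (Real.cos (r * (2 * Real.pi / m)) - 1) * Real.sin (2 * Real.pi / m) = 0 := by
        linarith
      rcases mul_eq_zero.1 this with h' | h'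
      · linarith
      · exact absurd h' hs.ne'
    obtain ⟨k, hk⟩ := (Real.cos_eq_one_iff _).1 hcr
    have hpi := Real.pi_pos
    have hk' : (k : ℝ) * m = r := by
      field_simp at hk
      nlinarith
    have hk'' : k * (m : ℤ) = r := by exact_mod_cast hk'
    have : 0 < k := by
      by_contra hneg
      nlinarith
    nlinarith

/-- The presentation only bounds the order of a product of two simple reflections from above; the
geometric representation shows that it does not drop. -/
theorem simple_mul_pow_eq_one_imp {i j : B} (hij : i ≠ j) {n : ℕ}
    (h : (cs.simple i * cs.simple j) ^ n = 1) : M i j ∣ n := by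
  have hl : M.IsLiftable (geomReflection M) := geomReflection_mul_pow
  apply dvd_of_geomReflection_mul_pow hij
  simpa using congrArg (cs.lift ⟨_, hl⟩) h

theorem simple_injective : Function.Injective cs.simple := by
  intro i j h
  by_contra hij
  have := simple_mul_pow_eq_one_imp cs hij (n := 1) (by simp [h])
  exact M.off_diagonal i j hij (Nat.dvd_one.1 this)

end Geometric

/-! ### The exchange and deletion conditions -/

section Exchange

variable {B W : Type*} [Group W] {M : CoxeterMatrix B} (cs : CoxeterSystem M W)

open List CoxeterSystem

theorem prod_map_alternatingWord {N : Type*} [Monoid N] (f : B → N) (i j : B) (m : ℕ) :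
    ((alternatingWord i j (2 * m)).map f).prod = (f i * f j) ^ m := by
  induction m with
  | zero => simp [alternatingWord]
  | succ m ih =>
    rw [Nat.mul_succ, alternatingWord_succ, alternatingWord_succ]
    simp [ih, pow_succ]

theorem reverse_alternatingWord (i j : B) (m : ℕ) :
    (alternatingWord i j (2 * m)).reverse = alternatingWord j i (2 * m) := by
  induction m with
  | zero => simp [alternatingWord]
  | succ m ih =>
    have e : 2 * (m + 1) = 2 * m + 1 + 1 := by ring
    rw [e, alternatingWord_succ, alternatingWord_succ, alternatingWord_succ',
      alternatingWord_succ']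
    simp [ih]

open Classical in
/-- A simple reflection acting on `W × ℤ/2` by conjugation, with the sign changed at itself. -/
def signedConj (i : B) : Function.End (W × ZMod 2) := fun x =>
  (cs.simple i * x.1 * cs.simple i, x.2 + if x.1 = cs.simple i then 1 else 0)

-- The sign coordinate counts, modulo 2, how often a reflection occurs among the right inversions of
-- the word. As soon as the operators define an action of `W`, this parity depends only on the
-- product of the word, which is the source of the exchange condition.
open Classical in
theorem prod_signedConj (ω : List B) (x : W × ZMod 2) :
    (ω.map (signedConj cs)).prod x =
      (cs.wordProd ω * x.1 * (cs.wordProd ω)⁻¹, x.2 + ((cs.rightInvSeq ω).count x.1 : ZMod 2)) := by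
  induction ω with
  | nil => simp [Function.End.one_def]
  | cons i ω ih =>
    rw [List.map_cons, List.prod_cons, Function.End.mul_def]
    change signedConj cs i ((ω.map (signedConj cs)).prod x) = _
    rw [ih]
    simp only [signedConj, wordProd_cons, rightInvSeq, List.count_cons]
    refine Prod.ext (by simp [mul_assoc]) ?_
    have : (cs.wordProd ω * x.1 * (cs.wordProd ω)⁻¹ = cs.simple i) ↔
        ((cs.wordProd ω)⁻¹ * cs.simple i * cs.wordProd ω = x.1) := by
      constructor
      · intro h; rw [← h]; group
      · intro h; rw [← h]; group
    simp [this, add_assoc]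

-- The inversion sequence of the relator `(st)^m` consists of `2m` reflections whose second half
-- repeats the first, because `(st)^m = 1`.
open Classical in
theorem even_count_alternatingWord (i j : B) (t : W) :
    Even ((cs.rightInvSeq (alternatingWord i j (2 * M i j))).count t) := by
  rw [← reverse_alternatingWord, rightInvSeq_reverse, List.count_reverse]
  generalize hl : cs.leftInvSeq (alternatingWord j i (2 * M i j)) = l
  have hlen : l.length = 2 * M i j := by rw [← hl]; simp
  have hget : ∀ k (hk : k < l.length), l[k] = cs.wordProd (alternatingWord i j (2 * k + 1)) := by
    subst hl
    intro k hk
    exact getElem_leftInvSeq_alternatingWord cs j i (M i j) k (by simpa using hk)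
  have hdrop : l.drop (M i j) = l.take (M i j) := by
    apply List.ext_getElem
    · simp; omega
    · intro k h1 h2
      rw [List.getElem_drop, List.getElem_take, hget, hget, prod_alternatingWord_eq_mul_pow,
        prod_alternatingWord_eq_mul_pow]
      have e1 : (2 * (M i j + k) + 1) / 2 = M i j + k := by omega
      have e2 : (2 * k + 1) / 2 = k := by omega
      have o1 : ¬ Even (2 * (M i j + k) + 1) := by simp
      have o2 : ¬ Even (2 * k + 1) := by simp
      rw [e1, e2, if_neg o1, if_neg o2, pow_add, cs.simple_mul_simple_pow, one_mul]
  rw [← List.take_append_drop (M i j) l, hdrop, List.count_append]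
  exact ⟨_, rfl⟩

theorem signedConj_liftable : M.IsLiftable (signedConj cs) := by
  classical
  intro i j
  rw [← prod_map_alternatingWord]
  funext x
  rw [prod_signedConj, (ZMod.natCast_eq_zero_iff_even).2 (even_count_alternatingWord cs i j x.1)]
  have : cs.wordProd (alternatingWord i j (2 * M i j)) = 1 := by
    rw [wordProd, prod_map_alternatingWord, cs.simple_mul_simple_pow]
  simp [this, Function.End.one_def]

open Classical in
theorem count_rightInvSeq_eq {ω ω' : List B} (h : cs.wordProd ω = cs.wordProd ω') (t : W) :
    ((cs.rightInvSeq ω).count t : ZMod 2) = ((cs.rightInvSeq ω').count t : ZMod 2) := by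
  have key : ∀ ω : List B, (ω.map (signedConj cs)).prod =
      cs.lift ⟨_, signedConj_liftable cs⟩ (cs.wordProd ω) := by
    intro ω
    rw [wordProd, map_list_prod, List.map_map]
    congr 1
    apply List.map_congr_left
    intro i _
    simp
  have h2 := congrFun ((key ω).trans ((congrArg _ h).trans (key ω').symm)) (t, 0)
  rw [prod_signedConj, prod_signedConj] at h2
  simpa using congrArg Prod.snd h2

/-- The exchange condition, for right multiplication and an arbitrary word. -/
theorem exchange_right {ω : List B} {i : B}
    (h : cs.length (cs.wordProd ω * cs.simple i) < cs.length (cs.wordProd ω)) :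
    ∃ j < ω.length, cs.wordProd ω * cs.simple i = cs.wordProd (ω.eraseIdx j) := by
  classical
  suffices hm : cs.simple i ∈ cs.rightInvSeq ω by
    obtain ⟨j, hj, hj'⟩ := List.mem_iff_getElem.1 hm
    refine ⟨j, by simpa using hj, ?_⟩
    rw [← wordProd_mul_getD_rightInvSeq, List.getD_eq_getElem _ _ hj, hj']
  by_contra hm
  obtain ⟨ρ, hρ, hρ'⟩ := cs.exists_isReduced (cs.wordProd ω * cs.simple i)
  -- A reduced word `ρ` of `ws`, followed by `s`, is another word for `w`. Conjugation by `s` fixes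
  -- `s`, so its inversion sequence contains `s` once more than that of `ρ`. If `s` did not occur
  -- for `ω`, it would occur for `ρ`, making `w` shorter than `ws`.
  have hc := count_rightInvSeq_eq cs (ω := ω) (ω' := ρ.concat i)
    (by rw [wordProd_concat, ← hρ']; simp) (cs.simple i)
  have hcount : ((cs.rightInvSeq ρ).map (MulAut.conj (cs.simple i))).count (cs.simple i) =
      (cs.rightInvSeq ρ).count (cs.simple i) := by
    have := List.count_map_of_injective (cs.rightInvSeq ρ) (MulAut.conj (cs.simple i))
      (MulAut.conj (cs.simple i)).injective (cs.simple i)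
    simpa using this
  rw [List.count_eq_zero_of_not_mem hm, rightInvSeq_concat, List.concat_eq_append,
    List.count_append, hcount] at hc
  have hmem : cs.simple i ∈ cs.rightInvSeq ρ := by
    by_contra h'
    rw [List.count_eq_zero_of_not_mem h'] at hc
    simp at hc
  have := (cs.isRightInversion_of_mem_rightInvSeq hρ hmem).2
  rw [← hρ'] at this
  simp at this
  omega

/-- The exchange condition, for left multiplication and an arbitrary word. -/
theorem exchange_left {ω : List B} {i : B}
    (h : cs.length (cs.simple i * cs.wordProd ω) < cs.length (cs.wordProd ω)) :
    ∃ j < ω.length, cs.simple i * cs.wordProd ω = cs.wordProd (ω.eraseIdx j) := by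
  have h' : cs.length (cs.wordProd ω.reverse * cs.simple i) < cs.length (cs.wordProd ω.reverse) := by
    rw [← cs.length_inv, wordProd_reverse, cs.length_inv (cs.wordProd ω)]
    simpa using h
  obtain ⟨j, hj, e⟩ := exchange_right cs h'
  rw [List.length_reverse] at hj
  refine ⟨ω.length - j - 1, by omega, ?_⟩
  have e' := congrArg (·⁻¹) e
  simp only [mul_inv_rev, inv_simple, ← wordProd_reverse, List.reverse_reverse] at e'
  rw [e', List.eraseIdx_eq_take_drop_succ, List.eraseIdx_eq_take_drop_succ, List.reverse_append,
    List.take_reverse, List.drop_reverse, List.reverse_reverse, List.reverse_reverse]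
  congr 3
  omega

theorem isReduced_eraseIdx {ω : List B} {j : ℕ} (hj : j < ω.length) (hω : cs.IsReduced ω)
    (h : cs.length (cs.wordProd ω) ≤ cs.length (cs.wordProd (ω.eraseIdx j)) + 1) :
    cs.IsReduced (ω.eraseIdx j) := by
  have h1 := cs.length_wordProd_le (ω.eraseIdx j)
  have h2 := List.length_eraseIdx_add_one hj
  have h3 : cs.length (cs.wordProd ω) = ω.length := hω
  change cs.length _ = _
  omega

/-- The deletion condition. -/
theorem exists_reduced_sublist (ω : List B) :
    ∃ ω' : List B, ω'.Sublist ω ∧ cs.IsReduced ω' ∧ cs.wordProd ω' = cs.wordProd ω := by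
  induction ω with
  | nil => exact ⟨[], List.Sublist.refl _, by simp [CoxeterSystem.IsReduced], rfl⟩
  | cons i ω ih =>
    obtain ⟨ρ, hs, hr, hp⟩ := ih
    rcases cs.length_simple_mul (cs.wordProd ρ) i with h | h
    · refine ⟨i :: ρ, hs.cons_cons i, ?_, by rw [wordProd_cons, wordProd_cons, hp]⟩
      have h3 : cs.length (cs.wordProd ρ) = ρ.length := hr
      simp [CoxeterSystem.IsReduced, wordProd_cons, h, h3]
    · obtain ⟨j, hj, e⟩ := exchange_left cs (ω := ρ) (i := i) (by omega)
      refine ⟨ρ.eraseIdx j, ((List.eraseIdx_sublist ρ j).trans hs).trans (List.sublist_cons_self _ _),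
        isReduced_eraseIdx cs hj hr (by rw [← e]; omega), ?_⟩
      rw [← e, hp, wordProd_cons]

end Exchange

/-! ### Parabolic subgroups and their cosets -/

section Parabolic

variable {B W : Type*} [Group W] {M : CoxeterMatrix B} (cs : CoxeterSystem M W)

open CoxeterSystem

theorem isReduced_iff {ω : List B} : cs.IsReduced ω ↔ cs.length (cs.wordProd ω) = ω.length :=
  Iff.rfl

theorem isReduced_append_left {ω ρ : List B} (h : cs.IsReduced (ω ++ ρ)) : cs.IsReduced ω := by
  simpa using h.take ω.length

theorem isReduced_append_right {ω ρ : List B} (h : cs.IsReduced (ω ++ ρ)) : cs.IsReduced ρ := by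
  simpa using h.drop ω.length

theorem isReduced_append_iff {ω ρ : List B} (hω : cs.IsReduced ω) (hρ : cs.IsReduced ρ) :
    cs.IsReduced (ω ++ ρ) ↔ cs.length (cs.wordProd ω * cs.wordProd ρ) =
      cs.length (cs.wordProd ω) + cs.length (cs.wordProd ρ) := by
  rw [isReduced_iff] at *
  rw [wordProd_append, hω, hρ, List.length_append]

variable {cs} {I : Finset B}

theorem simple_mem_parabolic {i : B} (hi : i ∈ I) : cs.simple i ∈ parabolic cs I :=
  Subgroup.subset_closure ⟨i, hi, rfl⟩

theorem wordProd_mem_parabolic {ω : List B} (h : ∀ i ∈ ω, i ∈ I) :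
    cs.wordProd ω ∈ parabolic cs I := by
  apply Subgroup.list_prod_mem
  intro x hx
  obtain ⟨i, hi, rfl⟩ := List.mem_map.1 hx
  exact simple_mem_parabolic (h i hi)

theorem exists_reduced_word_of_mem_parabolic {w : W} (hw : w ∈ parabolic cs I) :
    ∃ ω : List B, (∀ i ∈ ω, i ∈ I) ∧ cs.IsReduced ω ∧ cs.wordProd ω = w := by
  suffices h : ∃ ω : List B, (∀ i ∈ ω, i ∈ I) ∧ cs.wordProd ω = w by
    obtain ⟨ω, h1, rfl⟩ := h
    obtain ⟨ρ, h2, h3, h4⟩ := exists_reduced_sublist cs ω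
    exact ⟨ρ, fun i hi => h1 i (h2.subset hi), h3, h4⟩
  induction hw using Subgroup.closure_induction with
  | mem x hx =>
    obtain ⟨i, hi, rfl⟩ := hx
    exact ⟨[i], by simpa using hi, by simp⟩
  | one => exact ⟨[], by simp, by simp⟩
  | mul x y _ _ hx hy =>
    obtain ⟨ω, h1, rfl⟩ := hx
    obtain ⟨ρ, h2, rfl⟩ := hy
    refine ⟨ω ++ ρ, fun i hi => ?_, wordProd_append _ _ _⟩
    rcases List.mem_append.1 hi with h | h
    · exact h1 i h
    · exact h2 i h
  | inv x _ hx =>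
    obtain ⟨ω, h1, rfl⟩ := hx
    exact ⟨ω.reverse, fun i hi => h1 i (List.mem_reverse.1 hi), wordProd_reverse _ _⟩

theorem simple_mem_parabolic_iff {i : B} : cs.simple i ∈ parabolic cs I ↔ i ∈ I := by
  refine ⟨fun h => ?_, simple_mem_parabolic⟩
  obtain ⟨ω, h1, h2, h3⟩ := exists_reduced_word_of_mem_parabolic h
  rw [isReduced_iff, h3, length_simple] at h2
  obtain ⟨j, rfl⟩ := List.length_eq_one_iff.1 h2.symm
  rw [wordProd_singleton] at h3
  rw [← simple_injective cs h3]
  exact h1 j (by simp)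

/-- The letters of every reduced expression of an element of `W_I` lie in `I`. -/
theorem mem_of_isReduced_of_mem_parabolic {ω : List B} (hω : cs.IsReduced ω)
    (h : cs.wordProd ω ∈ parabolic cs I) : ∀ i ∈ ω, i ∈ I := by
  induction ω with
  | nil => simp
  | cons i ω ih =>
    have hr : cs.IsReduced ω := isReduced_append_right cs (ω := [i]) hω
    obtain ⟨ρ, h1, h2, h3⟩ := exists_reduced_word_of_mem_parabolic h
    -- Cancelling the first letter amounts to deleting a letter from the word `ρ` in `I`, so the
    -- tail again lies in `W_I`; hence so does the first letter.
    obtain ⟨j, hj, e⟩ := exchange_left cs (ω := ρ) (i := i) (by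
      rw [h3, wordProd_cons, simple_mul_simple_cancel_left, ← wordProd_cons, hω.eq, hr.eq]
      simp)
    have hmem : cs.wordProd ω ∈ parabolic cs I := by
      rw [h3, wordProd_cons, simple_mul_simple_cancel_left] at e
      rw [e]
      exact wordProd_mem_parabolic fun k hk => h1 k ((List.eraseIdx_sublist ρ j).subset hk)
    have hi : cs.simple i ∈ parabolic cs I := by
      rw [wordProd_cons] at h
      exact (Subgroup.mul_mem_cancel_right _ hmem).1 h
    intro k hk
    rcases List.mem_cons.1 hk with rfl | hk
    · exact simple_mem_parabolic_iff.1 hi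
    · exact ih hr hmem k hk

/-- Apply the exchange condition to the concatenation of reduced words of `d` and `v`. The deleted
letter cannot belong to `v`, for then `v * s` would be shorter than `v`; so it is removed from `d`.
-/
theorem exchange_of_length_mul {d v : W} {i : B} (h1 : cs.length (d * v) = cs.length d + cs.length v)
    (h2 : cs.length v < cs.length (v * cs.simple i))
    (h3 : cs.length (d * v * cs.simple i) < cs.length (d * v)) :
    ∃ d', cs.length d' < cs.length d ∧ d * v * cs.simple i = d' * v := by
  obtain ⟨δ, hδ, rfl⟩ := cs.exists_isReduced d
  obtain ⟨ν, hν, rfl⟩ := cs.exists_isReduced v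
  rw [← wordProd_append] at h3
  obtain ⟨j, hj, e⟩ := exchange_right cs h3
  by_cases hjδ : j < δ.length
  · rw [List.eraseIdx_append_of_lt_length hjδ, wordProd_append, wordProd_append] at e
    refine ⟨_, ?_, e⟩
    have := cs.length_wordProd_le (δ.eraseIdx j)
    have := List.length_eraseIdx_add_one hjδ
    rw [hδ.eq]
    omega
  · rw [List.eraseIdx_append_of_length_le (by omega), wordProd_append, wordProd_append,
      mul_assoc, mul_left_cancel_iff] at e
    rw [e] at h2
    have := cs.length_wordProd_le (ν.eraseIdx (j - δ.length))
    rw [List.length_append] at hj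
    have := List.length_eraseIdx_add_one (l := ν) (i := j - δ.length) (by omega)
    rw [hν.eq] at h2
    omega

/-- Lengths add up in `d W_I`, if `d` is of minimal length. -/
theorem length_mul_of_minimal {d : W} (hd : ∀ v ∈ parabolic cs I, cs.length d ≤ cs.length (d * v))
    {v : W} (hv : v ∈ parabolic cs I) : cs.length (d * v) = cs.length d + cs.length v := by
  obtain ⟨ω, h1, h2, rfl⟩ := exists_reduced_word_of_mem_parabolic hv
  clear hv
  induction ω using List.reverseRecOn with
  | nil => simp
  | append_singleton ω i ih =>
    have hr := isReduced_append_left cs h2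
    have ih' := ih (fun k hk => h1 k (by simp [hk])) hr
    have hlt : cs.length (cs.wordProd ω) + 1 = cs.length (cs.wordProd ω * cs.simple i) := by
      have := h2.eq
      rw [wordProd_append, wordProd_singleton] at this
      rw [this, hr.eq]
      simp
    rw [wordProd_append, wordProd_singleton, ← mul_assoc]
    rcases cs.length_mul_simple (d * cs.wordProd ω) i with h | h
    · omega
    · exfalso
      obtain ⟨d', hd', e⟩ := exchange_of_length_mul ih' (by omega) (i := i) (by omega)
      -- With `v` the product of `ω`, the element `v s v⁻¹` of `W_I` would carry `d` to the shorter
      -- `d'`, against minimality.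
      have hm : cs.wordProd ω * cs.simple i * (cs.wordProd ω)⁻¹ ∈ parabolic cs I := by
        have a : cs.wordProd ω ∈ parabolic cs I :=
          wordProd_mem_parabolic fun k hk => h1 k (by simp [hk])
        exact mul_mem (mul_mem a (simple_mem_parabolic (h1 i (by simp)))) (inv_mem a)
      have := hd _ hm
      rw [← mul_assoc, ← mul_assoc, e, mul_inv_cancel_right] at this
      omega

theorem exists_minimal_mul (I : Finset B) (w : W) : ∃ d v : W, w = d * v ∧ v ∈ parabolic cs I ∧
    ∀ v ∈ parabolic cs I, cs.length d ≤ cs.length (d * v) := by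
  classical
  have hex : ∃ n, ∃ v ∈ parabolic cs I, cs.length (w * v) = n := ⟨_, 1, one_mem _, rfl⟩
  obtain ⟨v, hv, hv'⟩ := Nat.find_spec hex
  refine ⟨w * v, v⁻¹, by simp, inv_mem hv, fun u hu => ?_⟩
  rw [hv', mul_assoc]
  exact Nat.find_min' hex ⟨v * u, mul_mem hv hu, rfl⟩

theorem minimal_unique {d d' v v' : W}
    (hd : ∀ v ∈ parabolic cs I, cs.length d ≤ cs.length (d * v))
    (hd' : ∀ v ∈ parabolic cs I, cs.length d' ≤ cs.length (d' * v))
    (hv : v ∈ parabolic cs I) (hv' : v' ∈ parabolic cs I) (h : d * v = d' * v') :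
    d = d' ∧ v = v' := by
  have hx : v * v'⁻¹ ∈ parabolic cs I := mul_mem hv (inv_mem hv')
  have e : d' = d * (v * v'⁻¹) := by rw [← mul_assoc, h, mul_inv_cancel_right]
  have h1 := length_mul_of_minimal hd hx
  rw [← e] at h1
  have h2 := hd' _ (inv_mem hx)
  rw [e, mul_inv_cancel_right, ← e] at h2
  have h3 : v * v'⁻¹ = 1 := cs.length_eq_zero_iff.1 (by omega)
  rw [h3, mul_one] at e
  exact ⟨e.symm, mul_inv_eq_one.1 h3⟩

/-! ### Longest elements -/

/-- If every letter of `I` is a descent of `w`, a reduced word in `I` can be stripped from the right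
of `w` letter by letter, each step shortening it by the exchange argument. So every element of `W_I`
is a right factor of `w` with lengths adding up; in particular this holds for the longest element.
-/
theorem length_mul_of_descents {w : W}
    (hw : ∀ i ∈ I, cs.length (w * cs.simple i) < cs.length w) {v : W}
    (hv : v ∈ parabolic cs I) : cs.length (w * v⁻¹) + cs.length v = cs.length w := by
  obtain ⟨ω, h1, h2, rfl⟩ := exists_reduced_word_of_mem_parabolic hv
  clear hv
  induction ω using List.reverseRecOn with
  | nil => simp
  | append_singleton ω i ih =>
    have hr := isReduced_append_left cs h2
    have ih' := ih (fun k hk => h1 k (by simp [hk])) hr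
    have hlt : cs.length (cs.wordProd ω) + 1 = cs.length (cs.wordProd ω * cs.simple i) := by
      have := h2.eq
      rw [wordProd_append, wordProd_singleton] at this
      rw [this, hr.eq]
      simp
    obtain ⟨d', hd', e⟩ := exchange_of_length_mul (cs := cs) (d := w * (cs.wordProd ω)⁻¹)
      (v := cs.wordProd ω) (i := i) (by rw [inv_mul_cancel_right]; omega) (by omega) (by
        rw [inv_mul_cancel_right]; exact hw i (h1 i (by simp)))
    rw [wordProd_append, wordProd_singleton]
    have e' : w * (cs.wordProd ω * cs.simple i)⁻¹ = d' := by
      rw [inv_mul_cancel_right] at e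
      rw [mul_inv_rev, inv_simple, ← mul_assoc, e, mul_inv_cancel_right]
    have := cs.length_le_length_mul_add_right w (cs.wordProd ω * cs.simple i)⁻¹
    rw [cs.length_inv] at this
    rw [e'] at this ⊢
    omega

end Parabolic

section Longest

variable {B W : Type*} [Group W] {M : CoxeterMatrix B} {cs : CoxeterSystem M W} {I : Finitary cs}

theorem exists_isLongest (I : Finitary cs) : ∃ w, IsLongest I w := by
  obtain ⟨w, hw⟩ := Finite.exists_max fun w : I.group => cs.length (w : W)
  exact ⟨w, w.2, fun v hv => hw ⟨v, hv⟩⟩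

theorem IsLongest.length_mul_simple_lt {w : W} (hw : IsLongest I w) {i : B} (hi : i ∈ I.carrier) :
    cs.length (w * cs.simple i) < cs.length w :=
  lt_of_le_of_ne (hw.2 _ (mul_mem hw.1 (simple_mem_parabolic hi))) (cs.length_mul_simple_ne w i)

theorem IsLongest.length_mul {w : W} (hw : IsLongest I w) {v : W} (hv : v ∈ I.group) :
    cs.length (w * v⁻¹) + cs.length v = cs.length w :=
  length_mul_of_descents (fun _ hi => hw.length_mul_simple_lt hi) hv

theorem IsLongest.eq_of_length_le {w v : W} (hw : IsLongest I w) (hv : v ∈ I.group)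
    (h : cs.length w ≤ cs.length v) : v = w := by
  have h1 := hw.length_mul hv
  have h2 : w * v⁻¹ = 1 := cs.length_eq_zero_iff.1 (by omega)
  exact (mul_inv_eq_one.1 h2).symm

theorem IsLongest.unique {w v : W} (hw : IsLongest I w) (hv : IsLongest I v) : v = w :=
  hw.eq_of_length_le hv.1 (hv.2 _ hw.1)

end Longest

/-! ### Dihedral subgroups and the word property -/

section Dihedral

variable {B W : Type*} [Group W] {M : CoxeterMatrix B} (cs : CoxeterSystem M W)

open CoxeterSystem

theorem length_wordProd_mod_two (ω : List B) :
    cs.length (cs.wordProd ω) % 2 = ω.length % 2 := by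
  induction ω with
  | nil => simp
  | cons i ω ih =>
    rw [wordProd_cons, length_mul_mod_two, length_simple, List.length_cons]
    omega

theorem mem_alternatingWord {i j : B} {m : ℕ} : ∀ k ∈ alternatingWord i j m, k = i ∨ k = j := by
  induction m generalizing i j with
  | zero => simp [alternatingWord]
  | succ m ih =>
    intro k hk
    rw [alternatingWord_succ, List.concat_eq_append, List.mem_append, List.mem_singleton] at hk
    rcases hk with hk | hk
    · exact (ih k hk).symm
    · exact Or.inr hk

theorem pow_mul_pow_swap (i j : B) (n : ℕ) :
    (cs.simple i * cs.simple j) ^ n * (cs.simple j * cs.simple i) ^ n = 1 := by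
  have : cs.simple j * cs.simple i = (cs.simple i * cs.simple j)⁻¹ := by simp
  rw [this, inv_pow, mul_inv_cancel]

theorem mod_two_eq_of_wordProd_eq {ω ρ : List B} (h : cs.wordProd ω = cs.wordProd ρ) :
    ω.length % 2 = ρ.length % 2 := by
  rw [← length_wordProd_mod_two cs, h, length_wordProd_mod_two cs]

/-- The two words end in different letters, so bringing one of them to the other side produces an
alternating word of length `k + l`, which is even by the sign character. -/
theorem pow_eq_one_of_alternatingWord_swap {i j : B} {k l : ℕ}
    (h : cs.wordProd (alternatingWord i j k) = cs.wordProd (alternatingWord j i l)) :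
    k % 2 = l % 2 ∧ (cs.simple i * cs.simple j) ^ ((k + l) / 2) = 1 := by
  have hp := mod_two_eq_of_wordProd_eq cs h
  rw [length_alternatingWord, length_alternatingWord] at hp
  refine ⟨hp, ?_⟩
  rw [prod_alternatingWord_eq_mul_pow, prod_alternatingWord_eq_mul_pow] at h
  by_cases hk : Even k
  · have hl : Even l := by rw [Nat.even_iff] at *; omega
    rw [if_pos hk, if_pos hl, one_mul, one_mul] at h
    have e : (k + l) / 2 = l / 2 + k / 2 := by rw [Nat.even_iff] at *; omega
    rw [e, pow_add, h, pow_mul_pow_swap]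
  · have hl : ¬ Even l := by rw [Nat.even_iff] at *; omega
    rw [if_neg hk, if_neg hl] at h
    have e : (k + l) / 2 = l / 2 + (k / 2 + 1) := by rw [Nat.even_iff] at *; omega
    rw [e, pow_add, pow_succ' _ (k / 2), mul_assoc (cs.simple i), h,
      simple_mul_simple_cancel_left, pow_mul_pow_swap]

/-- Here the words end in the same letter and the common tail cancels, leaving an alternating word
of length `k - l`. -/
theorem pow_eq_one_of_alternatingWord {i j : B} {k l : ℕ} (hkl : l ≤ k)
    (h : cs.wordProd (alternatingWord i j k) = cs.wordProd (alternatingWord i j l)) :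
    k % 2 = l % 2 ∧ (cs.simple i * cs.simple j) ^ ((k - l) / 2) = 1 := by
  have hp := mod_two_eq_of_wordProd_eq cs h
  rw [length_alternatingWord, length_alternatingWord] at hp
  refine ⟨hp, ?_⟩
  rw [prod_alternatingWord_eq_mul_pow, prod_alternatingWord_eq_mul_pow] at h
  have hev : Even k ↔ Even l := by rw [Nat.even_iff, Nat.even_iff]; omega
  have h' : (cs.simple i * cs.simple j) ^ (k / 2) = (cs.simple i * cs.simple j) ^ (l / 2) := by
    by_cases hk : Even k
    · simpa [hk, hev.1 hk] using h
    · simpa [hk, mt hev.2 hk] using h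
  have e : k / 2 = (k - l) / 2 + l / 2 := by omega
  rw [e, pow_add] at h'
  exact mul_eq_right.1 h'

theorem concat_eq_alternatingWord {i x : B} {ω : List B} (hω : cs.IsReduced (ω ++ [x]))
    (h : ω = alternatingWord i x ω.length ∨ ω = alternatingWord x i ω.length) :
    ω ++ [x] = alternatingWord i x (ω ++ [x]).length := by
  have key : ω = alternatingWord x i ω.length := by
    rcases h with e | e
    · generalize hn : ω.length = n at e
      cases n with
      | zero => rw [e]; rfl
      | succ n =>
        exfalso
        rw [alternatingWord_succ, List.concat_eq_append] at e
        have h1 := hω.eq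
        rw [wordProd_append, e, wordProd_append, wordProd_singleton,
          simple_mul_simple_cancel_right] at h1
        have := cs.length_wordProd_le (alternatingWord x i n)
        simp at h1 this
        omega
    · exact e
  rw [List.length_append, List.length_singleton, alternatingWord_succ, ← key,
    List.concat_eq_append]

theorem eq_alternatingWord_of_isReduced {i j : B} {ω : List B} (hω : cs.IsReduced ω)
    (h : ∀ k ∈ ω, k = i ∨ k = j) :
    ω = alternatingWord i j ω.length ∨ ω = alternatingWord j i ω.length := by
  induction ω using List.reverseRecOn with
  | nil => simp [alternatingWord]
  | append_singleton ω x ih =>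
    have ih' := ih (isReduced_append_left cs hω) (fun k hk => h k (by simp [hk]))
    rcases h x (by simp) with rfl | rfl
    · exact Or.inr (concat_eq_alternatingWord cs hω ih'.symm)
    · exact Or.inl (concat_eq_alternatingWord cs hω ih')

/-- By deletion there is a reduced subsequence with the same product, and it is again alternating.
If it were strictly shorter, comparing the two words would give a trivial power of `s_i s_j` with a
positive exponent that is too small for the order. -/
theorem isReduced_alternatingWord {i j : B} (hij : i ≠ j) {k : ℕ}
    (hk : M i j = 0 ∨ k ≤ M i j) : cs.IsReduced (alternatingWord i j k) := by
  obtain ⟨ρ, h1, h2, h3⟩ := exists_reduced_sublist cs (alternatingWord i j k)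
  have hlen := h1.length_le
  rw [length_alternatingWord] at hlen
  rcases hlen.eq_or_lt with he | hlt
  · rw [isReduced_iff, ← h3, h2.eq, he, length_alternatingWord]
  exfalso
  rcases eq_alternatingWord_of_isReduced cs h2 (fun x hx => mem_alternatingWord x (h1.subset hx))
    with e | e
  · rw [e] at h3
    obtain ⟨h4, h5⟩ := pow_eq_one_of_alternatingWord cs hlen h3.symm
    have h6 := simple_mul_pow_eq_one_imp cs hij h5
    have h7 := Nat.le_of_dvd (by omega) h6
    rcases hk with hk | hk
    · rw [hk, zero_dvd_iff] at h6
      omega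
    · omega
  · rw [e] at h3
    obtain ⟨h4, h5⟩ := pow_eq_one_of_alternatingWord_swap cs h3.symm
    have h6 := simple_mul_pow_eq_one_imp cs hij h5
    have h7 := Nat.le_of_dvd (by omega) h6
    rcases hk with hk | hk
    · rw [hk, zero_dvd_iff] at h6
      omega
    · omega

/-- Two alternating words of the same positive length with the same product have length `M i j`, if
they are reduced. -/
theorem eq_of_alternatingWord_swap {i j : B} (hij : i ≠ j) {n : ℕ} (hn : 0 < n)
    (hr : cs.IsReduced (alternatingWord i j n))
    (h : cs.wordProd (alternatingWord i j n) = cs.wordProd (alternatingWord j i n)) :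
    n = M i j := by
  obtain ⟨-, h5⟩ := pow_eq_one_of_alternatingWord_swap cs h
  rw [show (n + n) / 2 = n by omega] at h5
  have h6 := simple_mul_pow_eq_one_imp cs hij h5
  have h0 : M i j ≠ 0 := by
    intro h0
    rw [h0, zero_dvd_iff] at h6
    omega
  have h7 : ¬ n > M i j := fun h' => cs.not_isReduced_alternatingWord i j h0 h' hr
  have := Nat.le_of_dvd hn h6
  omega

theorem eq_of_wordProd_alternatingWord {i j : B} (hij : i ≠ j) {k l : ℕ} (hk : k < M i j)
    (hl : l < M i j)
    (h : cs.wordProd (alternatingWord i j k) = cs.wordProd (alternatingWord j i l)) :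
    k = 0 ∧ l = 0 := by
  obtain ⟨h4, h5⟩ := pow_eq_one_of_alternatingWord_swap cs h
  have h6 := simple_mul_pow_eq_one_imp cs hij h5
  have h7 := Nat.eq_zero_of_dvd_of_lt h6 (by omega)
  omega

/-- If `i ≠ j` are right descents of `w`, then `w = d w_{i,j}` with lengths adding up. -/
theorem exists_eq_mul_braidWord {i j : B} (hij : i ≠ j) {w : W}
    (hi : cs.length (w * cs.simple i) < cs.length w)
    (hj : cs.length (w * cs.simple j) < cs.length w) :
    M i j ≠ 0 ∧ ∃ δ : List B, w = cs.wordProd (δ ++ braidWord M i j) ∧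
      cs.IsReduced (δ ++ braidWord M i j) := by
  classical
  obtain ⟨d, v, rfl, hv, hd⟩ := exists_minimal_mul (cs := cs) {i, j} w
  have hdv : ∀ {x}, x ∈ parabolic cs {i, j} → cs.length (d * x) = cs.length d + cs.length x :=
    fun hx => length_mul_of_minimal hd hx
  have mi : cs.simple i ∈ parabolic cs {i, j} := simple_mem_parabolic (by simp)
  have mj : cs.simple j ∈ parabolic cs {i, j} := simple_mem_parabolic (by simp)
  -- The dihedral factor `v` inherits both descents of `w`. For each of them it has a reduced
  -- alternating word ending in that letter, and two such words of equal length force the length to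
  -- be `M i j`.
  have key : ∀ x y : B, ({x, y} : Finset B) = {i, j} →
      cs.length (v * cs.simple x) < cs.length v →
      cs.IsReduced (alternatingWord y x (cs.length v)) ∧
        cs.wordProd (alternatingWord y x (cs.length v)) = v := by
    intro x y hxy hlt
    have mx : cs.simple x ∈ parabolic cs {i, j} := by
      rw [← hxy]; exact simple_mem_parabolic (by simp)
    obtain ⟨ω, h1, h2, h3⟩ := exists_reduced_word_of_mem_parabolic (mul_mem hv mx)
    have hl : cs.length (v * cs.simple x) + 1 = cs.length v := by
      rcases cs.length_mul_simple v x with h | h <;> omega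
    have h4 : cs.wordProd (ω ++ [x]) = v := by
      rw [wordProd_append, h3, wordProd_singleton, simple_mul_simple_cancel_right]
    have h5 : cs.IsReduced (ω ++ [x]) := by
      rw [isReduced_iff, h4, List.length_append, ← h2.eq, h3]
      exact hl.symm
    have h6 := concat_eq_alternatingWord cs h5 (i := y) (eq_alternatingWord_of_isReduced cs h2
      (fun k hk => by
        have := h1 k hk
        rw [← hxy] at this
        simpa [or_comm] using this))
    rw [← h5.eq, h4] at h6
    rw [← h6]
    exact ⟨h5, h4⟩
  rw [mul_assoc, hdv (mul_mem hv mi), hdv hv] at hi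
  rw [mul_assoc, hdv (mul_mem hv mj), hdv hv] at hj
  have ki := key i j rfl (by omega)
  have kj := key j i (Finset.pair_comm _ _) (by omega)
  have hn := eq_of_alternatingWord_swap cs hij (by omega) kj.1 (kj.2.trans ki.2.symm)
  obtain ⟨δ, h1, rfl⟩ := cs.exists_isReduced d
  refine ⟨by omega, δ, ?_, ?_⟩
  · rw [wordProd_append, braidWord, ← hn, kj.2]
  · rw [braidWord, ← hn, isReduced_append_iff cs h1 kj.1, kj.2]
    exact hdv hv

/-- Matsumoto's theorem: a family of elements of a monoid that satisfies the braid relations has the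
same product along any two reduced expressions of an element. -/
theorem prod_map_eq_of_isReduced {N : Type*} [Monoid N] (f : B → N)
    (hf : ∀ i j, ((braidWord M i j).map f).prod = ((braidWord M j i).map f).prod)
    {ω ρ : List B} (hω : cs.IsReduced ω) (hρ : cs.IsReduced ρ)
    (h : cs.wordProd ω = cs.wordProd ρ) : (ω.map f).prod = (ρ.map f).prod := by
  have hlen : ω.length = ρ.length := by rw [← hω.eq, h, hρ.eq]
  induction hn : ω.length generalizing ω ρ with
  | zero =>
    rw [List.length_eq_zero_iff.1 hn, List.length_eq_zero_iff.1 (hlen.symm.trans hn)]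
  | succ n ih =>
    obtain ⟨a, i, rfl⟩ : ∃ a i, ω = a ++ [i] :=
      ⟨_, _, (List.dropLast_append_getLast (by rintro rfl; simp at hn)).symm⟩
    obtain ⟨b, j, rfl⟩ : ∃ b j, ρ = b ++ [j] :=
      ⟨_, _, (List.dropLast_append_getLast (by rintro rfl; simp at hn hlen)).symm⟩
    have ha := isReduced_append_left cs hω
    have hb := isReduced_append_left cs hρ
    simp only [List.length_append, List.length_singleton, Nat.add_right_cancel_iff] at hlen hn
    simp only [List.map_append, List.prod_append, List.map_singleton, List.prod_singleton]
    by_cases hij : i = j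
    · subst hij
      rw [wordProd_append, wordProd_append, mul_right_cancel_iff] at h
      rw [ih ha hb h hlen hn]
    -- If the last letters differ, both are descents, so there are reduced words `δ ++ braidWord`
    -- for either order of the letters. Each given word shares its last letter with one of these,
    -- where induction applies, and the two are exchanged by the braid relation for `f`.
    · have step : ∀ {c : List B} {k l : B} {δ : List B}, k ≠ l → M l k ≠ 0 → cs.IsReduced (c ++ [k]) →
          c.length = n → cs.wordProd (c ++ [k]) = cs.wordProd (δ ++ braidWord M l k) →
          cs.IsReduced (δ ++ braidWord M l k) →
          (c.map f).prod * f k = (δ.map f).prod * ((braidWord M l k).map f).prod := by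
        intro c k l δ hkl h0 h1 h2 h3 h4
        obtain ⟨m, hm⟩ := Nat.exists_eq_succ_of_ne_zero h0
        rw [braidWord, hm, Nat.succ_eq_add_one, alternatingWord_succ, List.concat_eq_append,
          ← List.append_assoc] at h3 h4
        rw [wordProd_append, wordProd_append _ _ [k], mul_right_cancel_iff] at h3
        have hc := isReduced_append_left cs h1
        have hd := isReduced_append_left cs h4
        have := ih hc hd h3 (by rw [← hc.eq, h3, hd.eq]) h2
        rw [this, braidWord, hm, Nat.succ_eq_add_one, alternatingWord_succ, List.concat_eq_append]
        simp [mul_assoc]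
      have di : cs.length (cs.wordProd (a ++ [i]) * cs.simple i) <
          cs.length (cs.wordProd (a ++ [i])) := by
        rw [hω.eq, wordProd_append, wordProd_singleton, simple_mul_simple_cancel_right, ha.eq]
        simp
      have dj : cs.length (cs.wordProd (a ++ [i]) * cs.simple j) <
          cs.length (cs.wordProd (a ++ [i])) := by
        rw [h, hρ.eq, wordProd_append, wordProd_singleton, simple_mul_simple_cancel_right, hb.eq]
        simp
      obtain ⟨h0, δ, h1, h2⟩ := exists_eq_mul_braidWord cs hij di dj
      have h0' : M j i ≠ 0 := by rwa [M.symmetric]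
      have e : cs.wordProd (δ ++ braidWord M j i) = cs.wordProd (δ ++ braidWord M i j) := by
        rw [wordProd_append, wordProd_append, cs.wordProd_braidWord_eq]
      have h3 : cs.IsReduced (δ ++ braidWord M j i) := by
        rw [isReduced_iff, e, h2.eq]
        simp [M.symmetric i j]
      rw [step hij h0' hω hn (h1.trans e.symm) h3, hf,
        step (Ne.symm hij) h0 hρ (hlen.symm.trans hn) (h.symm.trans h1) h2]

end Dihedral

/-! ### Multiplication rules in the Hecke algebra -/

section HeckeBasic

variable {B : Type*} {M : CoxeterMatrix B}

theorem Hecke.gen_mul_gen (s : B) : Hecke.gen M s * Hecke.gen M s =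
    ((Polynomial.X : ℤ[X]) - 1) • Hecke.gen M s + (Polynomial.X : ℤ[X]) • 1 := by
  have h := RingQuot.mkAlgHom_rel ℤ[X] (HeckeRel.quad (M := M) s)
  rw [map_mul, map_add, map_smul, map_smul, map_one] at h
  exact h

theorem Hecke.braid (s t : B) :
    ((CoxeterSystem.braidWord M s t).map (Hecke.gen M)).prod =
      ((CoxeterSystem.braidWord M t s).map (Hecke.gen M)).prod := by
  have h := RingQuot.mkAlgHom_rel ℤ[X] (HeckeRel.braid (M := M) s t)
  rw [map_list_prod, map_list_prod, List.map_map, List.map_map] at h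
  exact h

section Lift

variable {C : Type*} [Ring C] [Algebra ℤ[X] C] (f : B → C)
  (hq : ∀ s, f s * f s = ((Polynomial.X : ℤ[X]) - 1) • f s + (Polynomial.X : ℤ[X]) • 1)
  (hb : ∀ s t, ((CoxeterSystem.braidWord M s t).map f).prod =
    ((CoxeterSystem.braidWord M t s).map f).prod)

/-- The universal property of the Hecke algebra. -/
def Hecke.lift : Hecke M →ₐ[ℤ[X]] C :=
  RingQuot.liftAlgHom ℤ[X] ⟨FreeAlgebra.lift ℤ[X] f, by
    intro x y h
    cases h with
    | quad s => simpa using hq s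
    | braid s t =>
      have := hb s t
      rw [map_list_prod, map_list_prod, List.map_map, List.map_map]
      have e : (⇑(FreeAlgebra.lift ℤ[X] f) ∘ FreeAlgebra.ι ℤ[X]) = f := by funext x; simp
      rwa [e]⟩

theorem Hecke.lift_gen (s : B) : Hecke.lift f hq hb (Hecke.gen M s) = f s := by
  rw [Hecke.lift, Hecke.gen]
  erw [RingQuot.liftAlgHom_mkAlgHom_apply]
  simp

end Lift

theorem Hecke.induction {p : Hecke M → Prop} (halg : ∀ r : ℤ[X], p (algebraMap ℤ[X] _ r))
    (hgen : ∀ s, p (Hecke.gen M s)) (hmul : ∀ a b, p a → p b → p (a * b))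
    (hadd : ∀ a b, p a → p b → p (a + b)) (h : Hecke M) : p h := by
  obtain ⟨x, rfl⟩ := RingQuot.mkAlgHom_surjective ℤ[X] (HeckeRel M) h
  induction x using FreeAlgebra.induction with
  | grade0 r => rw [AlgHom.commutes]; exact halg r
  | grade1 s => exact hgen s
  | mul a b ha hb => rw [map_mul]; exact hmul _ _ ha hb
  | add a b ha hb => rw [map_add]; exact hadd _ _ ha hb

end HeckeBasic

section HeckeBasis

variable {B W : Type*} [Group W] {M : CoxeterMatrix B} (cs : CoxeterSystem M W)

open CoxeterSystem

theorem basisT_wordProd {ω : List B} (hω : cs.IsReduced ω) :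
    basisT cs (cs.wordProd ω) = (ω.map (Hecke.gen M)).prod := by
  have h := (cs.exists_isReduced (cs.wordProd ω)).choose_spec
  exact prod_map_eq_of_isReduced cs (Hecke.gen M) Hecke.braid h.1 hω h.2.symm

theorem basisT_one : basisT cs 1 = 1 := by
  simpa using basisT_wordProd cs (ω := []) (by simp [isReduced_iff])

theorem basisT_simple (i : B) : basisT cs (cs.simple i) = Hecke.gen M i := by
  simpa using basisT_wordProd cs (ω := [i]) (by simp [isReduced_iff])

theorem basisT_mul {v w : W} (h : cs.length (v * w) = cs.length v + cs.length w) :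
    basisT cs v * basisT cs w = basisT cs (v * w) := by
  obtain ⟨ω, h1, rfl⟩ := cs.exists_isReduced v
  obtain ⟨ρ, h2, rfl⟩ := cs.exists_isReduced w
  rw [basisT_wordProd cs h1, basisT_wordProd cs h2, ← wordProd_append, basisT_wordProd cs
    ((isReduced_append_iff cs h1 h2).2 h), List.map_append, List.prod_append]

theorem gen_mul_basisT_of_lt {i : B} {w : W} (h : cs.length w < cs.length (cs.simple i * w)) :
    Hecke.gen M i * basisT cs w = basisT cs (cs.simple i * w) := by
  rw [← basisT_simple cs, basisT_mul]
  rw [length_simple]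
  rcases cs.length_simple_mul w i with h' | h' <;> omega

theorem gen_mul_basisT_of_gt {i : B} {w : W} (h : cs.length (cs.simple i * w) < cs.length w) :
    Hecke.gen M i * basisT cs w = ((Polynomial.X : ℤ[X]) - 1) • basisT cs w +
      (Polynomial.X : ℤ[X]) • basisT cs (cs.simple i * w) := by
  have e := gen_mul_basisT_of_lt cs (i := i) (w := cs.simple i * w)
    (by rwa [simple_mul_simple_cancel_left])
  rw [simple_mul_simple_cancel_left] at e
  rw [← e, ← mul_assoc, Hecke.gen_mul_gen, add_mul, smul_mul_assoc, smul_mul_assoc, one_mul]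

theorem sum_parabolic_simple_mul {A : Type*} [AddCommMonoid A] {I : Finitary cs} {i : B}
    (hi : i ∈ I.carrier) (f : W → A) :
    ∑ w : I.group, f (cs.simple i * w) = ∑ w : I.group, f w :=
  Fintype.sum_equiv (Equiv.mulLeft (⟨cs.simple i, simple_mem_parabolic hi⟩ : I.group)) _ _
    fun _ => rfl

/-- Left multiplication by `T_s` has `T_w + T_{sw}` as eigenvector with eigenvalue `q`. In place of
a splitting of `W_I` into pairs, a pointwise identity is summed whose correction terms `g`,
supported on the descents, cancel after the reindexing `w ↦ sw`. -/
theorem gen_mul_xElt {I : Finitary cs} {i : B} (hi : i ∈ I.carrier) :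
    Hecke.gen M i * xElt I = (Polynomial.X : ℤ[X]) • xElt I := by
  classical
  set g : W → Hecke M := fun w => if cs.length w < cs.length (cs.simple i * w) then 0 else
    basisT cs w with hg
  have key : ∀ w : W, Hecke.gen M i * basisT cs w + g w + (Polynomial.X : ℤ[X]) • g (cs.simple i * w)
      = g (cs.simple i * w) + (Polynomial.X : ℤ[X]) • g w +
        (Polynomial.X : ℤ[X]) • basisT cs (cs.simple i * w) := by
    intro w
    simp only [hg, simple_mul_simple_cancel_left]
    by_cases h : cs.length w < cs.length (cs.simple i * w)
    · rw [if_pos h, if_neg h.le.not_gt, gen_mul_basisT_of_lt cs h]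
      simp
    · have h' := lt_of_le_of_ne (not_lt.1 h) (cs.length_simple_mul_ne w i)
      rw [if_neg h, if_pos h', gen_mul_basisT_of_gt cs h', sub_smul, one_smul]
      simp
      abel
  have hsum := Finset.sum_congr (rfl : (Finset.univ : Finset I.group) = Finset.univ)
    fun w _ => key (w : W)
  simp only [Finset.sum_add_distrib, ← Finset.smul_sum, ← Finset.mul_sum] at hsum
  rw [sum_parabolic_simple_mul cs hi g, sum_parabolic_simple_mul cs hi (basisT cs)] at hsum
  have e : Hecke.gen M i * ∑ w : I.group, basisT cs (w : W) + (∑ w : I.group, g w +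
      (Polynomial.X : ℤ[X]) • ∑ w : I.group, g w) = (Polynomial.X : ℤ[X]) •
      ∑ w : I.group, basisT cs (w : W) + (∑ w : I.group, g w +
      (Polynomial.X : ℤ[X]) • ∑ w : I.group, g w) := by
    rw [← add_assoc, hsum]; abel
  exact add_right_cancel e

theorem basisT_mul_xElt {I : Finitary cs} {w : W} (hw : w ∈ I.group) :
    basisT cs w * xElt I = (Polynomial.X : ℤ[X]) ^ cs.length w • xElt I := by
  obtain ⟨ω, h1, h2, rfl⟩ := exists_reduced_word_of_mem_parabolic hw
  rw [basisT_wordProd cs h2, h2.eq]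
  clear h2 hw
  induction ω with
  | nil => simp
  | cons i ω ih =>
    rw [List.map_cons, List.prod_cons, mul_assoc, ih fun k hk => h1 k (by simp [hk]),
      mul_smul_comm, gen_mul_xElt cs (h1 i (by simp)), smul_smul, List.length_cons, pow_succ]

variable {cs}

theorem inv_mem_shortest_iff {I : Finitary cs} {d : W} :
    d⁻¹ ∈ shortest I ↔ ∀ v ∈ I.group, cs.length d ≤ cs.length (d * v) := by
  constructor
  · intro h v hv
    have := h v⁻¹ (inv_mem hv)
    rwa [← mul_inv_rev, cs.length_inv, cs.length_inv] at this
  · intro h v hv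
    have := h v⁻¹ (inv_mem hv)
    rwa [← cs.length_inv d, ← cs.length_inv (d * v⁻¹), mul_inv_rev, inv_inv] at this

theorem parabolic_mono {I J : Finset B} (h : I ⊆ J) : parabolic cs I ≤ parabolic cs J :=
  Subgroup.closure_mono (Set.image_mono (by exact_mod_cast h))

open Classical in
/-- The minimal representatives of the cosets `w W_I` in `W_J`. -/
def minReps (J I : Finitary cs) : Finset W :=
  {w ∈ Finset.univ.image (Subtype.val : J.group → W) | w⁻¹ ∈ shortest I}

theorem mem_minReps {J I : Finitary cs} {d : W} : d ∈ minReps J I ↔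
    d ∈ J.group ∧ ∀ v ∈ I.group, cs.length d ≤ cs.length (d * v) := by
  classical
  rw [minReps, Finset.mem_filter, inv_mem_shortest_iff]
  simp

theorem hElt_eq_sum (J I : Finitary cs) : hElt J I = ∑ d ∈ minReps J I, basisT cs d := by
  classical
  refine Finset.sum_congr ?_ fun _ _ => rfl
  ext d
  rw [mem_minReps, Finset.mem_filter, inv_mem_shortest_iff]
  refine and_congr_left fun _ => ?_
  change d ∈ (Finset.univ : Finset J.group).sup (fun a => ({(a : W)} : Finset W)) ↔ _
  simp

theorem sum_minReps_mul {A : Type*} [AddCommMonoid A] {I J : Finitary cs}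
    (h : I.carrier ⊆ J.carrier) (f : W → A) :
    ∑ d ∈ minReps J I, ∑ v : I.group, f (d * v) = ∑ w : J.group, f w := by
  classical
  rw [← Finset.sum_product']
  have hIJ := parabolic_mono (cs := cs) h
  refine Finset.sum_bij (fun x hx => ⟨x.1 * x.2,
    mul_mem (mem_minReps.1 (Finset.mem_product.1 hx).1).1 (hIJ x.2.2)⟩)
    (fun _ _ => Finset.mem_univ _) ?_ ?_ ?_
  · rintro ⟨d, v⟩ h1 ⟨d', v'⟩ h2 he
    have he' : (d : W) * v = d' * v' := congrArg Subtype.val he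
    obtain ⟨a, b⟩ := minimal_unique (mem_minReps.1 (Finset.mem_product.1 h1).1).2
      (mem_minReps.1 (Finset.mem_product.1 h2).1).2 v.2 v'.2 he'
    exact Prod.ext a (Subtype.ext b)
  · intro w _
    obtain ⟨d, v, e, hv, hd⟩ := exists_minimal_mul (cs := cs) I.carrier (w : W)
    have hdJ : d ∈ J.group := by
      have : d = w * v⁻¹ := by rw [e, mul_inv_cancel_right]
      rw [this]
      exact mul_mem w.2 (inv_mem (hIJ hv))
    exact ⟨(d, ⟨v, hv⟩), Finset.mem_product.2 ⟨mem_minReps.2 ⟨hdJ, hd⟩, Finset.mem_univ _⟩,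
      Subtype.ext e.symm⟩
  · intro _ _
    rfl

/-- Every element of `W_J` is uniquely `d v` with `d` minimal in its coset and `v ∈ W_I`, and then
`T_d T_v = T_{dv}` because lengths add up. Most relations between the splitting maps come down to
this identity. -/
theorem hElt_mul_xElt {I J : Finitary cs} (h : I.carrier ⊆ J.carrier) :
    hElt J I * xElt I = xElt J := by
  rw [xElt, xElt, ← sum_minReps_mul h, hElt_eq_sum, Finset.sum_mul]
  refine Finset.sum_congr rfl fun d hd => ?_
  rw [Finset.mul_sum]
  refine Finset.sum_congr rfl fun v _ => ?_
  rw [basisT_mul]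
  exact length_mul_of_minimal (mem_minReps.1 hd).2 v.2

theorem poincare_eq_mul {I J : Finitary cs} (h : I.carrier ⊆ J.carrier) :
    poincare J = (∑ d ∈ minReps J I, Polynomial.X ^ cs.length d) * poincare I := by
  rw [poincare, poincare,
    ← sum_minReps_mul h fun w => (Polynomial.X : ℤ[X]) ^ cs.length w, Finset.sum_mul]
  refine Finset.sum_congr rfl fun d hd => ?_
  rw [Finset.mul_sum]
  refine Finset.sum_congr rfl fun v _ => ?_
  rw [← pow_add, length_mul_of_minimal (mem_minReps.1 hd).2 v.2]

/-- Left multiplication with `π(I) h_{J,I}` is multiplication with `π(J)` on `x_J H_q`. -/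
theorem poincare_smul_hElt_mul_xElt {I J : Finitary cs} (h : I.carrier ⊆ J.carrier) :
    poincare I • (hElt J I * xElt J) = poincare J • xElt J := by
  rw [poincare_eq_mul h, mul_comm, mul_smul, hElt_eq_sum, Finset.sum_mul, Finset.sum_smul]
  congr 1
  exact Finset.sum_congr rfl fun d hd => basisT_mul_xElt cs (mem_minReps.1 hd).1

theorem mem_parabolic_singleton {i : B} {w : W} :
    w ∈ parabolic cs {i} ↔ w = 1 ∨ w = cs.simple i := by
  constructor
  · intro h
    induction h using Subgroup.closure_induction with
    | mem x hx => simp at hx; exact Or.inr hx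
    | one => exact Or.inl rfl
    | mul x y _ _ hx hy => rcases hx with rfl | rfl <;> rcases hy with rfl | rfl <;> simp
    | inv x _ hx => rcases hx with rfl | rfl <;> simp
  · rintro (rfl | rfl)
    · exact one_mem _
    · exact simple_mem_parabolic (by simp)

theorem sum_singletonΛ {A : Type*} [AddCommMonoid A] (i : B) (f : W → A) :
    ∑ w : (singletonΛ cs i).group, f w = f (cs.simple i) + f 1 := by
  classical
  have hu : (Finset.univ : Finset (singletonΛ cs i).group) =
      {⟨cs.simple i, simple_mem_parabolic (by simp [singletonΛ])⟩, 1} := by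
    ext ⟨w, hw⟩
    have := mem_parabolic_singleton.1 hw
    simp only [Finset.mem_univ, Finset.mem_insert, Finset.mem_singleton, true_iff]
    rcases this with rfl | rfl
    · right; rfl
    · left; rfl
  rw [hu, Finset.sum_insert, Finset.sum_singleton]
  · rfl
  · rw [Finset.mem_singleton]
    intro h
    have h' : cs.simple i = 1 := congrArg Subtype.val h
    simpa using congrArg cs.length h'

theorem xElt_singletonΛ (i : B) : xElt (singletonΛ cs i) = Hecke.klGen M i := by
  rw [xElt, sum_singletonΛ, basisT_simple, basisT_one, Hecke.klGen]

theorem poincare_singletonΛ (i : B) : poincare (singletonΛ cs i) = Polynomial.X + 1 := by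
  rw [poincare, sum_singletonΛ i fun w => (Polynomial.X : ℤ[X]) ^ cs.length w]
  simp

theorem eq_one_of_mem_emptyΛ {w : W} (hw : w ∈ (emptyΛ cs).group) : w = 1 := by
  have : parabolic cs (emptyΛ cs).carrier = ⊥ := by simp [parabolic, emptyΛ]
  exact Subgroup.mem_bot.1 (this.le hw)

theorem sum_emptyΛ {A : Type*} [AddCommMonoid A] (f : W → A) :
    ∑ w : (emptyΛ cs).group, f w = f 1 := by
  rw [Finset.sum_eq_single 1]
  · rfl
  · rintro ⟨w, hw⟩ _ h
    exact absurd (Subtype.ext (eq_one_of_mem_emptyΛ hw)) h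
  · intro h
    exact absurd (Finset.mem_univ _) h

theorem xElt_emptyΛ : xElt (emptyΛ cs) = 1 := by
  rw [xElt, sum_emptyΛ, basisT_one]

theorem poincare_emptyΛ : poincare (emptyΛ cs) = 1 := by
  rw [poincare, sum_emptyΛ fun w => (Polynomial.X : ℤ[X]) ^ cs.length w]
  simp

end HeckeBasis

/-! ### The regular representation and the linear independence of the `T_w` -/

section Regular

variable {B W : Type*} [Group W] {M : CoxeterMatrix B} (cs : CoxeterSystem M W)

open CoxeterSystem

/-- The action of a generator on the free module on `W`, from the left. -/
def leftOp (i : B) : Module.End ℤ[X] (W →₀ ℤ[X]) :=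
  Finsupp.linearCombination ℤ[X] fun w =>
    if cs.length w < cs.length (cs.simple i * w) then Finsupp.single (cs.simple i * w) 1 else
      ((Polynomial.X : ℤ[X]) - 1) • Finsupp.single w 1 +
        (Polynomial.X : ℤ[X]) • Finsupp.single (cs.simple i * w) 1

/-- The action of a generator on the free module on `W`, from the right. -/
def rightOp (i : B) : Module.End ℤ[X] (W →₀ ℤ[X]) :=
  Finsupp.linearCombination ℤ[X] fun w =>
    if cs.length w < cs.length (w * cs.simple i) then Finsupp.single (w * cs.simple i) 1 else
      ((Polynomial.X : ℤ[X]) - 1) • Finsupp.single w 1 +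
        (Polynomial.X : ℤ[X]) • Finsupp.single (w * cs.simple i) 1

variable {cs}

theorem leftOp_of_lt {i : B} {w : W} (h : cs.length w < cs.length (cs.simple i * w)) :
    leftOp cs i (Finsupp.single w 1) = Finsupp.single (cs.simple i * w) 1 := by
  simp [leftOp, h]

theorem leftOp_of_gt {i : B} {w : W} (h : ¬ cs.length w < cs.length (cs.simple i * w)) :
    leftOp cs i (Finsupp.single w 1) = ((Polynomial.X : ℤ[X]) - 1) • Finsupp.single w 1 +
        (Polynomial.X : ℤ[X]) • Finsupp.single (cs.simple i * w) 1 := by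
  rw [leftOp, Finsupp.linearCombination_single, if_neg h, one_smul]

theorem rightOp_of_lt {i : B} {w : W} (h : cs.length w < cs.length (w * cs.simple i)) :
    rightOp cs i (Finsupp.single w 1) = Finsupp.single (w * cs.simple i) 1 := by
  simp [rightOp, h]

theorem rightOp_of_gt {i : B} {w : W} (h : ¬ cs.length w < cs.length (w * cs.simple i)) :
    rightOp cs i (Finsupp.single w 1) = ((Polynomial.X : ℤ[X]) - 1) • Finsupp.single w 1 +
        (Polynomial.X : ℤ[X]) • Finsupp.single (w * cs.simple i) 1 := by
  rw [rightOp, Finsupp.linearCombination_single, if_neg h, one_smul]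

theorem lt_simple_mul_iff (i : B) (w : W) : cs.length (cs.simple i * w) <
    cs.length (cs.simple i * (cs.simple i * w)) ↔ ¬ cs.length w < cs.length (cs.simple i * w) := by
  rw [simple_mul_simple_cancel_left]
  have := cs.length_simple_mul_ne w i
  omega

theorem lt_mul_simple_iff (i : B) (w : W) : cs.length (w * cs.simple i) <
    cs.length (w * cs.simple i * cs.simple i) ↔ ¬ cs.length w < cs.length (w * cs.simple i) := by
  rw [simple_mul_simple_cancel_right]
  have := cs.length_mul_simple_ne w i
  omega

/-- Exchange in the word of `w s_j` when `s_i` shortens it: the deleted letter cannot lie in `w`,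
since `s_i` lengthens `w`, so it is the final `j`. -/
theorem simple_mul_eq_mul_simple {i j : B} {w : W}
    (h1 : cs.length w < cs.length (cs.simple i * w))
    (h2 : ¬ cs.length (w * cs.simple j) < cs.length (cs.simple i * (w * cs.simple j))) :
    cs.simple i * w = w * cs.simple j := by
  rcases cs.length_mul_simple w j with h | h
  · obtain ⟨ω, hω, rfl⟩ := cs.exists_isReduced w
    have h3 := lt_of_le_of_ne (not_lt.1 h2) (cs.length_simple_mul_ne _ i)
    rw [← wordProd_singleton cs j, ← wordProd_append] at h3
    obtain ⟨k, hk, e⟩ := exchange_left cs h3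
    by_cases hkω : k < ω.length
    · exfalso
      rw [List.eraseIdx_append_of_lt_length hkω, wordProd_append, wordProd_append, ← mul_assoc,
        mul_right_cancel_iff] at e
      rw [e, hω.eq] at h1
      have := cs.length_wordProd_le (ω.eraseIdx k)
      have := List.length_eraseIdx_add_one hkω
      omega
    · have hk' : k - ω.length = 0 := by simp at hk; omega
      rw [List.eraseIdx_append_of_length_le (by omega), hk', wordProd_append] at e
      simp only [List.eraseIdx_zero, List.tail_cons, List.append_nil, wordProd_singleton] at e
      conv_rhs => rw [← e]
      simp [mul_assoc]
  · exfalso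
    have h3 := cs.length_mul_le (cs.simple i * (w * cs.simple j)) (cs.simple j)
    rw [← mul_assoc, simple_mul_simple_cancel_right, length_simple, mul_assoc] at h3
    omega

theorem lt_simple_mul_mul_simple_iff {i j : B} {w : W} (h : cs.simple i * w ≠ w * cs.simple j) :
    cs.length (w * cs.simple j) < cs.length (cs.simple i * (w * cs.simple j)) ↔
      cs.length w < cs.length (cs.simple i * w) := by
  constructor
  · intro h1
    by_contra h2
    apply h
    have := simple_mul_eq_mul_simple (i := i) (j := j) h1 (by simpa using h2)
    rw [simple_mul_simple_cancel_right] at this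
    conv_rhs => rw [← this]
    simp [mul_assoc]
  · intro h1
    by_contra h2
    exact h (simple_mul_eq_mul_simple h1 h2)

theorem lt_mul_simple_simple_mul_iff {i j : B} {w : W} (h : cs.simple i * w ≠ w * cs.simple j) :
    cs.length (cs.simple i * w) < cs.length (cs.simple i * w * cs.simple j) ↔
      cs.length w < cs.length (w * cs.simple j) := by
  have h' : cs.simple j * w⁻¹ ≠ w⁻¹ * cs.simple i := by
    intro e
    apply h
    have := congrArg (·⁻¹) e
    simpa using this.symm
  have key := lt_simple_mul_mul_simple_iff h'
  rw [← cs.length_inv w, ← cs.length_inv (w * cs.simple j), ← cs.length_inv (cs.simple i * w),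
    ← cs.length_inv (cs.simple i * w * cs.simple j)]
  simpa using key

/-- Right multiplication by `s_j` changes whether `s_i` is a left ascent of `w` only if `s_i w = w
s_j`, and in that case both operators act on `w` by the same formula. Otherwise the ascents on the
two sides are independent and the operators visibly commute. -/
theorem leftOp_rightOp (i j : B) (x : W →₀ ℤ[X]) :
    leftOp cs i (rightOp cs j x) = rightOp cs j (leftOp cs i x) := by
  suffices h : leftOp cs i ∘ₗ rightOp cs j = rightOp cs j ∘ₗ leftOp cs i from
    LinearMap.congr_fun h x
  refine Finsupp.lhom_ext' fun w => LinearMap.ext_ring ?_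
  simp only [LinearMap.comp_apply, Finsupp.lsingle_apply]
  by_cases e : cs.simple i * w = w * cs.simple j
  · by_cases h : cs.length w < cs.length (cs.simple i * w)
    · have h' : cs.length w < cs.length (w * cs.simple j) := by rwa [← e]
      rw [leftOp_of_lt h, rightOp_of_lt h', ← e, leftOp_of_gt (by rw [lt_simple_mul_iff]; simpa), e,
        rightOp_of_gt (by rw [lt_mul_simple_iff]; simpa), simple_mul_simple_cancel_right, ← e,
        simple_mul_simple_cancel_left]
    · have h' : ¬ cs.length w < cs.length (w * cs.simple j) := by rwa [← e]
      rw [leftOp_of_gt h, rightOp_of_gt h', map_add, map_add, map_smul, map_smul, map_smul, map_smul,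
        leftOp_of_gt h, rightOp_of_gt h', ← e, leftOp_of_lt (by rwa [lt_simple_mul_iff]), e,
        rightOp_of_lt (by rwa [lt_mul_simple_iff]), simple_mul_simple_cancel_right, ← e,
        simple_mul_simple_cancel_left]
  · have h1 := lt_simple_mul_mul_simple_iff e
    have h2 := lt_mul_simple_simple_mul_iff e
    by_cases hl : cs.length w < cs.length (cs.simple i * w) <;>
    by_cases hr : cs.length w < cs.length (w * cs.simple j)
    · rw [leftOp_of_lt hl, rightOp_of_lt hr, leftOp_of_lt (h1.2 hl), rightOp_of_lt (h2.2 hr),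
        mul_assoc]
    · rw [leftOp_of_lt hl, rightOp_of_gt hr, map_add, map_smul, map_smul, leftOp_of_lt hl,
        leftOp_of_lt (h1.2 hl), rightOp_of_gt (mt h2.1 hr), mul_assoc]
    · rw [leftOp_of_gt hl, rightOp_of_lt hr, map_add, map_smul, map_smul, rightOp_of_lt hr,
        leftOp_of_gt (mt h1.1 hl), rightOp_of_lt (h2.2 hr), mul_assoc]
    · rw [leftOp_of_gt hl, rightOp_of_gt hr, map_add, map_smul, map_smul, map_add, map_smul, map_smul,
        leftOp_of_gt hl, rightOp_of_gt hr, leftOp_of_gt (mt h1.1 hl), rightOp_of_gt (mt h2.1 hr),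
        mul_assoc]
      module

theorem prod_leftOp_rightOp (ω : List B) (j : B) (x : W →₀ ℤ[X]) :
    (ω.map (leftOp cs)).prod (rightOp cs j x) = rightOp cs j ((ω.map (leftOp cs)).prod x) := by
  induction ω with
  | nil => simp
  | cons i ω ih => simp only [List.map_cons, List.prod_cons, Module.End.mul_apply, ih,
      leftOp_rightOp]

theorem prod_leftOp_one {ω : List B} (hω : cs.IsReduced ω) :
    (ω.map (leftOp cs)).prod (Finsupp.single 1 1) = Finsupp.single (cs.wordProd ω) 1 := by
  induction ω with
  | nil => simp
  | cons i ω ih =>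
    have hr : cs.IsReduced ω := isReduced_append_right cs (ω := [i]) hω
    rw [List.map_cons, List.prod_cons, Module.End.mul_apply, ih hr, leftOp_of_lt, wordProd_cons]
    rw [← wordProd_cons, hω.eq, hr.eq]
    simp

theorem leftOp_mul_leftOp (i : B) : leftOp cs i * leftOp cs i =
    ((Polynomial.X : ℤ[X]) - 1) • leftOp cs i + (Polynomial.X : ℤ[X]) • 1 := by
  refine Finsupp.lhom_ext' fun w => LinearMap.ext_ring ?_
  simp only [LinearMap.comp_apply, Finsupp.lsingle_apply, Module.End.mul_apply,
    LinearMap.add_apply, LinearMap.smul_apply, Module.End.one_apply]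
  by_cases h : cs.length w < cs.length (cs.simple i * w)
  · rw [leftOp_of_lt h, leftOp_of_gt (by rw [lt_simple_mul_iff]; simpa),
      simple_mul_simple_cancel_left]
  · rw [leftOp_of_gt h, map_add, map_smul, map_smul, leftOp_of_gt h,
      leftOp_of_lt (by rwa [lt_simple_mul_iff]), simple_mul_simple_cancel_left]

/-- Both products commute with the right operators and agree on the basis vector at `1`, from which
the right operators produce every other basis vector. In particular the left operators satisfy the
braid relations. -/
theorem prod_leftOp_eq {ω ρ : List B} (hω : cs.IsReduced ω) (hρ : cs.IsReduced ρ)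
    (h : cs.wordProd ω = cs.wordProd ρ) :
    (ω.map (leftOp cs)).prod = (ρ.map (leftOp cs)).prod := by
  refine Finsupp.lhom_ext' fun w => LinearMap.ext_ring ?_
  simp only [LinearMap.comp_apply, Finsupp.lsingle_apply]
  obtain ⟨ν, hν, rfl⟩ := cs.exists_isReduced w
  induction ν using List.reverseRecOn with
  | nil => rw [wordProd_nil, prod_leftOp_one hω, prod_leftOp_one hρ, h]
  | append_singleton ν j ih =>
    have hr := isReduced_append_left cs hν
    have e : Finsupp.single (cs.wordProd (ν ++ [j])) (1 : ℤ[X]) =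
        rightOp cs j (Finsupp.single (cs.wordProd ν) 1) := by
      rw [rightOp_of_lt, wordProd_append, wordProd_singleton]
      rw [← wordProd_singleton cs, ← wordProd_append, hν.eq, hr.eq]
      simp
    rw [e, prod_leftOp_rightOp, prod_leftOp_rightOp, ih hr]

variable (cs)

/-- The regular representation of the Hecke algebra. -/
def regularRep : Hecke M →ₐ[ℤ[X]] Module.End ℤ[X] (W →₀ ℤ[X]) :=
  Hecke.lift (leftOp cs) leftOp_mul_leftOp fun i j => by
    by_cases hij : i = j
    · rw [hij]
    · exact prod_leftOp_eq (isReduced_alternatingWord cs hij (Or.inr le_rfl))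
        (isReduced_alternatingWord cs (Ne.symm hij) (Or.inr le_rfl)) (cs.wordProd_braidWord_eq i j)

theorem regularRep_basisT (w : W) :
    regularRep cs (basisT cs w) (Finsupp.single 1 1) = Finsupp.single w 1 := by
  obtain ⟨ω, hω, rfl⟩ := cs.exists_isReduced w
  rw [basisT_wordProd cs hω, map_list_prod, List.map_map, ← prod_leftOp_one hω]
  congr 3
  funext i
  exact Hecke.lift_gen _ _ _ i

theorem linearIndependent_basisT : LinearIndependent ℤ[X] (basisT cs) := by
  have h : LinearIndependent ℤ[X] fun w : W => (Finsupp.single w 1 : W →₀ ℤ[X]) :=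
    Finsupp.basisSingleOne.linearIndependent
  refine LinearIndependent.of_comp
    ((LinearMap.applyₗ (Finsupp.single 1 1 : W →₀ ℤ[X])) ∘ₗ (regularRep cs).toLinearMap) ?_
  convert h using 1
  funext w
  exact regularRep_basisT cs w

end Regular

/-! ### Expansions of `x_I` along adapted reduced expressions -/

section SubwordProducts

variable {B W : Type*} [Group W] {M : CoxeterMatrix B} (cs : CoxeterSystem M W)

open CoxeterSystem

open Classical in
/-- The products of the subsequences of a word. -/
def subwordProds (ω : List B) : Finset W := (ω.sublists.map cs.wordProd).toFinset

variable {cs}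

theorem mem_subwordProds {ω : List B} {v : W} :
    v ∈ subwordProds cs ω ↔ ∃ y : List B, y.Sublist ω ∧ cs.wordProd y = v := by
  simp [subwordProds]

theorem mem_subwordProds_cons {i : B} {ω : List B} {v : W} :
    v ∈ subwordProds cs (i :: ω) ↔
      v ∈ subwordProds cs ω ∨ cs.simple i * v ∈ subwordProds cs ω := by
  simp only [mem_subwordProds]
  constructor
  · rintro ⟨y, hy, rfl⟩
    rcases List.sublist_cons_iff.1 hy with h | ⟨z, rfl, h⟩
    · exact Or.inl ⟨y, h, rfl⟩
    · exact Or.inr ⟨z, h, by simp [wordProd_cons]⟩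
  · rintro (⟨y, hy, rfl⟩ | ⟨y, hy, e⟩)
    · exact ⟨y, hy.cons i, rfl⟩
    · exact ⟨i :: y, hy.cons_cons i, by rw [wordProd_cons, e, simple_mul_simple_cancel_left]⟩

theorem simple_mul_mem_subwordProds {i : B} {ω : List B} {v : W} (hv : v ∈ subwordProds cs ω)
    (h : cs.length (cs.simple i * v) < cs.length v) : cs.simple i * v ∈ subwordProds cs ω := by
  obtain ⟨y, hy, rfl⟩ := mem_subwordProds.1 hv
  obtain ⟨j, -, e⟩ := exchange_left cs h
  exact mem_subwordProds.2 ⟨_, (List.eraseIdx_sublist y j).trans hy, e.symm⟩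

theorem mul_simple_mem_subwordProds {i : B} {ω : List B} {v : W} (hv : v ∈ subwordProds cs ω)
    (h : cs.length (v * cs.simple i) < cs.length v) : v * cs.simple i ∈ subwordProds cs ω := by
  obtain ⟨y, hy, rfl⟩ := mem_subwordProds.1 hv
  obtain ⟨j, -, e⟩ := exchange_right cs h
  exact mem_subwordProds.2 ⟨_, (List.eraseIdx_sublist y j).trans hy, e.symm⟩

theorem length_le_of_mem_subwordProds {ω : List B} {v : W} (hv : v ∈ subwordProds cs ω) :
    cs.length v ≤ ω.length := by
  obtain ⟨y, hy, rfl⟩ := mem_subwordProds.1 hv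
  exact (cs.length_wordProd_le y).trans hy.length_le

theorem mem_parabolic_of_mem_subwordProds {I : Finset B} {ω : List B} (hω : ∀ i ∈ ω, i ∈ I) {v : W}
    (hv : v ∈ subwordProds cs ω) : v ∈ parabolic cs I := by
  obtain ⟨y, hy, rfl⟩ := mem_subwordProds.1 hv
  exact wordProd_mem_parabolic fun i hi => hω i (hy.subset hi)

/-- Every element of `W_I` is the product of a subsequence of any expression of the longest one. -/
theorem mem_subwordProds_of_isLongest {I : Finitary cs} {ω : List B}
    (hω : IsLongest I (cs.wordProd ω)) {v : W} (hv : v ∈ I.group) : v ∈ subwordProds cs ω := by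
  induction hn : cs.length (cs.wordProd ω) - cs.length v generalizing v with
  | zero =>
    rw [hω.eq_of_length_le hv (by omega)]
    exact mem_subwordProds.2 ⟨ω, List.Sublist.refl _, rfl⟩
  | succ n ih =>
    -- If all letters of `I` were descents of `v`, then `v` would be at least as long as the longest
    -- element. So `v` can be lengthened inside `W_I`, and the deletion condition leads back from
    -- the longer element to `v`.
    obtain ⟨i, hi, hlt⟩ : ∃ i ∈ I.carrier, cs.length v < cs.length (v * cs.simple i) := by
      by_contra! h
      have := length_mul_of_descents (fun i hi => lt_of_le_of_ne (h i hi)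
        (cs.length_mul_simple_ne v i)) hω.1
      omega
    have hm := ih (mul_mem hv (simple_mem_parabolic hi)) (by
      rcases cs.length_mul_simple v i with h | h <;> omega)
    have := mul_simple_mem_subwordProds (i := i) hm (by
      rwa [simple_mul_simple_cancel_right])
    rwa [simple_mul_simple_cancel_right] at this

variable (cs)

/-- The span of the `T_v` with `v ∈ W_I` of length less than `k`. -/
def spanBelow (I : Finset B) (k : ℕ) : Submodule ℤ[X] (Hecke M) :=
  Submodule.span ℤ[X] (basisT cs '' {v | v ∈ parabolic cs I ∧ cs.length v < k})

variable {cs}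

theorem basisT_mem_spanBelow {I : Finset B} {k : ℕ} {v : W} (hv : v ∈ parabolic cs I)
    (hk : cs.length v < k) : basisT cs v ∈ spanBelow cs I k :=
  Submodule.subset_span ⟨v, ⟨hv, hk⟩, rfl⟩

theorem klGen_mul_basisT_of_lt {i : B} {w : W} (h : cs.length w < cs.length (cs.simple i * w)) :
    Hecke.klGen M i * basisT cs w = basisT cs w + basisT cs (cs.simple i * w) := by
  rw [Hecke.klGen, add_mul, one_mul, gen_mul_basisT_of_lt cs h, add_comm]

theorem klGen_mul_basisT_of_gt {i : B} {w : W} (h : ¬ cs.length w < cs.length (cs.simple i * w)) :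
    Hecke.klGen M i * basisT cs w =
      (Polynomial.X : ℤ[X]) • (basisT cs w + basisT cs (cs.simple i * w)) := by
  have h' := lt_of_le_of_ne (not_lt.1 h) (cs.length_simple_mul_ne w i)
  rw [Hecke.klGen, add_mul, one_mul, gen_mul_basisT_of_gt cs h']
  module

theorem klGen_mul_mem_spanBelow {I : Finset B} {k : ℕ} {i : B} (hi : i ∈ I) {x : Hecke M}
    (hx : x ∈ spanBelow cs I k) : Hecke.klGen M i * x ∈ spanBelow cs I (k + 1) := by
  induction hx using Submodule.span_induction with
  | mem x hx =>
    obtain ⟨v, ⟨hv, hk⟩, rfl⟩ := hx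
    have h1 : basisT cs v + basisT cs (cs.simple i * v) ∈ spanBelow cs I (k + 1) :=
      add_mem (basisT_mem_spanBelow hv (by omega))
        (basisT_mem_spanBelow (mul_mem (simple_mem_parabolic hi) hv) (by
          rcases cs.length_simple_mul v i with h | h <;> omega))
    by_cases h : cs.length v < cs.length (cs.simple i * v)
    · rwa [klGen_mul_basisT_of_lt h]
    · rw [klGen_mul_basisT_of_gt h]
      exact Submodule.smul_mem _ _ h1
  | zero => simp
  | add x y _ _ hx hy => rw [mul_add]; exact add_mem hx hy
  | smul r x _ hx => rw [mul_smul_comm]; exact Submodule.smul_mem _ _ hx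

/-- Modulo `q`, the product of the `x_s` along a word is the sum of the `T_v` over the products `v`
of its subsequences. -/
theorem prod_klGen_eq {I : Finset B} {ω : List B} (hω : ∀ i ∈ ω, i ∈ I) :
    ∃ n ∈ spanBelow cs I ω.length, (ω.map (Hecke.klGen M)).prod =
      ∑ v ∈ subwordProds cs ω, basisT cs v + (Polynomial.X : ℤ[X]) • n := by
  classical
  induction ω with
  | nil =>
    refine ⟨0, zero_mem _, ?_⟩
    have : subwordProds cs ([] : List B) = {1} := by simp [subwordProds]
    simp [this, basisT_one]
  | cons i ω ih =>
    obtain ⟨n, hn, e⟩ := ih fun k hk => hω k (by simp [hk])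
    have hiI := hω i (by simp)
    set S := subwordProds cs ω with hS
    set P : W → Prop := fun v => cs.length v < cs.length (cs.simple i * v) with hP
    have hPs : ∀ v, P (cs.simple i * v) ↔ ¬ P v := fun v => lt_simple_mul_iff i v
    have hdown : ∀ v ∈ S, ¬ P v → cs.simple i * v ∈ S := fun v hv h =>
      simple_mul_mem_subwordProds hv (lt_of_le_of_ne (not_lt.1 h) (cs.length_simple_mul_ne v i))
    -- The products of subsequences of `i :: ω` form `S ∪ sS`. As `S` is closed under passing from a
    -- non-ascent `v` to `sv`, this is the disjoint union of the ascents in `S` and their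
    -- translates. The ascents give `T_v + T_{sv}`; the other elements contribute multiples of `q`
    -- and go into the remainder.
    have hcons : subwordProds cs (i :: ω) =
        {v ∈ S | P v} ∪ {v ∈ S | P v}.image (cs.simple i * ·) := by
      ext v
      rw [mem_subwordProds_cons, Finset.mem_union, Finset.mem_image]
      simp only [Finset.mem_filter]
      constructor
      · rintro (h | h)
        · by_cases hv : P v
          · exact Or.inl ⟨h, hv⟩
          · exact Or.inr ⟨_, ⟨hdown v h hv, (hPs v).2 hv⟩, simple_mul_simple_cancel_left cs i⟩
        · by_cases hv : P (cs.simple i * v)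
          · exact Or.inr ⟨_, ⟨h, hv⟩, simple_mul_simple_cancel_left cs i⟩
          · have h' := hdown _ h hv
            rw [simple_mul_simple_cancel_left] at h'
            exact Or.inl ⟨h', not_not.1 (mt (hPs v).2 hv)⟩
      · rintro (⟨h, -⟩ | ⟨u, ⟨h, -⟩, rfl⟩)
        · exact Or.inl h
        · exact Or.inr (by rwa [simple_mul_simple_cancel_left])
    have hsum : ∑ v ∈ subwordProds cs (i :: ω), basisT cs v =
        ∑ v ∈ S with P v, (basisT cs v + basisT cs (cs.simple i * v)) := by
      rw [hcons, Finset.sum_union, Finset.sum_image (fun _ _ _ _ h => mul_left_cancel h),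
        Finset.sum_add_distrib]
      rw [Finset.disjoint_left]
      intro v hv hv'
      obtain ⟨u, hu, rfl⟩ := Finset.mem_image.1 hv'
      exact (hPs u).1 (Finset.mem_filter.1 hv).2 (Finset.mem_filter.1 hu).2
    refine ⟨∑ v ∈ S with ¬ P v, (basisT cs v + basisT cs (cs.simple i * v)) + Hecke.klGen M i * n,
      add_mem (Submodule.sum_mem _ fun v hv => ?_) (klGen_mul_mem_spanBelow hiI hn), ?_⟩
    · obtain ⟨h1, h2⟩ := Finset.mem_filter.1 hv
      have h3 := length_le_of_mem_subwordProds h1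
      have h4 := mem_parabolic_of_mem_subwordProds (fun k hk => hω k (by simp [hk])) h1
      exact add_mem (basisT_mem_spanBelow h4 (by simp; omega))
        (basisT_mem_spanBelow (mul_mem (simple_mem_parabolic hiI) h4) (by
          have := not_lt.1 h2
          simp; omega))
    · rw [List.map_cons, List.prod_cons, e, mul_add, Finset.mul_sum, mul_smul_comm, hsum, smul_add,
        ← add_assoc, ← Finset.sum_filter_add_sum_filter_not S P]
      congr 2
      · exact Finset.sum_congr rfl fun v hv => klGen_mul_basisT_of_lt (Finset.mem_filter.1 hv).2
      · rw [Finset.smul_sum]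
        exact Finset.sum_congr rfl fun v hv => klGen_mul_basisT_of_gt (Finset.mem_filter.1 hv).2

/-- Triangularity, by induction on the length: if `y` is a reduced subsequence with product `v`,
then `x_y` is `T_v` plus a combination of `T_u` with `u` shorter than `v`. Since `v` is not the
longest element, `y` is a proper subsequence. -/
theorem basisT_mem_span_prod_klGen {I : Finitary cs} {ω : List B} (hω : ∀ i ∈ ω, i ∈ I.carrier)
    (hl : IsLongest I (cs.wordProd ω)) {v : W} (hv : v ∈ I.group) (hne : v ≠ cs.wordProd ω) :
    basisT cs v ∈ Submodule.span ℤ[X]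
      ((fun y : List B => (y.map (Hecke.klGen M)).prod) '' {y | y.Sublist ω ∧ y ≠ ω}) := by
  classical
  induction hn : cs.length v using Nat.strong_induction_on generalizing v with
  | _ k ih =>
    obtain ⟨y₀, hy₀, e₀⟩ := mem_subwordProds.1 (mem_subwordProds_of_isLongest hl hv)
    obtain ⟨y, hy, hr, e⟩ := exists_reduced_sublist cs y₀
    have hvy : cs.wordProd y = v := e.trans e₀
    have hyω := hy.trans hy₀
    have hylen : y.length = k := by rw [← hr.eq, hvy, hn]
    have hyI : ∀ i ∈ y, i ∈ I.carrier := fun i hi => hω i (hyω.subset hi)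
    obtain ⟨n, hnm, hsum⟩ := prod_klGen_eq (cs := cs) hyI
    set P := Submodule.span ℤ[X]
      ((fun y : List B => (y.map (Hecke.klGen M)).prod) '' {y | y.Sublist ω ∧ y ≠ ω})
    have low : ∀ u ∈ I.group, cs.length u < k → basisT cs u ∈ P := by
      intro u hu huk
      refine ih _ huk hu ?_ rfl
      rintro rfl
      have := hl.2 v hv
      omega
    have hnP : n ∈ P := by
      refine Submodule.span_le.2 ?_ hnm
      rintro _ ⟨u, ⟨hu, huk⟩, rfl⟩
      exact low u hu (by omega)
    have hvS : v ∈ subwordProds cs y := mem_subwordProds.2 ⟨y, List.Sublist.refl _, hvy⟩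
    rw [← Finset.add_sum_erase _ _ hvS] at hsum
    have hT : basisT cs v = (y.map (Hecke.klGen M)).prod -
        ∑ u ∈ (subwordProds cs y).erase v, basisT cs u - (Polynomial.X : ℤ[X]) • n := by
      rw [hsum]; abel
    rw [hT]
    refine sub_mem (sub_mem (Submodule.subset_span ⟨y, ⟨hyω, ?_⟩, rfl⟩)
      (Submodule.sum_mem _ fun u hu => ?_)) (Submodule.smul_mem _ _ hnP)
    · rintro rfl
      exact hne hvy.symm
    · obtain ⟨hu1, hu2⟩ := Finset.mem_erase.1 hu
      refine low u (mem_parabolic_of_mem_subwordProds hyI hu2) ?_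
      obtain ⟨z, hz, rfl⟩ := mem_subwordProds.1 hu2
      refine lt_of_le_of_ne ((cs.length_wordProd_le z).trans (hz.length_le.trans hylen.le)) ?_
      intro h
      apply hu1
      have : y.length ≤ z.length := by
        rw [hylen, ← h]
        exact cs.length_wordProd_le z
      rw [hz.eq_of_length_le this, hvy]

end SubwordProducts

section Adapted

variable {B W : Type*} [Group W] {M : CoxeterMatrix B} {cs : CoxeterSystem M W}

open CoxeterSystem

theorem IsAdapted.isReduced_and_isLongest {I : Finitary cs} {c : Ordering cs I} {ω : List B}
    (h : IsAdapted c ω) : cs.IsReduced ω ∧ IsLongest I (cs.wordProd ω) := by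
  cases c with
  | nil =>
    rw [IsAdapted] at h
    subst h
    refine ⟨by simp [isReduced_iff], by simp, fun v hv => ?_⟩
    rw [eq_one_of_mem_emptyΛ hv]
    simp
  | snoc c h' =>
    rw [IsAdapted] at h
    exact ⟨h.1, h.2.1⟩

/-- The longest element of the smaller group is a right factor, with lengths adding up, of the
longest element of the larger one. So a reduced word of the quotient can be put in front of an
adapted word. -/
theorem exists_isAdapted {I : Finitary cs} (c : Ordering cs I) : ∃ ω, IsAdapted c ω := by
  induction c with
  | nil => exact ⟨[], by rw [IsAdapted]⟩
  | @snoc I J c h ih =>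
    obtain ⟨ρ, hρ⟩ := ih
    obtain ⟨h1, h2⟩ := hρ.isReduced_and_isLongest
    obtain ⟨w, hw⟩ := exists_isLongest J
    have hJ : cs.wordProd ρ ∈ J.group := parabolic_mono h.1.subset h2.1
    obtain ⟨δ, hδ, e⟩ := cs.exists_isReduced (w * (cs.wordProd ρ)⁻¹)
    have e' : cs.wordProd δ * cs.wordProd ρ = w := by rw [← e, inv_mul_cancel_right]
    refine ⟨δ ++ ρ, ?_⟩
    rw [IsAdapted]
    refine ⟨?_, by rwa [wordProd_append, e'], δ, ρ, rfl, hρ⟩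
    rw [isReduced_append_iff cs hδ h1, e', ← e]
    exact (hw.length_mul hJ).symm

/-- For a reduced word of the longest element, the products of subsequences are exactly the elements
of `W_I`. The word therefore gives `x_I` up to `q` times a combination of shorter `T_v`, and these
are combinations of products along proper subsequences. -/
theorem nonempty_expansion {I : Finitary cs} (c : Ordering cs I) : Nonempty (Expansion c) := by
  classical
  obtain ⟨ω, hω⟩ := exists_isAdapted c
  obtain ⟨hr, hl⟩ := hω.isReduced_and_isLongest
  have hI : ∀ i ∈ ω, i ∈ I.carrier := mem_of_isReduced_of_mem_parabolic hr hl.1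
  obtain ⟨n, hn, e⟩ := prod_klGen_eq (cs := cs) hI
  have hx : xElt I = ∑ v ∈ subwordProds cs ω, basisT cs v := by
    rw [xElt]
    refine Finset.sum_bij (fun v _ => (v : W)) (fun v _ => mem_subwordProds_of_isLongest hl v.2)
      (fun _ _ _ _ h => Subtype.ext h)
      (fun v hv => ⟨⟨v, mem_parabolic_of_mem_subwordProds hI hv⟩, Finset.mem_univ _, rfl⟩)
      fun _ _ => rfl
  have hmem : -n ∈ Submodule.span ℤ[X]
      ((fun y : List B => (y.map (Hecke.klGen M)).prod) '' {y | y.Sublist ω ∧ y ≠ ω}) := by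
    refine neg_mem (Submodule.span_le.2 ?_ hn)
    rintro _ ⟨v, ⟨hv, hk⟩, rfl⟩
    refine basisT_mem_span_prod_klGen hI hl hv ?_
    rintro rfl
    rw [hr.eq] at hk
    exact lt_irrefl _ hk
  obtain ⟨l, hl1, hl2⟩ := (Finsupp.mem_span_image_iff_linearCombination ℤ[X]).1 hmem
  refine ⟨⟨ω, hω, l, fun y hy => hl1 hy, ?_⟩⟩
  change _ = _ + (Polynomial.X : ℤ[X]) • Finsupp.linearCombination ℤ[X]
    (fun y : List B => (y.map (Hecke.klGen M)).prod) l
  rw [hl2, e, hx, smul_neg, add_neg_cancel_right]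

end Adapted

/-! ### Chains of finitary subsets -/

section Chains

variable {B W : Type*} [Group W] {M : CoxeterMatrix B} {cs : CoxeterSystem M W}

/-- A subset of a finitary subset is finitary. -/
def Finitary.ofSubset (J : Finitary cs) (I : Finset B) (h : I ⊆ J.carrier) : Finitary cs where
  carrier := I
  finite := by
    have := J.finite
    exact Set.Finite.subset (Set.toFinite (J.group : Set W)) (parabolic_mono h)

theorem nonempty_ordering (J : Finitary cs) : Nonempty (Ordering cs J) := by
  classical
  induction hn : J.carrier.card generalizing J with
  | zero =>
    obtain rfl : J = emptyΛ cs := Finitary.ext (Finset.card_eq_zero.1 hn)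
    exact ⟨.nil⟩
  | succ n ih =>
    obtain ⟨i, hi⟩ : J.carrier.Nonempty := Finset.card_pos.1 (by omega)
    have hc := Finset.card_erase_add_one hi
    obtain ⟨c⟩ := ih (J.ofSubset (J.carrier.erase i) (Finset.erase_subset _ _))
      (by change (J.carrier.erase i).card = n; omega)
    exact ⟨c.snoc ⟨Finset.erase_ssubset hi, hc⟩⟩

end Chains

/-! ### Families satisfying the relations -/

/-- The families `u`, `d`, `e` satisfy the idempotent, sandwich, extended braid and quiver
relations. -/
structure IsHasseFamily {B W : Type*} [Finite B] [Group W] {M : CoxeterMatrix B}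
    {cs : CoxeterSystem M W} {A : Type*} [Ring A] [Algebra GroundRing A]
    (E : (I : Finitary cs) → (c : Ordering cs I) → Expansion c)
    (u d : {I J : Finitary cs} → I.Below J → A) (e : Finitary cs → A) : Prop where
  hasse : ∀ {x y}, HasseRel u d e E x y → x = y
  quiver : ∀ {x y}, QuiverRel u d e x y → x = y

namespace IsHasseFamily

variable {B W : Type*} [Finite B] [Group W] {M : CoxeterMatrix B} {cs : CoxeterSystem M W}
  {A : Type*} [Ring A] [Algebra GroundRing A]
  {E : (I : Finitary cs) → (c : Ordering cs I) → Expansion c}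
  {u d : {I J : Finitary cs} → I.Below J → A} {e : Finitary cs → A}
  (F : IsHasseFamily E u d e)

include F

theorem d_mul_u {I J : Finitary cs} (h : I.Below J) : d h * u h = e J := F.hasse (.idempotent h)

theorem u_mul_e {I J : Finitary cs} (h : I.Below J) : u h * e J = u h := F.quiver (.u_one h)

theorem e_mul_u {I J : Finitary cs} (h : I.Below J) : e I * u h = u h := F.quiver (.one_u h)

theorem d_mul_e {I J : Finitary cs} (h : I.Below J) : d h * e I = d h := F.quiver (.d_one h)

theorem e_mul_d {I J : Finitary cs} (h : I.Below J) : e J * d h = d h := F.quiver (.one_d h)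

theorem e_mul_e (I : Finitary cs) : e I * e I = e I := F.quiver (.idem I)

theorem e_mul_e_of_ne {I J : Finitary cs} (h : I ≠ J) : e I * e J = 0 := F.quiver (.orth h)

theorem sum_e : ∑ K, e K = 1 := F.quiver .sum_one

theorem e_mul_uProd {I : Finitary cs} (c : Ordering cs I) :
    e (emptyΛ cs) * uProd u e c = uProd u e c := by
  induction c with
  | nil => exact F.e_mul_e _
  | snoc c h ih => rw [uProd, ← mul_assoc, ih]

theorem uProd_mul_e {I : Finitary cs} (c : Ordering cs I) : uProd u e c * e I = uProd u e c := by
  cases c with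
  | nil => exact F.e_mul_e _
  | snoc c h => rw [uProd, mul_assoc, F.u_mul_e]

theorem e_mul_dProd {I : Finitary cs} (c : Ordering cs I) : e I * dProd d e c = dProd d e c := by
  cases c with
  | nil => exact F.e_mul_e _
  | snoc c h => rw [dProd, ← mul_assoc, F.e_mul_d]

theorem dProd_mul_e {I : Finitary cs} (c : Ordering cs I) :
    dProd d e c * e (emptyΛ cs) = dProd d e c := by
  induction c with
  | nil => exact F.e_mul_e _
  | snoc c h ih => rw [dProd, mul_assoc, ih]

/-- The idempotent relation telescopes along the chain. This makes every `e I` factor through the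
vertex `∅`. -/
theorem dProd_mul_uProd {I : Finitary cs} (c : Ordering cs I) :
    dProd d e c * uProd u e c = e I := by
  induction c with
  | nil => exact F.e_mul_e _
  | snoc c h ih =>
    rw [dProd, uProd, mul_assoc, ← mul_assoc _ _ (u h), ih, F.e_mul_u, F.d_mul_u]

/-- The products along a chain depend only on its end. -/
theorem prod_chain_eq {I : Finitary cs} (c c' : Ordering cs I) :
    uProd u e c = uProd u e c' ∧ dProd d e c = dProd d e c' := by
  classical
  induction hn : I.carrier.card generalizing I with
  | zero =>
    have key : ∀ c : Ordering cs I, uProd u e c = e (emptyΛ cs) ∧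
        dProd d e c = e (emptyΛ cs) := by
      intro c
      cases c with
      | nil => exact ⟨rfl, rfl⟩
      | snoc c h => have := h.2; omega
    exact ⟨(key c).1.trans (key c').1.symm, (key c).2.trans (key c').2.symm⟩
  | succ n ih =>
    cases c with
    | nil => simp [emptyΛ] at hn
    | @snoc J _ c h =>
      cases c' with
      | nil => simp [emptyΛ] at hn
      | @snoc J' _ c' h' =>
        have hJ : J.carrier.card = n := by have := h.2; omega
        have hJ' : J'.carrier.card = n := by have := h'.2; omega
        by_cases hJJ : J = J'
        · subst hJJ
          obtain ⟨h1, h2⟩ := ih c c' hJ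
          exact ⟨by rw [uProd, uProd, h1], by rw [dProd, dProd, h2]⟩
        -- Two different penultimate members `J`, `J'` meet in a set `K` with one element fewer.
        -- Induction reroutes both chains through `K`, and the sandwich relation compares the two
        -- ways from `K` to `I`.
        · set K := J.ofSubset (J.carrier ∩ J'.carrier) Finset.inter_subset_left with hK
          have hu : J.carrier ∪ J'.carrier ⊆ I.carrier :=
            Finset.union_subset h.1.subset h'.1.subset
          have hne : ¬ J.carrier ⊆ J'.carrier := fun hs =>
            hJJ (Finitary.ext (Finset.eq_of_subset_of_card_le hs (by omega)))
          have hne' : ¬ J'.carrier ⊆ J.carrier := fun hs =>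
            hJJ (Finitary.ext (Finset.eq_of_subset_of_card_le hs (by omega)).symm)
          have hKJ : K.carrier ⊂ J.carrier :=
            ⟨Finset.inter_subset_left, fun hs => hne (hs.trans Finset.inter_subset_right)⟩
          have hKJ' : K.carrier ⊂ J'.carrier :=
            ⟨Finset.inter_subset_right, fun hs => hne' (hs.trans Finset.inter_subset_left)⟩
          have hcard : K.carrier.card + 1 = n := by
            have h1 := Finset.card_union_add_card_inter J.carrier J'.carrier
            have h2 := Finset.card_le_card hu
            have h3 := Finset.card_lt_card hKJ
            change (J.carrier ∩ J'.carrier).card < _ at h3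
            change (J.carrier ∩ J'.carrier).card + 1 = n
            omega
          have b : K.Below J := ⟨hKJ, by omega⟩
          have b' : K.Below J' := ⟨hKJ', by omega⟩
          obtain ⟨k⟩ := nonempty_ordering K
          obtain ⟨h1, h2⟩ := ih c (k.snoc b) hJ
          obtain ⟨h1', h2'⟩ := ih c' (k.snoc b') hJ'
          constructor
          · rw [uProd, uProd, h1, h1', uProd, uProd, mul_assoc, mul_assoc,
              F.hasse (.sandwich_u b h b' h')]
          · rw [dProd, dProd, h2, h2', dProd, dProd, ← mul_assoc, ← mul_assoc,
              F.hasse (.sandwich_d b h b' h')]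

theorem e_mul_chi (s : B) : e (emptyΛ cs) * chi u d s = chi u d s := by
  rw [chi, mul_smul_comm, ← mul_assoc, F.e_mul_u]

theorem chi_mul_e (s : B) : chi u d s * e (emptyΛ cs) = chi u d s := by
  rw [chi, smul_mul_assoc, mul_assoc, F.d_mul_e]

theorem chi_mul_chi (s : B) : chi u d s * chi u d s =
    algebraMap ℤ[X] GroundRing (Polynomial.X + 1) • chi u d s := by
  rw [chi, smul_mul_assoc, mul_smul_comm, mul_assoc, ← mul_assoc (d _), F.d_mul_u, F.e_mul_d]

end IsHasseFamily

/-! ### Alternating products in an algebra with quadratic relations -/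

section Alternating

variable {B C : Type*} [Ring C] [Algebra ℤ[X] C] (T : B → C) (s t : B)

open CoxeterSystem

/-- The alternating words in `s` and `t` of length less than `k`. -/
def alternatingWords (k : ℕ) : Set (List B) :=
  {v | ∃ n < k, v = alternatingWord s t n ∨ v = alternatingWord t s n}

/-- The span of the products along the alternating words of length less than `k`. -/
def alternatingSpan (k : ℕ) : Submodule ℤ[X] C :=
  Submodule.span ℤ[X] ((fun v : List B => (v.map T).prod) '' alternatingWords s t k)

variable {T s t}

theorem prod_mem_alternatingSpan {k n : ℕ} (h : n < k) {v : List B}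
    (hv : v = alternatingWord s t n ∨ v = alternatingWord t s n) :
    (v.map T).prod ∈ alternatingSpan T s t k :=
  Submodule.subset_span ⟨v, ⟨n, h, hv⟩, rfl⟩

theorem alternatingSpan_mono {k l : ℕ} (h : k ≤ l) :
    alternatingSpan T s t k ≤ alternatingSpan T s t l :=
  Submodule.span_mono (Set.image_mono fun _ ⟨n, hn, hv⟩ => ⟨n, hn.trans_le h, hv⟩)

theorem alternatingSpan_comm (k : ℕ) : alternatingSpan T s t k = alternatingSpan T t s k := by
  have : alternatingWords s t k = alternatingWords t s k := by
    ext v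
    simp only [alternatingWords, Set.mem_ofPred_eq, or_comm]
  rw [alternatingSpan, alternatingSpan, this]

variable (hq : ∀ s, T s * T s = ((Polynomial.X : ℤ[X]) - 1) • T s + (Polynomial.X : ℤ[X]) • 1)

include hq

theorem mul_prod_alternatingWord_mem {x : B} (hx : x = s ∨ x = t) (n : ℕ) :
    T x * ((alternatingWord s t n).map T).prod ∈ alternatingSpan T s t (n + 2) := by
  cases n with
  | zero =>
    have : T x * ((alternatingWord s t 0).map T).prod = ([x].map T).prod := by
      simp [alternatingWord]
    rw [this]
    refine prod_mem_alternatingSpan (n := 1) (by omega) ?_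
    rcases hx with rfl | rfl
    · right; rfl
    · left; rfl
  | succ n =>
    by_cases hxe : x = if Even n then t else s
    · have e : T x * ((alternatingWord s t (n + 1)).map T).prod = ((Polynomial.X : ℤ[X]) - 1) •
          ((alternatingWord s t (n + 1)).map T).prod +
          (Polynomial.X : ℤ[X]) • ((alternatingWord s t n).map T).prod := by
        rw [alternatingWord_succ', ← hxe, List.map_cons, List.prod_cons, ← mul_assoc, hq, add_mul,
          smul_mul_assoc, smul_mul_assoc, one_mul]
      rw [e]
      exact add_mem (Submodule.smul_mem _ _ (prod_mem_alternatingSpan (by omega) (Or.inl rfl)))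
        (Submodule.smul_mem _ _ (prod_mem_alternatingSpan (by omega) (Or.inl rfl)))
    · have e : x = if Even (n + 1) then t else s := by
        by_cases hn : Even n
        · have hn' : ¬ Even (n + 1) := by simpa [Nat.even_add_one] using hn
          rw [if_pos hn] at hxe
          rw [if_neg hn']
          tauto
        · have hn' : Even (n + 1) := by simpa [Nat.even_add_one] using hn
          rw [if_neg hn] at hxe
          rw [if_pos hn']
          tauto
      rw [← List.prod_cons, ← List.map_cons, e, ← alternatingWord_succ']
      exact prod_mem_alternatingSpan (by omega) (Or.inl rfl)

theorem mul_mem_alternatingSpan {x : B} (hx : x = s ∨ x = t) {k : ℕ} {y : C}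
    (hy : y ∈ alternatingSpan T s t k) : T x * y ∈ alternatingSpan T s t (k + 1) := by
  induction hy using Submodule.span_induction with
  | mem y hy =>
    obtain ⟨v, ⟨n, hn, rfl | rfl⟩, rfl⟩ := hy
    · exact alternatingSpan_mono (by omega) (mul_prod_alternatingWord_mem hq hx n)
    · rw [alternatingSpan_comm]
      exact alternatingSpan_mono (by omega) (mul_prod_alternatingWord_mem hq hx.symm n)
  | zero => simp
  | add x y _ _ hx hy => rw [mul_add]; exact add_mem hx hy
  | smul r x _ hx => rw [mul_smul_comm]; exact Submodule.smul_mem _ _ hx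

theorem add_one_mul_mem_alternatingSpan {x : B} (hx : x = s ∨ x = t) {k : ℕ} {y : C}
    (hy : y ∈ alternatingSpan T s t k) : (T x + 1) * y ∈ alternatingSpan T s t (k + 1) := by
  rw [add_mul, one_mul]
  exact add_mem (mul_mem_alternatingSpan hq hx hy) (alternatingSpan_mono (by omega) hy)

theorem prod_add_one_mem_alternatingSpan {y : List B} (hy : ∀ x ∈ y, x = s ∨ x = t) :
    (y.map fun x => T x + 1).prod ∈ alternatingSpan T s t (y.length + 1) := by
  induction y with
  | nil => exact prod_mem_alternatingSpan (v := []) (n := 0) (by simp) (Or.inl rfl)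
  | cons x y ih =>
    rw [List.map_cons, List.prod_cons]
    exact add_one_mul_mem_alternatingSpan hq (hy x (by simp)) (ih fun z hz => hy z (by simp [hz]))

theorem prod_add_one_sub_mem_alternatingSpan (n : ℕ) :
    ((alternatingWord s t n).map fun x => T x + 1).prod - ((alternatingWord s t n).map T).prod ∈
      alternatingSpan T s t n := by
  induction n with
  | zero => simp [alternatingWord]
  | succ n ih =>
    rw [alternatingWord_succ']
    generalize hx : (if Even n then t else s) = x
    have hx' : x = s ∨ x = t := by
      rw [← hx]
      split_ifs <;> simp
    simp only [List.map_cons, List.prod_cons]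
    set P := ((alternatingWord s t n).map fun x => T x + 1).prod
    set Q := ((alternatingWord s t n).map T).prod with hQ
    have e : (T x + 1) * P - T x * Q = (T x + 1) * (P - Q) + Q := by noncomm_ring
    rw [e]
    exact add_mem (add_one_mul_mem_alternatingSpan hq hx' ih)
      (prod_mem_alternatingSpan (by omega) (Or.inl rfl))

/-- The leading term of an expansion along an alternating word. -/
theorem expansion_sub_mem_alternatingSpan {n : ℕ} (l : List B →₀ ℤ[X])
    (hl : ∀ y ∈ l.support, y.Sublist (alternatingWord s t n) ∧ y ≠ alternatingWord s t n) :
    ((alternatingWord s t n).map fun x => T x + 1).prod + (Polynomial.X : ℤ[X]) •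
      (l.sum fun y a => a • (y.map fun x => T x + 1).prod) - ((alternatingWord s t n).map T).prod ∈
      alternatingSpan T s t n := by
  rw [add_sub_right_comm]
  refine add_mem (prod_add_one_sub_mem_alternatingSpan hq n) (Submodule.smul_mem _ _
    (Submodule.sum_mem _ fun y hy => Submodule.smul_mem _ _ ?_))
  obtain ⟨h1, h2⟩ := hl y hy
  -- A proper subsequence has length less than `n`, and a product of `T x + 1` along it involves
  -- only alternating words of at most its own length.
  have hlt : y.length < n := by
    by_contra h
    exact h2 (h1.eq_of_length_le (by rw [length_alternatingWord]; omega))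
  exact alternatingSpan_mono hlt (prod_add_one_mem_alternatingSpan hq
    fun x hx => mem_alternatingWord x (h1.subset hx))

end Alternating

/-! ### Adapted words of finitary subsets with two elements -/

section Pair

variable {B W : Type*} [Group W] {M : CoxeterMatrix B} {cs : CoxeterSystem M W}

open CoxeterSystem

theorem exists_finitary_pair (cs : CoxeterSystem M W) {s t : B} (h : M s t ≠ 0) :
    ∃ I : Finitary cs, (I.carrier : Set B) = {s, t} := by
  classical
  refine ⟨⟨{s, t}, ?_⟩, by simp⟩
  have hfin : Set.Finite (cs.wordProd '' alternatingWords s t (M s t + 1)) := by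
    apply Set.Finite.image
    have : alternatingWords s t (M s t + 1) ⊆ (Finset.range (M s t + 1)).image (alternatingWord s t) ∪
        (Finset.range (M s t + 1)).image (alternatingWord t s) := by
      rintro v ⟨n, hn, rfl | rfl⟩
      · left; simp; exact ⟨n, by omega, rfl⟩
      · right; simp; exact ⟨n, by omega, rfl⟩
    exact Set.Finite.subset (Set.toFinite _) this
  refine hfin.subset fun w hw => ?_
  obtain ⟨ω, h1, h2, rfl⟩ := exists_reduced_word_of_mem_parabolic hw
  have h3 := eq_alternatingWord_of_isReduced cs h2 (i := s) (j := t) (by simpa using h1)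
  refine ⟨ω, ⟨ω.length, ?_, h3⟩, rfl⟩
  by_contra hlt
  rcases h3 with e | e
  · rw [e] at h2
    exact cs.not_isReduced_alternatingWord s t h (by omega) h2
  · rw [e] at h2
    rw [M.symmetric] at h hlt
    exact cs.not_isReduced_alternatingWord t s h (by omega) h2

/-- Adaptedness to a chain through `{t}` forces the last letter to be `t`. The chains through `{s}`
and `{t}` thus single out the two sides of the braid relation. -/
theorem eq_alternatingWord_of_isAdapted {s t : B} {I : Finitary cs}
    (hI : (I.carrier : Set B) = {s, t}) (h : (singletonΛ cs t).Below I) {ω : List B}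
    (hω : IsAdapted ((Ordering.nil.snoc (empty_below_singleton cs t)).snoc h) ω) :
    ω = alternatingWord s t ω.length ∧ 0 < ω.length := by
  obtain ⟨hr, hl⟩ := hω.isReduced_and_isLongest
  rw [IsAdapted] at hω
  obtain ⟨-, -, left, right, rfl, hω'⟩ := hω
  obtain ⟨hr', hl'⟩ := hω'.isReduced_and_isLongest
  have hmem : ∀ k ∈ left ++ right, k = s ∨ k = t := fun k hk => by
    have : k ∈ (I.carrier : Set B) := mem_of_isReduced_of_mem_parabolic hr hl.1 k hk
    rwa [hI] at this
  have ht : cs.simple t ∈ (singletonΛ cs t).group := simple_mem_parabolic (by simp [singletonΛ])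
  have h1 : cs.length (cs.wordProd right) = 1 := by
    have a := hl'.2 _ ht
    rw [length_simple] at a
    rcases mem_parabolic_singleton.1 hl'.1 with b | b <;> rw [b] at a ⊢ <;> simp at a ⊢
  rw [hr'.eq] at h1
  obtain ⟨x, rfl⟩ := List.length_eq_one_iff.1 h1
  have hx : x = t := by
    simpa [singletonΛ] using mem_of_isReduced_of_mem_parabolic hr' hl'.1 x (by simp)
  subst hx
  refine ⟨concat_eq_alternatingWord cs hr (eq_alternatingWord_of_isReduced cs
    (isReduced_append_left cs hr) fun k hk => hmem k (by simp [hk])), by simp⟩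

theorem singletonΛ_below {s t : B} (hst : s ≠ t) {I : Finitary cs}
    (hI : (I.carrier : Set B) = {s, t}) : (singletonΛ cs t).Below I := by
  classical
  have hI' : I.carrier = {s, t} := by
    apply Finset.coe_injective
    rw [hI]
    simp
  constructor
  · rw [hI']
    refine ⟨by simp [singletonΛ], fun h => hst ?_⟩
    simpa [singletonΛ] using h (show s ∈ ({s, t} : Finset B) by simp)
  · rw [hI', Finset.card_pair hst]
    simp [singletonΛ]

theorem alternatingWords_spec {s t : B} (hst : s ≠ t) {v : List B}
    (hv : v ∈ alternatingWords s t (M s t)) : cs.IsReduced v := by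
  obtain ⟨n, hn, rfl | rfl⟩ := hv
  · exact isReduced_alternatingWord cs hst (Or.inr hn.le)
  · exact isReduced_alternatingWord cs hst.symm (Or.inr (by rw [M.symmetric]; exact hn.le))

theorem injOn_wordProd_alternatingWords {s t : B} (hst : s ≠ t) :
    Set.InjOn cs.wordProd (alternatingWords s t (M s t)) := by
  intro v hv w hw h
  have hlen : v.length = w.length := by
    rw [← (alternatingWords_spec (cs := cs) hst hv).eq, h,
      (alternatingWords_spec (cs := cs) hst hw).eq]
  obtain ⟨n, hn, hv⟩ := hv
  obtain ⟨m, hm, hw⟩ := hw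
  have e1 : v.length = n := by rcases hv with rfl | rfl <;> simp
  have e2 : w.length = m := by rcases hw with rfl | rfl <;> simp
  obtain rfl : n = m := by omega
  rcases hv with rfl | rfl <;> rcases hw with rfl | rfl
  · rfl
  · rw [(eq_of_wordProd_alternatingWord cs hst hn hn h).1]
    rfl
  · rw [(eq_of_wordProd_alternatingWord cs hst hn hn h.symm).1]
    rfl
  · rfl

theorem linearIndepOn_alternatingWords {s t : B} (hst : s ≠ t) :
    LinearIndepOn ℤ[X] (fun v : List B => (v.map (Hecke.gen M)).prod)
      (alternatingWords s t (M s t)) := by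
  -- Only the Coxeter matrix enters the statement, so any Coxeter group for it may serve; distinct
  -- short alternating words have distinct products there.
  let cs := M.toCoxeterSystem
  have h := (linearIndependent_basisT cs).comp
    (fun v : alternatingWords s t (M s t) => cs.wordProd v)
    fun v w h => Subtype.ext (injOn_wordProd_alternatingWords hst v.2 w.2 h)
  have e : (basisT cs ∘ fun v : alternatingWords s t (M s t) => cs.wordProd v) =
      fun v : alternatingWords s t (M s t) => ((v : List B).map (Hecke.gen M)).prod :=
    funext fun v => basisT_wordProd cs (alternatingWords_spec hst v.2)
  rw [e] at h
  exact h

end Pair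

/-! ### Scalars in the localised ground ring -/

section GroundRing

theorem GroundRing.smul_smul {A : Type*} [Ring A] [Algebra GroundRing A] (a b : GroundRing) (x : A) :
    a • b • x = (a * b) • x := _root_.smul_smul a b x

theorem GroundRing.algebraMap_smul {A : Type*} [Ring A] [Algebra GroundRing A] [Algebra ℤ[X] A]
    [IsScalarTower ℤ[X] GroundRing A] (a : ℤ[X]) (x : A) :
    algebraMap ℤ[X] GroundRing a • x = a • x := _root_.algebraMap_smul GroundRing a x

theorem algebraMap_mul_mk (p : ℤ[X]) (f : constOne) (q : ℤ[X]) :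
    algebraMap ℤ[X] GroundRing p * Localization.mk q f = Localization.mk (p * q) f := by
  rw [← Localization.mk_one_eq_algebraMap, Localization.mk_mul, one_mul]

theorem algebraMap_mul_mk_self (f : constOne) :
    algebraMap ℤ[X] GroundRing f * Localization.mk 1 f = 1 := by
  rw [algebraMap_mul_mk, mul_one, Localization.mk_self]

theorem algebraMap_smul_mk_smul {A : Type*} [Ring A] [Algebra GroundRing A] (f : constOne) (x : A) :
    algebraMap ℤ[X] GroundRing f • (Localization.mk 1 f : GroundRing) • x = x := by
  rw [GroundRing.smul_smul, algebraMap_mul_mk_self]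
  exact one_smul GroundRing x

theorem mk_smul_algebraMap_smul {A : Type*} [Ring A] [Algebra GroundRing A] (f : constOne) (x : A) :
    (Localization.mk 1 f : GroundRing) • algebraMap ℤ[X] GroundRing f • x = x := by
  rw [GroundRing.smul_smul, mul_comm, algebraMap_mul_mk_self]
  exact one_smul GroundRing x

end GroundRing

/-! ### The Hecke algebra in the corner at the empty set -/

namespace IsHasseFamily

variable {B W : Type*} [Finite B] [Group W] {M : CoxeterMatrix B} {cs : CoxeterSystem M W}
  {A : Type*} [Ring A] [Algebra GroundRing A] [Algebra ℤ[X] A] [IsScalarTower ℤ[X] GroundRing A]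
  {E : (I : Finitary cs) → (c : Ordering cs I) → Expansion c}
  {u d : {I J : Finitary cs} → I.Below J → A} {e : Finitary cs → A}
  (F : IsHasseFamily E u d e)

open CoxeterSystem

include F

theorem chi_sub_one_mul_self (s : B) : (chi u d s - 1) * (chi u d s - 1) =
    ((Polynomial.X : ℤ[X]) - 1) • (chi u d s - 1) + (Polynomial.X : ℤ[X]) • (1 : A) := by
  have h := F.chi_mul_chi s
  rw [GroundRing.algebraMap_smul] at h
  rw [mul_sub, sub_mul, h]
  simp only [mul_one, one_mul]
  module

-- Off the vertex `∅` the element `χ_s` is zero, so each `χ_s - 1` acts as `-1` and only the length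
-- of a word matters. This settles the part of the braid relation that the extended braid relations
-- do not see.
omit [Algebra ℤ[X] A] [IsScalarTower ℤ[X] GroundRing A] in
theorem prod_chi_sub_one_mul (ω : List B) :
    (ω.map fun s => chi u d s - 1).prod * (1 - e (emptyΛ cs)) =
      (-1) ^ ω.length * (1 - e (emptyΛ cs)) := by
  induction ω with
  | nil => simp
  | cons s ω ih =>
    have h : (chi u d s - 1) * (1 - e (emptyΛ cs)) = -(1 - e (emptyΛ cs)) := by
      rw [sub_mul, mul_sub, mul_one, F.chi_mul_e]
      simp
    have hc : (chi u d s - 1) * (-1) ^ ω.length = (-1) ^ ω.length * (chi u d s - 1) :=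
      ((Commute.neg_one_right _).pow_right _).eq
    rw [List.map_cons, List.prod_cons, mul_assoc, ih, ← mul_assoc, hc, mul_assoc, h,
      List.length_cons, pow_succ, mul_neg, mul_neg, mul_one, neg_mul]

omit [Algebra ℤ[X] A] [IsScalarTower ℤ[X] GroundRing A] in
theorem uProd_mul_dProd {I : Finitary cs} (hI : 1 < I.carrier.card) (c : Ordering cs I) :
    uProd u e c * dProd d e c = rho u d e (E I c) := F.hasse (.braid hI c)

theorem poincare_smul_uProd_mul_dProd {I : Finitary cs} (hI : 1 < I.carrier.card)
    (c : Ordering cs I) : poincare I • (uProd u e c * dProd d e c) =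
      (((E I c).word.map (chi u d)).prod + (Polynomial.X : ℤ[X]) •
        (E I c).coeff.sum fun y a => a • (y.map (chi u d)).prod) * e (emptyΛ cs) := by
  rw [F.uProd_mul_dProd hI, rho, ← GroundRing.algebraMap_smul (poincare I),
    algebraMap_smul_mk_smul ⟨poincare I, poincare_mem I⟩, add_mul, GroundRing.algebraMap_smul,
    smul_mul_assoc, Finsupp.sum_mul, chiWord]
  congr 2
  refine Finsupp.sum_congr fun y _ => ?_
  rw [GroundRing.algebraMap_smul, chiWord, smul_mul_assoc]

/-- The braid relations for the `χ_s - 1`. -/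
theorem prod_braidWord_chi_sub_one (s t : B) :
    ((braidWord M s t).map fun s => chi u d s - 1).prod =
      ((braidWord M t s).map fun s => chi u d s - 1).prod := by
  by_cases hst : s = t
  · rw [hst]
  by_cases h0 : M s t = 0
  · have h0' : M t s = 0 := by rwa [M.symmetric]
    rw [braidWord, braidWord, h0, h0']
    rfl
  obtain ⟨I, hI⟩ := exists_finitary_pair cs h0
  have hI' : (I.carrier : Set B) = {t, s} := by rw [hI, Set.pair_comm]
  have ht := singletonΛ_below hst hI
  have hs := singletonΛ_below (Ne.symm hst) hI'
  have hcard : 1 < I.carrier.card := by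
    have := ht.2
    simp [singletonΛ] at this
    omega
  set c := (Ordering.nil.snoc (empty_below_singleton cs t)).snoc ht with hc
  set c' := (Ordering.nil.snoc (empty_below_singleton cs s)).snoc hs with hc'
  obtain ⟨hr, hl⟩ := (E I c).adapted.isReduced_and_isLongest
  obtain ⟨hr', hl'⟩ := (E I c').adapted.isReduced_and_isLongest
  obtain ⟨hw, hpos⟩ := eq_alternatingWord_of_isAdapted hI ht (E I c).adapted
  obtain ⟨hw', -⟩ := eq_alternatingWord_of_isAdapted hI' hs (E I c').adapted
  have hprod := hl'.unique hl
  have hlen : (E I c').word.length = (E I c).word.length := by rw [← hr.eq, hprod, hr'.eq]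
  have hm : (E I c).word.length = M s t := by
    rw [hlen] at hw'
    refine eq_of_alternatingWord_swap cs hst hpos (by rwa [← hw]) ?_
    rw [← hw, ← hw', hprod]
  rw [hm] at hw
  rw [hlen, hm] at hw'
  -- In the product `A × H_q` the two expansions are computed simultaneously in `A` and in the Hecke
  -- algebra, so that one coefficient vector describes the error term in both components.
  set T : B → A × Hecke M := fun s => (chi u d s - 1, Hecke.gen M s) with hT
  have hq : ∀ s, T s * T s = ((Polynomial.X : ℤ[X]) - 1) • T s + (Polynomial.X : ℤ[X]) • 1 :=
    fun s => Prod.ext (F.chi_sub_one_mul_self s) (Hecke.gen_mul_gen s)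
  have hfst : ∀ (w : List B) (l : List B →₀ ℤ[X]), AlgHom.fst ℤ[X] A (Hecke M)
      ((w.map fun x => T x + 1).prod + (Polynomial.X : ℤ[X]) •
        (l.sum fun y a => a • (y.map fun x => T x + 1).prod)) =
      (w.map (chi u d)).prod + (Polynomial.X : ℤ[X]) •
        l.sum fun y a => a • (y.map (chi u d)).prod := by
    intro w l
    have key : ∀ y : List B, AlgHom.fst ℤ[X] A (Hecke M) (y.map fun x => T x + 1).prod =
        (y.map (chi u d)).prod := by
      intro y
      rw [map_list_prod, List.map_map]
      congr 2
      funext x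
      simp [hT]
    rw [map_add, map_smul, map_finsuppSum, key]
    simp only [map_smul, key]
  have hsnd : ∀ (w : List B) (l : List B →₀ ℤ[X]), AlgHom.snd ℤ[X] A (Hecke M)
      ((w.map fun x => T x + 1).prod + (Polynomial.X : ℤ[X]) •
        (l.sum fun y a => a • (y.map fun x => T x + 1).prod)) =
      (w.map (Hecke.klGen M)).prod + (Polynomial.X : ℤ[X]) •
        l.sum fun y a => a • (y.map (Hecke.klGen M)).prod := by
    intro w l
    have key : ∀ y : List B, AlgHom.snd ℤ[X] A (Hecke M) (y.map fun x => T x + 1).prod =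
        (y.map (Hecke.klGen M)).prod := by
      intro y
      rw [map_list_prod, List.map_map]
      congr 2
    rw [map_add, map_smul, map_finsuppSum, key]
    simp only [map_smul, key]
  have hTfst : ∀ y : List B, AlgHom.fst ℤ[X] A (Hecke M) (y.map T).prod =
      (y.map fun s => chi u d s - 1).prod := by
    intro y
    rw [map_list_prod, List.map_map]
    congr 2
  have hTsnd : ∀ y : List B, AlgHom.snd ℤ[X] A (Hecke M) (y.map T).prod =
      (y.map (Hecke.gen M)).prod := by
    intro y
    rw [map_list_prod, List.map_map]
    congr 2
  have m1 := expansion_sub_mem_alternatingSpan hq (s := s) (t := t) (n := M s t) (E I c).coeff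
    (by rw [← hw]; exact (E I c).sublist)
  have m2 := expansion_sub_mem_alternatingSpan hq (s := t) (t := s) (n := M s t) (E I c').coeff
    (by rw [← hw']; exact (E I c').sublist)
  rw [← alternatingSpan_comm] at m2
  obtain ⟨l, hl1, hl2⟩ := (Finsupp.mem_span_image_iff_linearCombination ℤ[X]).1 (sub_mem m1 m2)
  have hbraid := Hecke.braid (M := M) s t
  rw [braidWord, braidWord, M.symmetric t s] at hbraid
  -- In the Hecke component both expansions equal `x_I` and the two braid words agree, so the
  -- combination `l` of short alternating words vanishes there; linear independence gives `l = 0`.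
  have hl0 : l = 0 := by
    refine linearIndepOn_iff.1 (linearIndepOn_alternatingWords (M := M) hst) l hl1 ?_
    have := congrArg (AlgHom.snd ℤ[X] A (Hecke M)) hl2
    rw [map_sub, map_sub, map_sub, hsnd, hsnd, hTsnd, hTsnd, hbraid] at this
    nth_rw 1 [← hw] at this
    nth_rw 2 [← hw'] at this
    rw [← (E I c).expansion, ← (E I c').expansion, sub_self] at this
    rw [← this, Finsupp.linearCombination_apply, Finsupp.linearCombination_apply, map_finsuppSum]
    exact Finsupp.sum_congr fun y _ => by rw [map_smul, hTsnd]
  rw [hl0, map_zero] at hl2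
  have h1 := congrArg (AlgHom.fst ℤ[X] A (Hecke M)) hl2
  rw [map_zero, map_sub, map_sub, map_sub, hfst, hfst, hTfst, hTfst, ← hw, ← hw'] at h1
  -- In `A` the two expansions, multiplied by `e_∅`, are `π(I)` times the chain products, which do
  -- not depend on the chain. This is the braid relation multiplied by `e_∅`; on `1 - e_∅` both
  -- words give the same sign.
  have p1 := F.poincare_smul_uProd_mul_dProd hcard c
  have p2 := F.poincare_smul_uProd_mul_dProd hcard c'
  obtain ⟨e1, e2⟩ := F.prod_chain_eq c c'
  rw [e1, e2, p2] at p1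
  rw [braidWord, braidWord, M.symmetric t s, ← hw, ← hw']
  have q1 := F.prod_chi_sub_one_mul (E I c).word
  have q2 := F.prod_chi_sub_one_mul (E I c').word
  rw [hlen, ← q1, ← sub_eq_zero, ← sub_mul] at q2
  have h2 := congrArg (· * e (emptyΛ cs)) h1
  simp only [sub_mul _ _ (e (emptyΛ cs)), zero_mul, p1] at h2
  rw [sub_sub_sub_cancel_left] at h2
  rw [mul_sub, mul_one, sub_mul, ← h2, sub_zero] at q2
  exact (sub_eq_zero.1 q2).symm

/-- The homomorphism from the Hecke algebra that sends `T_s` to `χ_s - 1`. -/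
def heckeHom : Hecke M →ₐ[ℤ[X]] A :=
  Hecke.lift (fun s => chi u d s - 1) F.chi_sub_one_mul_self F.prod_braidWord_chi_sub_one

theorem heckeHom_gen (s : B) : F.heckeHom (Hecke.gen M s) = chi u d s - 1 :=
  Hecke.lift_gen _ _ _ s

theorem heckeHom_klGen (s : B) : F.heckeHom (Hecke.klGen M s) = chi u d s := by
  rw [Hecke.klGen, map_add, map_one, heckeHom_gen, sub_add_cancel]

theorem heckeHom_prod_klGen (y : List B) :
    F.heckeHom (y.map (Hecke.klGen M)).prod = (y.map (chi u d)).prod := by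
  rw [map_list_prod, List.map_map]
  congr 2
  funext s
  exact F.heckeHom_klGen s

theorem commute_heckeHom (x : Hecke M) : Commute (F.heckeHom x) (e (emptyΛ cs)) := by
  induction x using Hecke.induction with
  | halg r => rw [AlgHom.commutes]; exact Algebra.commutes r _
  | hgen s =>
    rw [heckeHom_gen]
    refine Commute.sub_left ?_ (Commute.one_left _)
    rw [Commute, SemiconjBy, F.chi_mul_e, F.e_mul_chi]
  | hmul a b ha hb => rw [map_mul]; exact ha.mul_left hb
  | hadd a b ha hb => rw [map_add]; exact ha.add_left hb

/-- The extension of scalars of the homomorphism from the Hecke algebra. -/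
def heckeHomR : GroundRing ⊗[ℤ[X]] Hecke M →ₐ[GroundRing] A :=
  Algebra.TensorProduct.lift (Algebra.ofId GroundRing A) F.heckeHom
    fun r x => show Commute _ _ from Algebra.commutes r (F.heckeHom x)

theorem heckeHomR_tmul (r : GroundRing) (x : Hecke M) :
    F.heckeHomR (r ⊗ₜ x) = r • F.heckeHom x := by
  rw [Algebra.smul_def]
  exact Algebra.TensorProduct.lift_tmul (Algebra.ofId GroundRing A) F.heckeHom _ r x

theorem commute_heckeHomR (x : GroundRing ⊗[ℤ[X]] Hecke M) :
    Commute (F.heckeHomR x) (e (emptyΛ cs)) := by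
  induction x using TensorProduct.induction_on with
  | zero => rw [map_zero]; exact Commute.zero_left _
  | tmul r x => rw [heckeHomR_tmul]; exact (F.commute_heckeHom x).smul_left r
  | add x y hx hy => rw [map_add]; exact hx.add_left hy

/-- The image of the Hecke algebra in the corner at the empty set. -/
def corner : Submodule GroundRing A :=
  LinearMap.range (LinearMap.mulRight GroundRing (e (emptyΛ cs)) ∘ₗ F.heckeHomR.toLinearMap)

theorem mem_corner {x : A} : x ∈ F.corner ↔ ∃ y, F.heckeHomR y * e (emptyΛ cs) = x := Iff.rfl

theorem heckeHom_mul_e_mem_corner (x : Hecke M) : F.heckeHom x * e (emptyΛ cs) ∈ F.corner :=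
  F.mem_corner.2 ⟨1 ⊗ₜ x, by
    rw [heckeHomR_tmul]
    congr 1
    exact one_smul GroundRing (F.heckeHom x)⟩

theorem mul_mem_corner {x y : A} (hx : x ∈ F.corner) (hy : y ∈ F.corner) : x * y ∈ F.corner := by
  obtain ⟨a, rfl⟩ := F.mem_corner.1 hx
  obtain ⟨b, rfl⟩ := F.mem_corner.1 hy
  refine F.mem_corner.2 ⟨a * b, ?_⟩
  rw [map_mul]
  conv_rhs => rw [mul_assoc, ← mul_assoc (e _), ← (F.commute_heckeHomR b).eq, mul_assoc _ (e _),
    F.e_mul_e, ← mul_assoc]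

/-- The product is `e_∅` for the empty set and `χ_s / (q + 1)` for a singleton, both by definition.
From two elements on, the extended braid relation expresses it through words in the `χ_s`. -/
theorem uProd_mul_dProd_mem_corner {I : Finitary cs} (c c' : Ordering cs I) :
    uProd u e c * dProd d e c' ∈ F.corner := by
  rw [(F.prod_chain_eq c' c).2]
  rcases lt_trichotomy I.carrier.card 1 with h | h | h
  · obtain rfl : I = emptyΛ cs := Finitary.ext (Finset.card_eq_zero.1 (by omega))
    rw [(F.prod_chain_eq c .nil).1, (F.prod_chain_eq c .nil).2, uProd, dProd, F.e_mul_e]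
    simpa using F.heckeHom_mul_e_mem_corner 1
  · obtain ⟨s, hs⟩ := Finset.card_eq_one.1 h
    obtain rfl : I = singletonΛ cs s := Finitary.ext hs
    rw [(F.prod_chain_eq c (.snoc .nil (empty_below_singleton cs s))).1,
      (F.prod_chain_eq c (.snoc .nil (empty_below_singleton cs s))).2, uProd, dProd, uProd, dProd,
      F.e_mul_u, F.d_mul_e]
    have h1 := F.heckeHom_mul_e_mem_corner (Hecke.klGen M s)
    rw [heckeHom_klGen, F.chi_mul_e] at h1
    have h2 := Submodule.smul_mem _
      (Localization.mk 1 ⟨Polynomial.X + 1, by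
        rw [← poincare_singletonΛ (cs := cs) s]; exact poincare_mem _⟩ : GroundRing) h1
    rw [chi] at h2
    rwa [mk_smul_algebraMap_smul ⟨Polynomial.X + 1, _⟩] at h2
  · have h1 := F.poincare_smul_uProd_mul_dProd h c
    have h2 : (Localization.mk 1 ⟨poincare I, poincare_mem I⟩ : GroundRing) •
        (poincare I • (uProd u e c * dProd d e c)) ∈ F.corner := by
      rw [h1]
      refine Submodule.smul_mem _ _ ?_
      have h3 := F.heckeHom_mul_e_mem_corner (((E I c).word.map (Hecke.klGen M)).prod +
        (Polynomial.X : ℤ[X]) •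
        (E I c).coeff.sum fun y a => a • (y.map (Hecke.klGen M)).prod)
      rw [map_add, map_smul, map_finsuppSum, heckeHom_prod_klGen] at h3
      simpa only [map_smul, heckeHom_prod_klGen] using h3
    rw [← GroundRing.algebraMap_smul (poincare I),
      mk_smul_algebraMap_smul ⟨poincare I, poincare_mem I⟩] at h2
    exact h2

end IsHasseFamily

/-! ### Homomorphisms between the right ideals `x_I H_q` -/

section Ideals

variable {B W : Type*} [Group W] {M : CoxeterMatrix B} {cs : CoxeterSystem M W}

open CoxeterSystem

theorem mem_xIdeal {I : Finitary cs} {y : Hecke M} : y ∈ xIdeal I ↔ ∃ z, xElt I * z = y := by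
  rw [Submodule.mem_span_singleton]
  constructor
  · rintro ⟨a, rfl⟩
    exact ⟨a.unop, rfl⟩
  · rintro ⟨z, rfl⟩
    exact ⟨MulOpposite.op z, rfl⟩

theorem mem_xIdeal_emptyΛ (y : Hecke M) : y ∈ xIdeal (emptyΛ cs) :=
  mem_xIdeal.2 ⟨y, by rw [xElt_emptyΛ, one_mul]⟩

theorem sum_group_inv {A : Type*} [AddCommMonoid A] (I : Finitary cs) (f : W → A) :
    ∑ w : I.group, f (w : W)⁻¹ = ∑ w : I.group, f w :=
  Fintype.sum_equiv (Equiv.inv I.group) _ _ fun _ => rfl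

/-- This is the factorisation of `W_J` into cosets of `W_I`, read after inversion. It exhibits `x_J`
as a right multiple of `x_I`, which is why the ideals are nested. -/
theorem xElt_mul_sum {I J : Finitary cs} (h : I.carrier ⊆ J.carrier) :
    xElt I * ∑ d ∈ minReps J I, basisT cs d⁻¹ = xElt J := by
  rw [xElt, xElt, ← sum_group_inv J, ← sum_minReps_mul h fun w => basisT cs w⁻¹, Finset.mul_sum]
  refine Finset.sum_congr rfl fun d hd => ?_
  rw [← sum_group_inv I, Finset.sum_mul]
  refine Finset.sum_congr rfl fun v _ => ?_
  rw [basisT_mul, mul_inv_rev]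
  rw [← mul_inv_rev, cs.length_inv, cs.length_inv, cs.length_inv, add_comm]
  exact length_mul_of_minimal (mem_minReps.1 hd).2 v.2

theorem xIdeal_le {I J : Finitary cs} (h : I.carrier ⊆ J.carrier) : xIdeal J ≤ xIdeal I := by
  intro y hy
  obtain ⟨z, rfl⟩ := mem_xIdeal.1 hy
  rw [← xElt_mul_sum h, mul_assoc]
  exact mem_xIdeal.2 ⟨_, rfl⟩

/-- Left multiplication, as an endomorphism of the right module `H_q`. -/
def leftMul (a : Hecke M) : Hecke M →ₗ[(Hecke M)ᵐᵒᵖ] Hecke M where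
  toFun x := a * x
  map_add' := mul_add a
  map_smul' r x := by
    change a * (x * r.unop) = a * x * r.unop
    rw [mul_assoc]

theorem leftMul_apply (a x : Hecke M) : leftMul a x = a * x := rfl

/-- The inclusion `x_J H_q → x_I H_q`. -/
def inclMap {I J : Finitary cs} (h : I.Below J) : xIdeal J →ₗ[(Hecke M)ᵐᵒᵖ] xIdeal I :=
  Submodule.inclusion (xIdeal_le h.1.subset)

theorem isInclusion_inclMap {I J : Finitary cs} (h : I.Below J) : IsInclusion (inclMap h) :=
  fun y => Submodule.coe_inclusion (xIdeal_le h.1.subset) y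

/-- Left multiplication with `h_{J,I}`, as a homomorphism `x_I H_q → x_J H_q`. -/
def splitMap {I J : Finitary cs} (h : I.Below J) : xIdeal I →ₗ[(Hecke M)ᵐᵒᵖ] xIdeal J :=
  (leftMul (hElt J I)).restrict fun y hy => by
    obtain ⟨z, rfl⟩ := mem_xIdeal.1 hy
    rw [leftMul_apply, ← mul_assoc, hElt_mul_xElt h.1.subset]
    exact mem_xIdeal.2 ⟨z, rfl⟩

theorem isLeftMul_splitMap {I J : Finitary cs} (h : I.Below J) :
    IsLeftMul (hElt J I) (splitMap h) :=
  fun y => LinearMap.coe_restrict_apply _ y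

variable (cs) in
/-- Left multiplication, as an endomorphism of the summand `x_∅ H_q = H_q`. -/
def leftMulEmpty (a : Hecke M) : xIdeal (emptyΛ cs) →ₗ[(Hecke M)ᵐᵒᵖ] xIdeal (emptyΛ cs) :=
  (leftMul a).restrict fun _ _ => mem_xIdeal_emptyΛ _

theorem leftMulEmpty_apply (a : Hecke M) (y : xIdeal (emptyΛ cs)) :
    (leftMulEmpty cs a y : Hecke M) = a * y :=
  LinearMap.coe_restrict_apply _ y

theorem extend_congr {I J : Finitary cs} {f g : xIdeal I →ₗ[(Hecke M)ᵐᵒᵖ] xIdeal J}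
    (h : ∀ y, (f y : Hecke M) = g y) : extend f = extend g := by
  rw [LinearMap.ext fun y => Subtype.ext (h y)]

theorem extend_mul {I J K : Finitary cs} (g : xIdeal J →ₗ[(Hecke M)ᵐᵒᵖ] xIdeal K)
    (f : xIdeal I →ₗ[(Hecke M)ᵐᵒᵖ] xIdeal J) : extend g * extend f = extend (g ∘ₗ f) := by
  refine LinearMap.ext fun x => ?_
  simp only [extend, Module.End.mul_apply, LinearMap.comp_apply]
  rw [DirectSum.component.lof_self]

theorem extend_mul_of_ne {I J J' K : Finitary cs} (h : J ≠ J')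
    (g : xIdeal J →ₗ[(Hecke M)ᵐᵒᵖ] xIdeal K) (f : xIdeal I →ₗ[(Hecke M)ᵐᵒᵖ] xIdeal J') :
    extend g * extend f = 0 := by
  refine LinearMap.ext fun x => ?_
  simp only [extend, Module.End.mul_apply, LinearMap.comp_apply, LinearMap.zero_apply]
  rw [DirectSum.component.of, dif_neg (Ne.symm h)]
  simp

theorem extend_add {I J : Finitary cs} (f g : xIdeal I →ₗ[(Hecke M)ᵐᵒᵖ] xIdeal J) :
    extend (f + g) = extend f + extend g := by
  rw [extend, LinearMap.add_comp, LinearMap.comp_add]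
  rfl

theorem extend_smul {I J : Finitary cs} (r : ℤ[X]) (f g : xIdeal I →ₗ[(Hecke M)ᵐᵒᵖ] xIdeal J)
    (h : ∀ y, (f y : Hecke M) = r • (g y : Hecke M)) : extend f = r • extend g := by
  refine LinearMap.ext fun x => ?_
  simp only [extend, LinearMap.comp_apply, LinearMap.smul_apply]
  rw [← LinearMap.map_smul_of_tower]
  congr 1
  exact Subtype.ext (h _)

theorem sum_extend_id [Finite B] : ∑ K : Finitary cs,
    extend (LinearMap.id : xIdeal K →ₗ[(Hecke M)ᵐᵒᵖ] xIdeal K) = 1 := by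
  refine DirectSum.linearMap_ext _ fun I => LinearMap.ext fun y => ?_
  rw [LinearMap.comp_apply, LinearMap.sum_apply, Finset.sum_eq_single I]
  · simp only [extend, LinearMap.comp_apply, LinearMap.id_apply]
    rw [DirectSum.component.lof_self]
    rfl
  · intro K _ hK
    simp only [extend, LinearMap.comp_apply, LinearMap.id_apply]
    rw [DirectSum.component.of, dif_neg (Ne.symm hK)]
    simp
  · intro h
    exact absurd (Finset.mem_univ I) h

variable (cs)

/-- The embedding of `H_q` into `E_q(W)` as the endomorphisms of the summand `x_∅ H_q`. -/
def leftMulEnd : Hecke M →ₗ[ℤ[X]] HeckeEndAlg cs where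
  toFun a := extend (leftMulEmpty cs a)
  map_add' a b := by
    rw [← extend_add]
    exact extend_congr fun y => by
      rw [leftMulEmpty_apply, add_mul]
      rfl
  map_smul' r a := extend_smul r _ _ fun y => by
    rw [leftMulEmpty_apply, leftMulEmpty_apply, smul_mul_assoc]

theorem leftMulEnd_apply (a : Hecke M) : leftMulEnd cs a = extend (leftMulEmpty cs a) := rfl

theorem leftMulEnd_mul (a b : Hecke M) :
    leftMulEnd cs (a * b) = leftMulEnd cs a * leftMulEnd cs b := by
  rw [leftMulEnd_apply, leftMulEnd_apply, leftMulEnd_apply, extend_mul]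
  exact extend_congr fun y => mul_assoc _ _ _

theorem leftMulEnd_one : leftMulEnd cs 1 =
    extend (LinearMap.id : xIdeal (emptyΛ cs) →ₗ[(Hecke M)ᵐᵒᵖ] xIdeal (emptyΛ cs)) :=
  extend_congr fun _ => one_mul _

/-- The value of the `(∅, ∅)`-component of an endomorphism at `1`. -/
def evalOne : HeckeEndAlg cs →ₗ[ℤ[X]] Hecke M where
  toFun f := (DirectSum.component (Hecke M)ᵐᵒᵖ (Finitary cs) (fun I => xIdeal I) (emptyΛ cs)
    (f (DirectSum.lof (Hecke M)ᵐᵒᵖ (Finitary cs) (fun I => xIdeal I) (emptyΛ cs)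
      ⟨1, mem_xIdeal_emptyΛ 1⟩)) : Hecke M)
  map_add' f g := by simp
  map_smul' r f := by
    rw [LinearMap.smul_apply, LinearMap.map_smul_of_tower]
    rfl

theorem evalOne_leftMulEnd (a : Hecke M) : evalOne cs (leftMulEnd cs a) = a := by
  change (DirectSum.component (Hecke M)ᵐᵒᵖ (Finitary cs) (fun I => xIdeal I) (emptyΛ cs)
    (extend (leftMulEmpty cs a) _) : Hecke M) = a
  simp only [extend, LinearMap.comp_apply]
  rw [DirectSum.component.lof_self, DirectSum.component.lof_self, leftMulEmpty_apply, mul_one]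

/-- The summand at `∅` is the regular right module, so an endomorphism of it is left multiplication
by its value at `1`. -/
theorem leftMulEnd_evalOne (f : HeckeEndAlg cs) :
    leftMulEnd cs (evalOne cs f) = leftMulEnd cs 1 * f * leftMulEnd cs 1 := by
  rw [leftMulEnd_one, leftMulEnd_apply]
  set g : xIdeal (emptyΛ cs) →ₗ[(Hecke M)ᵐᵒᵖ] xIdeal (emptyΛ cs) :=
    DirectSum.component (Hecke M)ᵐᵒᵖ (Finitary cs) (fun I => xIdeal I) (emptyΛ cs) ∘ₗ f ∘ₗ
      DirectSum.lof (Hecke M)ᵐᵒᵖ (Finitary cs) (fun I => xIdeal I) (emptyΛ cs) with hg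
  -- Multiplying by the idempotent on both sides leaves only the `(∅, ∅)`-component `g` of `f`.
  have h1 : extend (LinearMap.id : xIdeal (emptyΛ cs) →ₗ[(Hecke M)ᵐᵒᵖ] xIdeal (emptyΛ cs)) * f *
      extend (LinearMap.id : xIdeal (emptyΛ cs) →ₗ[(Hecke M)ᵐᵒᵖ] xIdeal (emptyΛ cs)) =
      extend g := rfl
  rw [h1]
  refine extend_congr fun y => ?_
  rw [leftMulEmpty_apply]
  have h2 : y = MulOpposite.op (y : Hecke M) • (⟨1, mem_xIdeal_emptyΛ 1⟩ : xIdeal (emptyΛ cs)) :=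
    Subtype.ext (one_mul _).symm
  conv_rhs => rw [h2, map_smul]
  rfl

end Ideals

/-! ### The relations in the Hecke endomorphism algebra -/

section EndRelations

variable {B W : Type*} [Group W] {M : CoxeterMatrix B} {cs : CoxeterSystem M W}

variable (cs) in
/-- The inclusions `u_{I,J}` in `R E_q(W)`. -/
def inclElt {I J : Finitary cs} (h : I.Below J) : RHeckeEndAlg cs := uElt (inclMap h)

variable (cs) in
/-- The splitting maps `d_{J,I}` in `R E_q(W)`. -/
def splitElt {I J : Finitary cs} (h : I.Below J) : RHeckeEndAlg cs := dElt (splitMap h)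

theorem tmul_mul_tmul (a b : GroundRing) (x y : HeckeEndAlg cs) :
    (a ⊗ₜ[ℤ[X]] x) * (b ⊗ₜ[ℤ[X]] y) = (a * b) ⊗ₜ[ℤ[X]] (x * y) :=
  Algebra.TensorProduct.tmul_mul_tmul a b x y

theorem smul_tmul_eq (a b : GroundRing) (x : HeckeEndAlg cs) :
    a • (b ⊗ₜ[ℤ[X]] x) = (a * b) ⊗ₜ[ℤ[X]] x := TensorProduct.smul_tmul' a b x

theorem tmul_smul_eq (p : ℤ[X]) (a : GroundRing) (x : HeckeEndAlg cs) :
    a ⊗ₜ[ℤ[X]] (p • x) = (algebraMap ℤ[X] GroundRing p * a) ⊗ₜ[ℤ[X]] x := by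
  rw [← TensorProduct.smul_tmul, Algebra.smul_def]

/-- Shows that the normalising factors `π(I)/π(J)` telescope along a chain. -/
theorem mk_mul_mk_cancel (p : ℤ[X]) (f g : constOne) :
    (Localization.mk (g : ℤ[X]) f * Localization.mk p g : GroundRing) = Localization.mk p f := by
  rw [Localization.mk_mul, mul_comm f g, mul_comm (g : ℤ[X]) p]
  rw [Localization.mk_eq_mk_iff, Localization.r_iff_exists]
  exact ⟨1, by push_cast; ring⟩

theorem splitElt_mul_inclElt {I J : Finitary cs} (h : I.Below J) :
    splitElt cs h * inclElt cs h = oneElt J := by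
  rw [splitElt, inclElt, dElt, uElt, oneElt, tmul_mul_tmul, extend_mul, mul_one]
  -- Cleared of denominators: every element `w` of `W_J` satisfies `T_w x_J = q^{ℓ(w)} x_J`, and the
  -- minimal representatives contribute `π(J)/π(I)` in total.
  have e1 : poincare I • extend (splitMap h ∘ₗ inclMap h) =
      poincare J • extend (LinearMap.id : xIdeal J →ₗ[(Hecke M)ᵐᵒᵖ] xIdeal J) := by
    have key : ∀ y : xIdeal J, poincare I • (((splitMap h ∘ₗ inclMap h) y : xIdeal J) : Hecke M) =
        poincare J • (y : Hecke M) := by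
      intro y
      rw [LinearMap.comp_apply, isLeftMul_splitMap, isInclusion_inclMap]
      obtain ⟨z, hz⟩ := mem_xIdeal.1 y.2
      rw [← hz, ← mul_assoc, ← smul_mul_assoc, poincare_smul_hElt_mul_xElt h.1.subset,
        smul_mul_assoc]
    rw [← extend_smul (poincare I) (poincare I • (splitMap h ∘ₗ inclMap h)) _ fun _ => rfl,
      ← extend_smul (poincare J) (poincare J • LinearMap.id) _ fun _ => rfl]
    exact extend_congr key
  have e2 : (Localization.mk (poincare I) ⟨poincare J, poincare_mem J⟩ : GroundRing) =
      algebraMap ℤ[X] GroundRing (poincare I) * Localization.mk 1 ⟨poincare J, poincare_mem J⟩ := by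
    rw [algebraMap_mul_mk, mul_one]
  rw [e2, ← tmul_smul_eq, e1, tmul_smul_eq, algebraMap_mul_mk_self ⟨poincare J, poincare_mem J⟩]

theorem inclElt_mul_inclElt {I J J' K : Finitary cs} (h₁ : I.Below J) (h₂ : J.Below K)
    (h₁' : I.Below J') (h₂' : J'.Below K) :
    inclElt cs h₁ * inclElt cs h₂ = inclElt cs h₁' * inclElt cs h₂' := by
  simp only [inclElt, uElt, tmul_mul_tmul, extend_mul]
  refine congrArg (TensorProduct.tmul ℤ[X] _) (extend_congr fun y => ?_)
  simp only [LinearMap.comp_apply]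
  rw [isInclusion_inclMap, isInclusion_inclMap, isInclusion_inclMap, isInclusion_inclMap]

/-- On `x_I H_q` the composite sends `x_I` to `x_J` and then to `x_K`, so the intermediate set
leaves no trace, and neither does its Poincaré polynomial. -/
theorem splitElt_mul_splitElt {I J J' K : Finitary cs} (h₁ : I.Below J) (h₂ : J.Below K)
    (h₁' : I.Below J') (h₂' : J'.Below K) :
    splitElt cs h₂ * splitElt cs h₁ = splitElt cs h₂' * splitElt cs h₁' := by
  simp only [splitElt, dElt, tmul_mul_tmul, extend_mul]
  rw [mk_mul_mk_cancel _ _ ⟨poincare J, poincare_mem J⟩,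
    mk_mul_mk_cancel _ _ ⟨poincare J', poincare_mem J'⟩]
  refine congrArg (TensorProduct.tmul ℤ[X] _) (extend_congr fun y => ?_)
  simp only [LinearMap.comp_apply]
  rw [isLeftMul_splitMap, isLeftMul_splitMap, isLeftMul_splitMap, isLeftMul_splitMap]
  obtain ⟨z, hz⟩ := mem_xIdeal.1 y.2
  rw [← hz, ← mul_assoc (hElt J I), ← mul_assoc (hElt J' I), hElt_mul_xElt h₁.1.subset,
    hElt_mul_xElt h₁'.1.subset, ← mul_assoc, ← mul_assoc, hElt_mul_xElt h₂.1.subset,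
    hElt_mul_xElt h₂'.1.subset]

theorem exists_uProd_inclElt {I : Finitary cs} (c : Ordering cs I) :
    ∃ f : xIdeal I →ₗ[(Hecke M)ᵐᵒᵖ] xIdeal (emptyΛ cs), IsInclusion f ∧
      uProd (inclElt cs) oneElt c = 1 ⊗ₜ extend f := by
  induction c with
  | nil => exact ⟨LinearMap.id, fun _ => rfl, rfl⟩
  | snoc c h ih =>
    obtain ⟨f, hf, e⟩ := ih
    refine ⟨f ∘ₗ inclMap h, fun y => ?_, ?_⟩
    · rw [LinearMap.comp_apply, hf, isInclusion_inclMap]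
    · rw [uProd, e, inclElt, uElt, tmul_mul_tmul, extend_mul, mul_one]

/-- The factors `h_{J,I}` accumulate to `x_I`, starting from `x_∅ = 1`, while the scalars telescope
to `1/π(I)`. -/
theorem exists_dProd_splitElt {I : Finitary cs} (c : Ordering cs I) :
    ∃ f : xIdeal (emptyΛ cs) →ₗ[(Hecke M)ᵐᵒᵖ] xIdeal I, IsLeftMul (xElt I) f ∧
      dProd (splitElt cs) oneElt c =
        (Localization.mk 1 ⟨poincare I, poincare_mem I⟩ : GroundRing) ⊗ₜ extend f := by
  induction c with
  | nil =>
    refine ⟨LinearMap.id, fun y => ?_, ?_⟩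
    · rw [xElt_emptyΛ, one_mul, LinearMap.id_apply]
    · have : (⟨poincare (emptyΛ cs), poincare_mem _⟩ : constOne) = 1 := Subtype.ext poincare_emptyΛ
      rw [this, Localization.mk_one]
      rfl
  | @snoc I J c h ih =>
    obtain ⟨f, hf, e⟩ := ih
    refine ⟨splitMap h ∘ₗ f, fun y => ?_, ?_⟩
    · rw [LinearMap.comp_apply, isLeftMul_splitMap, hf, ← mul_assoc, hElt_mul_xElt h.1.subset]
    · rw [dProd, e, splitElt, dElt, tmul_mul_tmul, extend_mul,
        mk_mul_mk_cancel _ _ ⟨poincare I, poincare_mem I⟩]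

theorem uProd_inclElt_mul_dProd_splitElt {I : Finitary cs} (c : Ordering cs I) :
    uProd (inclElt cs) oneElt c * dProd (splitElt cs) oneElt c =
      (Localization.mk 1 ⟨poincare I, poincare_mem I⟩ : GroundRing) ⊗ₜ
        leftMulEnd cs (xElt I) := by
  obtain ⟨f, hf, e⟩ := exists_uProd_inclElt c
  obtain ⟨g, hg, e'⟩ := exists_dProd_splitElt c
  rw [e, e', tmul_mul_tmul, extend_mul, one_mul, leftMulEnd_apply]
  refine congrArg (TensorProduct.tmul ℤ[X] _) (extend_congr fun y => ?_)
  rw [LinearMap.comp_apply, hf, hg, leftMulEmpty_apply]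

theorem oneElt_emptyΛ : oneElt (emptyΛ cs) = 1 ⊗ₜ leftMulEnd cs 1 := by
  rw [leftMulEnd_one, oneElt]

theorem inclElt_mul_oneElt {I J : Finitary cs} (h : I.Below J) :
    inclElt cs h * oneElt J = inclElt cs h := by
  rw [inclElt, uElt, oneElt, tmul_mul_tmul, extend_mul, mul_one, LinearMap.comp_id]

theorem oneElt_mul_inclElt {I J : Finitary cs} (h : I.Below J) :
    oneElt I * inclElt cs h = inclElt cs h := by
  rw [inclElt, uElt, oneElt, tmul_mul_tmul, extend_mul, mul_one, LinearMap.id_comp]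

theorem splitElt_mul_oneElt {I J : Finitary cs} (h : I.Below J) :
    splitElt cs h * oneElt I = splitElt cs h := by
  rw [splitElt, dElt, oneElt, tmul_mul_tmul, extend_mul, mul_one, LinearMap.comp_id]

theorem oneElt_mul_splitElt {I J : Finitary cs} (h : I.Below J) :
    oneElt J * splitElt cs h = splitElt cs h := by
  rw [splitElt, dElt, oneElt, tmul_mul_tmul, extend_mul, one_mul, LinearMap.id_comp]

/-- The factor `q + 1` in `χ_s` is `π({s})` and cancels the normalisation of the splitting map. -/
theorem chi_inclElt_splitElt (s : B) :
    chi (inclElt cs) (splitElt cs) s = 1 ⊗ₜ leftMulEnd cs (Hecke.klGen M s) := by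
  have h := uProd_inclElt_mul_dProd_splitElt (.snoc .nil (empty_below_singleton cs s))
  rw [uProd, dProd, uProd, dProd, oneElt_mul_inclElt, splitElt_mul_oneElt, xElt_singletonΛ] at h
  rw [chi, h, smul_tmul_eq, ← poincare_singletonΛ (cs := cs) s,
    algebraMap_mul_mk_self ⟨poincare _, poincare_mem _⟩]

theorem chiWord_inclElt_splitElt (y : List B) :
    chiWord (inclElt cs) (splitElt cs) oneElt y =
      1 ⊗ₜ leftMulEnd cs (y.map (Hecke.klGen M)).prod := by
  induction y with
  | nil => rw [chiWord, List.map_nil, List.prod_nil, one_mul, oneElt_emptyΛ]; rfl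
  | cons s y ih =>
    rw [chiWord] at ih
    rw [chiWord, List.map_cons, List.prod_cons, mul_assoc, ih, chi_inclElt_splitElt, tmul_mul_tmul,
      mul_one, List.map_cons, List.prod_cons, leftMulEnd_mul]

/-- Since `χ_s` is left multiplication by `x_s`, the element `ρ` is the given expansion of `x_I`
divided by `π(I)`. The extended braid relation holds for every choice of the expansion. -/
theorem rho_inclElt_splitElt {I : Finitary cs} {c : Ordering cs I} (E : Expansion c) :
    rho (inclElt cs) (splitElt cs) oneElt E =
      (Localization.mk 1 ⟨poincare I, poincare_mem I⟩ : GroundRing) ⊗ₜ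
        leftMulEnd cs (xElt I) := by
  have key : ∀ (a : ℤ[X]) (x : HeckeEndAlg cs), algebraMap ℤ[X] GroundRing a •
      ((1 : GroundRing) ⊗ₜ[ℤ[X]] x) = 1 ⊗ₜ[ℤ[X]] (a • x) := fun a x => by
    rw [smul_tmul_eq, tmul_smul_eq]
  have hsum : (E.coeff.sum fun y a => algebraMap ℤ[X] GroundRing a •
      chiWord (inclElt cs) (splitElt cs) oneElt y) = 1 ⊗ₜ leftMulEnd cs
        (E.coeff.sum fun y a => a • (y.map (Hecke.klGen M)).prod) := by
    rw [map_finsuppSum, Finsupp.sum, Finsupp.sum, TensorProduct.tmul_sum]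
    refine Finset.sum_congr rfl fun y _ => ?_
    rw [chiWord_inclElt_splitElt, key, map_smul]
  rw [rho, hsum, chiWord_inclElt_splitElt, key, ← map_smul, ← TensorProduct.tmul_add, ← map_add,
    ← E.expansion, smul_tmul_eq, mul_one]

theorem isHasseFamily_endAlg [Finite B] (E : (I : Finitary cs) → (c : Ordering cs I) → Expansion c) :
    IsHasseFamily E (inclElt cs) (splitElt cs) oneElt where
  hasse h := by
    cases h with
    | idempotent h => exact splitElt_mul_inclElt h
    | sandwich_u h₁ h₂ h₁' h₂' => exact inclElt_mul_inclElt h₁ h₂ h₁' h₂'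
    | sandwich_d h₁ h₂ h₁' h₂' => exact splitElt_mul_splitElt h₁ h₂ h₁' h₂'
    | braid hI c => rw [rho_inclElt_splitElt, uProd_inclElt_mul_dProd_splitElt]
  quiver h := by
    cases h with
    | u_one h => exact inclElt_mul_oneElt h
    | one_u h => exact oneElt_mul_inclElt h
    | d_one h => exact splitElt_mul_oneElt h
    | one_d h => exact oneElt_mul_splitElt h
    | idem I => rw [oneElt, tmul_mul_tmul, extend_mul, mul_one, LinearMap.id_comp]
    | orth h => rw [oneElt, oneElt, tmul_mul_tmul, extend_mul_of_ne h, TensorProduct.tmul_zero]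
    | sum_one =>
      simp only [oneElt]
      rw [← TensorProduct.tmul_sum, sum_extend_id]
      rfl

end EndRelations

/-! ### Images of the relations under homomorphisms -/

section Map

variable {B W : Type*} [Group W] {M : CoxeterMatrix B} {cs : CoxeterSystem M W}
  {A A' : Type*} [Ring A] [Algebra GroundRing A] [Ring A'] [Algebra GroundRing A']
  {u d : {I J : Finitary cs} → I.Below J → A} {e : Finitary cs → A}
  {u' d' : {I J : Finitary cs} → I.Below J → A'} {e' : Finitary cs → A'}
  (φ : A →ₐ[GroundRing] A')

theorem map_uProd (hu : ∀ {I J : Finitary cs} (h : I.Below J), φ (u h) = u' h)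
    (he : ∀ K, φ (e K) = e' K) {I : Finitary cs} (c : Ordering cs I) :
    φ (uProd u e c) = uProd u' e' c := by
  induction c with
  | nil => exact he _
  | snoc c h ih => rw [uProd, map_mul, ih, hu, uProd]

theorem map_dProd (hd : ∀ {I J : Finitary cs} (h : I.Below J), φ (d h) = d' h)
    (he : ∀ K, φ (e K) = e' K) {I : Finitary cs} (c : Ordering cs I) :
    φ (dProd d e c) = dProd d' e' c := by
  induction c with
  | nil => exact he _
  | snoc c h ih => rw [dProd, map_mul, ih, hd, dProd]

variable (hu : ∀ {I J : Finitary cs} (h : I.Below J), φ (u h) = u' h)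
  (hd : ∀ {I J : Finitary cs} (h : I.Below J), φ (d h) = d' h) (he : ∀ K, φ (e K) = e' K)

include hu hd

theorem map_chi (s : B) : φ (chi u d s) = chi u' d' s := by
  rw [chi, chi, ← hu, ← hd, ← map_mul]
  exact map_smul φ _ _

include he

theorem map_chiWord (y : List B) : φ (chiWord u d e y) = chiWord u' d' e' y := by
  rw [chiWord, chiWord, map_mul, he, map_list_prod, List.map_map]
  congr 3
  funext s
  exact map_chi φ hu hd s

theorem map_rho {I : Finitary cs} {c : Ordering cs I} (E : Expansion c) :
    φ (rho u d e E) = rho u' d' e' E := by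
  have hs : ∀ (a : GroundRing) (x : A), φ (a • x) = a • φ x := fun a x => map_smul φ a x
  rw [rho, rho, hs, map_add, hs, map_finsuppSum]
  simp only [hs, map_chiWord φ hu hd he]

theorem HasseRel.map {E : (I : Finitary cs) → (c : Ordering cs I) → Expansion c} {x y : A}
    (h : HasseRel u d e E x y) : HasseRel u' d' e' E (φ x) (φ y) := by
  cases h with
  | idempotent h => rw [map_mul, hu, hd, he]; exact .idempotent h
  | sandwich_u h₁ h₂ h₁' h₂' =>
    rw [map_mul, map_mul, hu, hu, hu, hu]; exact .sandwich_u h₁ h₂ h₁' h₂'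
  | sandwich_d h₁ h₂ h₁' h₂' =>
    rw [map_mul, map_mul, hd, hd, hd, hd]; exact .sandwich_d h₁ h₂ h₁' h₂'
  | braid hI c =>
    rw [map_mul, map_uProd φ hu he, map_dProd φ hd he, map_rho φ hu hd he]; exact .braid hI c

/-- Each relation is an expression in the family alone, so it lifts along a homomorphism. For a
quotient map this reduces the relations in the quotient to the defining ones. -/
theorem HasseRel.exists_of_map {E : (I : Finitary cs) → (c : Ordering cs I) → Expansion c}
    {x' y' : A'} (h : HasseRel u' d' e' E x' y') :
    ∃ x y, HasseRel u d e E x y ∧ φ x = x' ∧ φ y = y' := by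
  cases h with
  | idempotent h => exact ⟨_, _, .idempotent h, by rw [map_mul, hu, hd], he _⟩
  | sandwich_u h₁ h₂ h₁' h₂' =>
    exact ⟨_, _, .sandwich_u h₁ h₂ h₁' h₂', by rw [map_mul, hu, hu], by rw [map_mul, hu, hu]⟩
  | sandwich_d h₁ h₂ h₁' h₂' =>
    exact ⟨_, _, .sandwich_d h₁ h₂ h₁' h₂', by rw [map_mul, hd, hd], by rw [map_mul, hd, hd]⟩
  | braid hI c =>
    exact ⟨_, _, .braid hI c, by rw [map_mul, map_uProd φ hu he, map_dProd φ hd he],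
      map_rho φ hu hd he _⟩

theorem QuiverRel.map [Fintype (Finitary cs)] {x y : A}
    (h : QuiverRel u d e x y) : QuiverRel u' d' e' (φ x) (φ y) := by
  cases h with
  | u_one h => rw [map_mul, hu, he]; exact .u_one h
  | one_u h => rw [map_mul, hu, he]; exact .one_u h
  | d_one h => rw [map_mul, hd, he]; exact .d_one h
  | one_d h => rw [map_mul, hd, he]; exact .one_d h
  | idem I => rw [map_mul, he]; exact .idem I
  | orth h => rw [map_mul, he, he, map_zero]; exact .orth h
  | sum_one => rw [map_sum, map_one]; simp only [he]; exact .sum_one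

theorem QuiverRel.exists_of_map [Fintype (Finitary cs)] {x' y' : A'}
    (h : QuiverRel u' d' e' x' y') : ∃ x y, QuiverRel u d e x y ∧ φ x = x' ∧ φ y = y' := by
  cases h with
  | u_one h => exact ⟨_, _, .u_one h, by rw [map_mul, hu, he], hu h⟩
  | one_u h => exact ⟨_, _, .one_u h, by rw [map_mul, hu, he], hu h⟩
  | d_one h => exact ⟨_, _, .d_one h, by rw [map_mul, hd, he], hd h⟩
  | one_d h => exact ⟨_, _, .one_d h, by rw [map_mul, hd, he], hd h⟩
  | idem I => exact ⟨_, _, .idem I, by rw [map_mul, he], he I⟩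
  | orth h => exact ⟨_, _, .orth h, by rw [map_mul, he, he], map_zero φ⟩
  | sum_one => exact ⟨_, _, .sum_one, by rw [map_sum]; simp only [he], map_one φ⟩

end Map

/-! ### The comparison with the Hecke endomorphism algebra -/

section BaseChange

theorem add_right_cancel_of_ring {A : Type*} [Ring A] {a b c : A} (h : a + c = b + c) : a = b :=
  _root_.add_right_cancel h

variable {B W : Type*} [Group W] {M : CoxeterMatrix B} {cs : CoxeterSystem M W}

theorem baseChange_evalOne_leftMulEnd (t : GroundRing ⊗[ℤ[X]] Hecke M) :
    (evalOne cs).baseChange GroundRing ((leftMulEnd cs).baseChange GroundRing t) = t := by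
  induction t using TensorProduct.induction_on with
  | zero => rw [map_zero, map_zero]
  | tmul r x => rw [LinearMap.baseChange_tmul, LinearMap.baseChange_tmul, evalOne_leftMulEnd]
  | add x y hx hy => rw [map_add, map_add, hx, hy]

theorem baseChange_leftMulEnd_evalOne (r : RHeckeEndAlg cs) :
    (leftMulEnd cs).baseChange GroundRing ((evalOne cs).baseChange GroundRing r) =
      oneElt (emptyΛ cs) * r * oneElt (emptyΛ cs) := by
  induction r using TensorProduct.induction_on with
  | zero => rw [map_zero, map_zero, mul_zero, zero_mul]
  | tmul r x =>
    rw [LinearMap.baseChange_tmul, LinearMap.baseChange_tmul, leftMulEnd_evalOne, oneElt_emptyΛ,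
      tmul_mul_tmul, tmul_mul_tmul, one_mul, mul_one]
  | add x y hx hy => rw [map_add, map_add, hx, hy, mul_add, add_mul]

end BaseChange

namespace IsHasseFamily

variable {B W : Type*} [Finite B] [Group W] {M : CoxeterMatrix B} {cs : CoxeterSystem M W}
  {A : Type*} [Ring A] [Algebra GroundRing A]
  {E : (I : Finitary cs) → (c : Ordering cs I) → Expansion c}
  {u d : {I J : Finitary cs} → I.Below J → A} {e : Finitary cs → A}

theorem sum_e_mul_mul_e (F : IsHasseFamily E u d e) (a : A) : ∑ J, ∑ I, e J * a * e I = a := by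
  simp only [← Finset.mul_sum, F.sum_e, mul_one, ← Finset.sum_mul, one_mul]

theorem e_mul_mul_e (F : IsHasseFamily E u d e) {I J : Finitary cs} (c : Ordering cs J)
    (c' : Ordering cs I) (a : A) :
    dProd d e c * (uProd u e c * a * dProd d e c') * uProd u e c' = e J * a * e I := by
  rw [← F.dProd_mul_uProd c, ← F.dProd_mul_uProd c']
  simp only [mul_assoc]

theorem e_mul_uProd_mul_dProd_mul_e (F : IsHasseFamily E u d e) {I J : Finitary cs}
    (c : Ordering cs J) (c' : Ordering cs I) (a : A) :
    e (emptyΛ cs) * (uProd u e c * a * dProd d e c') * e (emptyΛ cs) =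
      uProd u e c * a * dProd d e c' := by
  rw [← mul_assoc, ← mul_assoc, F.e_mul_uProd, mul_assoc, F.dProd_mul_e]

section Corner

variable [Algebra ℤ[X] A] [IsScalarTower ℤ[X] GroundRing A] (F : IsHasseFamily E u d e)

theorem uProd_mul_dProd_mem_corner_of_ends {I J : Finitary cs} (c : Ordering cs J)
    (c' : Ordering cs I) : uProd u e c * dProd d e c' ∈ F.corner := by
  by_cases h : J = I
  · subst h
    exact F.uProd_mul_dProd_mem_corner c c'
  · rw [← F.uProd_mul_e c, mul_assoc, ← F.e_mul_dProd c', ← mul_assoc (e J), F.e_mul_e_of_ne h,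
      zero_mul, mul_zero]
    exact zero_mem _

/-- Induction over the generated subalgebra. A generator next to a chain product lengthens the
chain, leaves it unchanged, or is killed by orthogonality, which leaves a product `uProd * dProd`.
-/
theorem uProd_mul_mul_dProd_mem_corner {a : A}
    (ha : a ∈ Algebra.adjoin GroundRing {x : A | (∃ (I J : Finitary cs) (h : I.Below J), u h = x) ∨
      (∃ (I J : Finitary cs) (h : I.Below J), d h = x) ∨ ∃ K, e K = x})
    {I J : Finitary cs} (c : Ordering cs J) (c' : Ordering cs I) :
    uProd u e c * a * dProd d e c' ∈ F.corner := by
  induction ha using Algebra.adjoin_induction generalizing I J with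
  | mem x hx =>
    rcases hx with ⟨K, L, h, rfl⟩ | ⟨K, L, h, rfl⟩ | ⟨K, rfl⟩
    · by_cases hJ : J = K
      · subst hJ
        exact F.uProd_mul_dProd_mem_corner_of_ends (c.snoc h) c'
      · rw [← F.uProd_mul_e c, mul_assoc (uProd u e c), ← F.e_mul_u h, ← mul_assoc (e J),
          F.e_mul_e_of_ne hJ, zero_mul, mul_zero, zero_mul]
        exact zero_mem _
    · by_cases hI : K = I
      · subst hI
        rw [mul_assoc]
        exact F.uProd_mul_dProd_mem_corner_of_ends c (c'.snoc h)
      · rw [← F.e_mul_dProd c', mul_assoc, ← F.d_mul_e h, mul_assoc (d h), ← mul_assoc (e K),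
          F.e_mul_e_of_ne hI, zero_mul, mul_zero, mul_zero]
        exact zero_mem _
    · by_cases hJ : J = K
      · subst hJ
        rw [F.uProd_mul_e]
        exact F.uProd_mul_dProd_mem_corner_of_ends c c'
      · rw [← F.uProd_mul_e c, mul_assoc (uProd u e c), F.e_mul_e_of_ne hJ, mul_zero, zero_mul]
        exact zero_mem _
  | algebraMap r =>
    rw [mul_assoc, Algebra.left_comm, ← Algebra.smul_def]
    exact Submodule.smul_mem _ _ (F.uProd_mul_dProd_mem_corner_of_ends c c')
  | add x y _ _ hx hy =>
    rw [mul_add, add_mul]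
    exact add_mem (hx c c') (hy c c')
  | mul x y _ _ hx hy =>
    -- Inserting `1 = ∑ e K`, with each `e K` written as `dProd * uProd` along some chain to `K`,
    -- splits a product into elements of the corner.
    have e1 : uProd u e c * (x * y) * dProd d e c' = ∑ K : Finitary cs,
        uProd u e c * x * dProd d e (nonempty_ordering K).some *
          (uProd u e (nonempty_ordering K).some * y * dProd d e c') := by
      conv_lhs => rw [← mul_one x, ← F.sum_e]
      simp only [Finset.mul_sum, Finset.sum_mul]
      refine Finset.sum_congr rfl fun K _ => ?_
      rw [← F.dProd_mul_uProd (nonempty_ordering K).some]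
      simp only [mul_assoc]
    rw [e1]
    exact sum_mem fun K _ => F.mul_mem_corner (hx _ _) (hy _ _)

variable (φ : A →ₐ[GroundRing] RHeckeEndAlg cs)
  (hu : ∀ {I J : Finitary cs} (h : I.Below J), φ (u h) = inclElt cs h)
  (hd : ∀ {I J : Finitary cs} (h : I.Below J), φ (d h) = splitElt cs h)
  (he : ∀ K, φ (e K) = oneElt K)

include hu hd

/-- The factor `1_∅` is essential: the homomorphism from `H_q` is unital on all of `A`, and off the
vertex `∅` it sends each `T_s` to `-1`. -/
theorem map_heckeHom (x : Hecke M) :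
    φ (F.heckeHom x) * oneElt (emptyΛ cs) = 1 ⊗ₜ leftMulEnd cs x := by
  induction x using Hecke.induction with
  | halg r =>
    rw [AlgHom.commutes, IsScalarTower.algebraMap_apply ℤ[X] GroundRing A, AlgHom.commutes,
      ← Algebra.smul_def, oneElt_emptyΛ, Algebra.algebraMap_eq_smul_one (A := Hecke M), map_smul,
      smul_tmul_eq, tmul_smul_eq]
  | hgen s =>
    have h1 := map_chi (u' := inclElt cs) (d' := splitElt cs) φ hu hd s
    rw [chi_inclElt_splitElt] at h1
    rw [← F.heckeHom_klGen, Hecke.klGen, map_add, map_add, map_one, map_one] at h1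
    have h2 := congrArg (· * oneElt (emptyΛ cs)) h1
    simp only [add_mul, one_mul] at h2
    rw [oneElt_emptyΛ, tmul_mul_tmul, one_mul, ← leftMulEnd_mul, mul_one, map_add,
      TensorProduct.tmul_add] at h2
    rw [oneElt_emptyΛ]
    exact add_right_cancel_of_ring h2
  | hmul a b ha hb =>
    have h1 : (1 : GroundRing) ⊗ₜ[ℤ[X]] leftMulEnd cs b =
        oneElt (emptyΛ cs) * (1 ⊗ₜ[ℤ[X]] leftMulEnd cs b) := by
      rw [oneElt_emptyΛ, tmul_mul_tmul, one_mul, ← leftMulEnd_mul, one_mul]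
    rw [map_mul, map_mul, mul_assoc, hb, h1, ← mul_assoc, ha, tmul_mul_tmul, one_mul,
      leftMulEnd_mul]
  | hadd a b ha hb => rw [map_add, map_add, add_mul, ha, hb, map_add, TensorProduct.tmul_add]

theorem map_heckeHomR (t : GroundRing ⊗[ℤ[X]] Hecke M) :
    φ (F.heckeHomR t) * oneElt (emptyΛ cs) = (leftMulEnd cs).baseChange GroundRing t := by
  induction t using TensorProduct.induction_on with
  | zero => rw [map_zero, map_zero, map_zero, zero_mul]
  | tmul r x =>
    have hs : φ (r • F.heckeHom x) = r • φ (F.heckeHom x) := map_smul φ r _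
    rw [heckeHomR_tmul, hs, smul_mul_assoc, F.map_heckeHom φ hu hd, LinearMap.baseChange_tmul,
      smul_tmul_eq, mul_one]
  | add x y hx hy => rw [map_add, map_add, map_add, add_mul, hx, hy]

end Corner

/-- A homomorphism to `R E_q(W)` that respects the families is bijective on an algebra that is
generated by its family. -/
theorem bijective (F : IsHasseFamily E u d e)
    (hgen : Algebra.adjoin GroundRing {x : A | (∃ (I J : Finitary cs) (h : I.Below J), u h = x) ∨
      (∃ (I J : Finitary cs) (h : I.Below J), d h = x) ∨ ∃ K, e K = x} = ⊤)
    (φ : A →ₐ[GroundRing] RHeckeEndAlg cs)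
    (hu : ∀ {I J : Finitary cs} (h : I.Below J), φ (u h) = inclElt cs h)
    (hd : ∀ {I J : Finitary cs} (h : I.Below J), φ (d h) = splitElt cs h)
    (he : ∀ K, φ (e K) = oneElt K) : Function.Bijective φ := by
  let _ : Algebra ℤ[X] A := Algebra.compHom A (algebraMap ℤ[X] GroundRing)
  have : IsScalarTower ℤ[X] GroundRing A := ⟨fun p r a => by
    rw [Algebra.smul_def p r, ← GroundRing.smul_smul]
    rfl⟩
  have G := isHasseFamily_endAlg E
  constructor
  · rw [injective_iff_map_eq_zero]
    intro a ha
    have key : ∀ {I J : Finitary cs} (c : Ordering cs J) (c' : Ordering cs I),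
        uProd u e c * a * dProd d e c' = 0 := by
      intro I J c c'
      -- Each corner component of `a` comes from some `t` in `R ⊗ H_q`, and its image under `φ` is
      -- left multiplication by `t`. Evaluation at `1` recovers `t`, which is therefore zero.
      obtain ⟨t, ht⟩ := F.mem_corner.1 (F.uProd_mul_mul_dProd_mem_corner
        (a := a) (by rw [hgen]; exact Algebra.mem_top) c c')
      have h0 : (leftMulEnd cs).baseChange GroundRing t = 0 := by
        rw [← F.map_heckeHomR φ hu hd, ← he, ← map_mul, ht, map_mul, map_mul, ha, mul_zero,
          zero_mul]
      have ht0 : t = 0 := by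
        rw [← baseChange_evalOne_leftMulEnd (cs := cs) t, h0, map_zero]
      rw [← ht, ht0, map_zero, zero_mul]
    rw [← F.sum_e_mul_mul_e a]
    refine Finset.sum_eq_zero fun J _ => Finset.sum_eq_zero fun I _ => ?_
    rw [← F.e_mul_mul_e (nonempty_ordering J).some (nonempty_ordering I).some, key, mul_zero,
      zero_mul]
  · intro r
    rw [← AlgHom.mem_range, ← G.sum_e_mul_mul_e r]
    refine sum_mem fun J _ => sum_mem fun I _ => ?_
    set c := (nonempty_ordering J).some
    set c' := (nonempty_ordering I).some
    -- The outer chain products are images of those in `A`. The middle factor lies in the corner of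
    -- `R E_q(W)`, so it is left multiplication by an element of `R ⊗ H_q`, which `heckeHomR` lifts
    -- to `A`.
    rw [← G.e_mul_mul_e c c']
    refine mul_mem (mul_mem (AlgHom.mem_range φ |>.2 ⟨_, map_dProd (d' := splitElt cs) φ hd he c⟩) ?_)
      (AlgHom.mem_range φ |>.2 ⟨_, map_uProd (u' := inclElt cs) φ hu he c'⟩)
    rw [← G.e_mul_uProd_mul_dProd_mul_e, ← baseChange_leftMulEnd_evalOne, ← F.map_heckeHomR φ hu hd, ← he, ← map_mul]
    exact AlgHom.mem_range_self φ _

end IsHasseFamily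

/-! ### The universal property of path algebras -/

namespace PathAlgebra

section Path

variable {R : Type*} [CommRing R] {V : Type*} [Quiver V]

theorem of_cons {a b c : V} (p : Quiver.Path a b) (f : b ⟶ c) :
    of R (⟨a, c, p.cons f⟩ : AnyPath V) = arrow R f * of R ⟨a, b, p⟩ := by
  rw [arrow, of_mul_of, pathMul_comp]
  rfl

theorem arrow_mul_vertex {a b : V} (f : a ⟶ b) : arrow R f * vertex R a = arrow R f := by
  rw [arrow, vertex, of_mul_of, pathMul_comp, Quiver.Path.nil_comp]

theorem vertex_mul_arrow {a b : V} (f : a ⟶ b) : vertex R b * arrow R f = arrow R f := by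
  rw [arrow, vertex, of_mul_of, pathMul_comp, Quiver.Path.comp_nil]

theorem vertex_mul_vertex (a : V) : vertex R a * vertex R a = vertex R a := by
  rw [vertex, of_mul_of, pathMul_comp, Quiver.Path.nil_comp]

theorem vertex_mul_vertex_of_ne {a b : V} (h : a ≠ b) : vertex R a * vertex R b = 0 := by
  rw [vertex, vertex, of_mul_of]
  exact pathMul_ne _ _ h.symm

variable {A : Type*} [Ring A] [Algebra R A] (e : V → A) (f : {a b : V} → (a ⟶ b) → A)

/-- The product of the images of the arrows along a path. -/
def pathVal {a : V} : {b : V} → Quiver.Path a b → A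
  | _, .nil => e a
  | _, .cons p g => f g * pathVal p

/-- The linear extension of `pathVal`. -/
def liftLinear : PathAlgebra R V →ₗ[R] A :=
  (Finsupp.linearCombination R fun p : AnyPath V => pathVal e f p.2.2 :
    (AnyPath V →₀ R) →ₗ[R] A)

theorem liftLinear_of (p : AnyPath V) : liftLinear (R := R) e f (of R p) = pathVal e f p.2.2 := by
  rw [liftLinear, of]
  exact (Finsupp.linearCombination_single R _ _).trans (one_smul R _)

variable {e f} (hef : ∀ {a b : V} (g : a ⟶ b), e b * f g = f g) (hee : ∀ a, e a * e a = e a)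
  (horth : ∀ {a b}, a ≠ b → e a * e b = 0)

include hee

theorem vertex_mul_pathVal (hef : ∀ {a b : V} (g : a ⟶ b), e b * f g = f g) {a b : V}
    (p : Quiver.Path a b) : e b * pathVal e f p = pathVal e f p := by
  cases p with
  | nil => exact hee a
  | cons p g => rw [pathVal, ← mul_assoc, hef]

theorem pathVal_mul_vertex {a b : V} (p : Quiver.Path a b) :
    pathVal e f p * e a = pathVal e f p := by
  induction p with
  | nil => exact hee a
  | cons p g ih => rw [pathVal, mul_assoc, ih]

include hef

theorem pathVal_comp {a b c : V} (q : Quiver.Path a b) (p : Quiver.Path b c) :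
    pathVal e f (q.comp p) = pathVal e f p * pathVal e f q := by
  induction p with
  | nil => exact (vertex_mul_pathVal hee hef q).symm
  | cons p g ih => rw [Quiver.Path.comp_cons, pathVal, pathVal, ih, mul_assoc]

include horth

theorem liftLinear_mul (x y : PathAlgebra R V) :
    liftLinear (R := R) e f (x * y) = liftLinear e f x * liftLinear e f y := by
  induction x using induct with
  | h0 => rw [zero_mul', map_zero, zero_mul]
  | hadd x x' hx hx' => rw [add_mul', map_add, map_add, add_mul, hx, hx']
  | hs r p =>
    rw [smul_mul', map_smul, map_smul, smul_mul_assoc]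
    congr 1
    induction y using induct with
    | h0 => rw [mul_zero', map_zero, mul_zero]
    | hadd y y' hy hy' => rw [mul_add', map_add, map_add, mul_add, hy, hy']
    | hs s q =>
      rw [mul_smul', map_smul, map_smul, mul_smul_comm]
      congr 1
      obtain ⟨a, b, p⟩ := p
      obtain ⟨a', b', q⟩ := q
      rw [of_mul_of, liftLinear_of, liftLinear_of]
      by_cases h : b' = a
      · subst h
        rw [pathMul_comp, liftLinear_of]
        exact pathVal_comp hef hee q p
      -- For paths that cannot be composed, the values carry different orthogonal idempotents at the
      -- ends that meet.
      · rw [pathMul_ne _ _ h, map_zero, ← pathVal_mul_vertex hee p,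
          ← vertex_mul_pathVal hee hef q, mul_assoc, ← mul_assoc (e a), horth (Ne.symm h),
          zero_mul, mul_zero]

end Path

section Lift

variable {R : Type*} [CommRing R] {V : Type*} [Quiver V] [Fintype V]
  {A : Type*} [Ring A] [Algebra R A] {e : V → A} {f : {a b : V} → (a ⟶ b) → A}
  (hfe : ∀ {a b : V} (g : a ⟶ b), f g * e a = f g)
  (hef : ∀ {a b : V} (g : a ⟶ b), e b * f g = f g) (hee : ∀ a, e a * e a = e a)
  (horth : ∀ {a b}, a ≠ b → e a * e b = 0) (hsum : ∑ a, e a = 1)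

/-- The homomorphism from the path algebra that is given by a representation of the vertices and
arrows. -/
def lift : PathAlgebra R V →ₐ[R] A :=
  AlgHom.ofLinearMap (liftLinear e f)
    (by
      rw [one_def, map_sum, ← hsum]
      exact Finset.sum_congr rfl fun a _ => liftLinear_of e f _)
    (liftLinear_mul hef hee horth)

theorem lift_vertex (a : V) : lift (R := R) hef hee horth hsum (vertex R a) = e a :=
  liftLinear_of e f _

include hfe in
theorem lift_arrow {a b : V} (g : a ⟶ b) :
    lift (R := R) hef hee horth hsum (arrow R g) = f g :=
  (liftLinear_of e f _).trans (hfe g)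

theorem mem_of_vertex_mem_of_arrow_mem {S : Subalgebra R (PathAlgebra R V)}
    (hv : ∀ a, vertex R a ∈ S) (ha : ∀ {a b : V} (g : a ⟶ b), arrow R g ∈ S)
    (x : PathAlgebra R V) : x ∈ S := by
  induction x using induct with
  | h0 => exact zero_mem S
  | hadd x y hx hy => exact add_mem hx hy
  | hs r p =>
    refine S.smul_mem ?_ r
    obtain ⟨a, b, p⟩ := p
    induction p with
    | nil => exact hv a
    | cons p g ih => rw [of_cons]; exact mul_mem (ha g) ih

end Lift

end PathAlgebra

/-! ### The algebra of the Hasse quiver and the presented algebra -/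

section Algebras

variable {B W : Type*} [Finite B] [Group W] {M : CoxeterMatrix B} {cs : CoxeterSystem M W}
  (E : (I : Finitary cs) → (c : Ordering cs I) → Expansion c)

/-- The path algebra satisfies the quiver relations by its construction; hence they need not be
imposed on its quotient, in contrast to the presented algebra. -/
theorem eq_of_quiverRel_pathAlgebra {x y : PathAlgebra GroundRing (Finitary cs)}
    (h : QuiverRel upsilon delta (PathAlgebra.vertex GroundRing) x y) : x = y := by
  cases h with
  | u_one h => exact PathAlgebra.arrow_mul_vertex _
  | one_u h => exact PathAlgebra.vertex_mul_arrow _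
  | d_one h => exact PathAlgebra.arrow_mul_vertex _
  | one_d h => exact PathAlgebra.vertex_mul_arrow _
  | idem I => exact PathAlgebra.vertex_mul_vertex I
  | orth h => exact PathAlgebra.vertex_mul_vertex_of_ne h
  | sum_one => rfl

theorem isHasseFamily_hasseAlg : IsHasseFamily E (fun h => HasseAlg.mk E (upsilon h))
    (fun h => HasseAlg.mk E (delta h)) fun K => HasseAlg.mk E (PathAlgebra.vertex GroundRing K) where
  hasse h := by
    obtain ⟨x, y, h', rfl, rfl⟩ := h.exists_of_map (u := upsilon) (d := delta)
      (e := PathAlgebra.vertex GroundRing) (HasseAlg.mk E) (fun _ => rfl) (fun _ => rfl)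
      fun _ => rfl
    exact RingQuot.mkAlgHom_rel GroundRing h'
  quiver h := by
    obtain ⟨x, y, h', rfl, rfl⟩ := h.exists_of_map (u := upsilon) (d := delta)
      (e := PathAlgebra.vertex GroundRing) (HasseAlg.mk E) (fun _ => rfl) (fun _ => rfl)
      fun _ => rfl
    rw [eq_of_quiverRel_pathAlgebra h']

theorem adjoin_hasseAlg : Algebra.adjoin GroundRing {x : HasseAlg E |
    (∃ (I J : Finitary cs) (h : I.Below J), HasseAlg.mk E (upsilon h) = x) ∨
    (∃ (I J : Finitary cs) (h : I.Below J), HasseAlg.mk E (delta h) = x) ∨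
    ∃ K, HasseAlg.mk E (PathAlgebra.vertex GroundRing K) = x} = ⊤ := by
  refine eq_top_iff.2 fun x _ => ?_
  obtain ⟨x, rfl⟩ := RingQuot.mkAlgHom_surjective GroundRing _ x
  refine PathAlgebra.mem_of_vertex_mem_of_arrow_mem (S := (Algebra.adjoin GroundRing _).comap
    (HasseAlg.mk E)) (fun K => ?_) (fun g => ?_) x
  · exact Algebra.subset_adjoin (Or.inr (Or.inr ⟨K, rfl⟩))
  · rcases g with h | h
    · exact Algebra.subset_adjoin (Or.inr (Or.inl ⟨_, _, h, rfl⟩))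
    · exact Algebra.subset_adjoin (Or.inl ⟨_, _, h, rfl⟩)

theorem adjoin_presentedAlg : Algebra.adjoin GroundRing {x : PresentedAlg E |
    (∃ (I J : Finitary cs) (h : I.Below J), PresentedAlg.gen E (.u h) = x) ∨
    (∃ (I J : Finitary cs) (h : I.Below J), PresentedAlg.gen E (.d h) = x) ∨
    ∃ K, PresentedAlg.gen E (.one K) = x} = ⊤ := by
  refine eq_top_iff.2 fun x _ => ?_
  obtain ⟨x, rfl⟩ := RingQuot.mkAlgHom_surjective GroundRing _ x
  induction x using FreeAlgebra.induction with
  | grade0 r => rw [AlgHom.commutes]; exact Subalgebra.algebraMap_mem _ r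
  | grade1 g =>
    apply Algebra.subset_adjoin
    cases g with
    | u h => exact Or.inl ⟨_, _, h, rfl⟩
    | d h => exact Or.inr (Or.inl ⟨_, _, h, rfl⟩)
    | one K => exact Or.inr (Or.inr ⟨K, rfl⟩)
  | mul x y hx hy => rw [map_mul]; exact mul_mem (hx trivial) (hy trivial)
  | add x y hx hy => rw [map_add]; exact add_mem (hx trivial) (hy trivial)

variable {A : Type*} [Ring A] [Algebra GroundRing A]
  {u d : {I J : Finitary cs} → I.Below J → A} {e : Finitary cs → A}

variable (u d) in
/-- The image of an arrow of the Hasse quiver. -/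
def arrowVal : {I J : Finitary cs} → (I ⟶ J) → A
  | _, _, .delta h => d h
  | _, _, .upsilon h => u h

variable {E} (F : IsHasseFamily E u d e)

theorem IsHasseFamily.e_mul_arrowVal (F : IsHasseFamily E u d e) {I J : Finitary cs} (g : I ⟶ J) :
    e J * arrowVal u d g = arrowVal u d g := by
  rcases g with h | h
  exacts [F.e_mul_d h, F.e_mul_u h]

theorem IsHasseFamily.arrowVal_mul_e (F : IsHasseFamily E u d e) {I J : Finitary cs} (g : I ⟶ J) :
    arrowVal u d g * e I = arrowVal u d g := by
  rcases g with h | h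
  exacts [F.d_mul_e h, F.u_mul_e h]

/-- The homomorphism from the path algebra that is given by a family satisfying the relations. -/
def IsHasseFamily.pathHom : PathAlgebra GroundRing (Finitary cs) →ₐ[GroundRing] A :=
  PathAlgebra.lift (e := e) (f := arrowVal u d) F.e_mul_arrowVal F.e_mul_e F.e_mul_e_of_ne F.sum_e

theorem IsHasseFamily.pathHom_vertex (K : Finitary cs) :
    F.pathHom (PathAlgebra.vertex GroundRing K) = e K := 
  PathAlgebra.lift_vertex F.e_mul_arrowVal F.e_mul_e F.e_mul_e_of_ne F.sum_e K

theorem IsHasseFamily.pathHom_upsilon {I J : Finitary cs} (h : I.Below J) :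
    F.pathHom (upsilon h) = u h := 
  PathAlgebra.lift_arrow F.arrowVal_mul_e F.e_mul_arrowVal F.e_mul_e F.e_mul_e_of_ne F.sum_e
    (HasseArrow.upsilon h)

theorem IsHasseFamily.pathHom_delta {I J : Finitary cs} (h : I.Below J) :
    F.pathHom (delta h) = d h := 
  PathAlgebra.lift_arrow F.arrowVal_mul_e F.e_mul_arrowVal F.e_mul_e F.e_mul_e_of_ne F.sum_e
    (HasseArrow.delta h)

include F

theorem exists_hasseAlg_hom : ∃ φ : HasseAlg E →ₐ[GroundRing] A,
    (∀ {I J : Finitary cs} (h : I.Below J), φ (HasseAlg.mk E (upsilon h)) = u h) ∧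
    (∀ {I J : Finitary cs} (h : I.Below J), φ (HasseAlg.mk E (delta h)) = d h) ∧
    ∀ K, φ (HasseAlg.mk E (PathAlgebra.vertex GroundRing K)) = e K := by
  have key := fun x => RingQuot.liftAlgHom_mkAlgHom_apply GroundRing F.pathHom
    (s := HasseRel upsilon delta (PathAlgebra.vertex GroundRing) E)
    (fun _ _ h => F.hasse (h.map F.pathHom F.pathHom_upsilon F.pathHom_delta F.pathHom_vertex)) x
  exact ⟨_, fun h => (key _).trans (F.pathHom_upsilon h), fun h => (key _).trans (F.pathHom_delta h),
    fun K => (key _).trans (F.pathHom_vertex K)⟩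

theorem exists_presentedAlg_hom : ∃ φ : PresentedAlg E →ₐ[GroundRing] A,
    (∀ {I J : Finitary cs} (h : I.Below J), φ (PresentedAlg.gen E (.u h)) = u h) ∧
    (∀ {I J : Finitary cs} (h : I.Below J), φ (PresentedAlg.gen E (.d h)) = d h) ∧
    ∀ K, φ (PresentedAlg.gen E (.one K)) = e K := by
  let g : Generator cs → A := fun x => match x with
    | .u h => u h
    | .d h => d h
    | .one K => e K
  have hg : ∀ x, FreeAlgebra.lift GroundRing g (freeGen x) = g x :=
    fun x => FreeAlgebra.lift_ι_apply g x
  have key := fun x => RingQuot.liftAlgHom_mkAlgHom_apply GroundRing (FreeAlgebra.lift GroundRing g)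
    (s := PresentationRel E) (fun _ _ h => h.elim
      (fun h => F.hasse (h.map (u' := u) (d' := d) (e' := e) (FreeAlgebra.lift GroundRing g)
        (fun h => hg (.u h)) (fun h => hg (.d h)) fun K => hg (.one K)))
      (fun h => F.quiver (h.map (u' := u) (d' := d) (e' := e) (FreeAlgebra.lift GroundRing g)
        (fun h => hg (.u h)) (fun h => hg (.d h)) fun K => hg (.one K)))) x
  exact ⟨_, fun h => (key _).trans (hg _), fun h => (key _).trans (hg _),
    fun K => (key _).trans (hg _)⟩

end Algebras

section Presented

variable {B W : Type*} [Finite B] [Group W] {M : CoxeterMatrix B} {cs : CoxeterSystem M W}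
  (E : (I : Finitary cs) → (c : Ordering cs I) → Expansion c)

/-- The presented algebra as a ring. -/
abbrev presentedAlgRing : Ring (PresentedAlg E) := Algebra.semiringToRing GroundRing

attribute [local instance] presentedAlgRing

theorem isHasseFamily_presentedAlg : IsHasseFamily E (fun h => PresentedAlg.gen E (.u h))
    (fun h => PresentedAlg.gen E (.d h)) fun K => PresentedAlg.gen E (.one K) where
  hasse h := by
    obtain ⟨x, y, h', rfl, rfl⟩ := h.exists_of_map (u := fun h => freeGen (.u h))
      (d := fun h => freeGen (.d h)) (e := fun K => freeGen (.one K))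
      (RingQuot.mkAlgHom GroundRing (PresentationRel E)) (fun _ => rfl) (fun _ => rfl)
      fun _ => rfl
    exact RingQuot.mkAlgHom_rel GroundRing (Or.inl h')
  quiver h := by
    obtain ⟨x, y, h', rfl, rfl⟩ := h.exists_of_map (u := fun h => freeGen (.u h))
      (d := fun h => freeGen (.d h)) (e := fun K => freeGen (.one K))
      (RingQuot.mkAlgHom GroundRing (PresentationRel E)) (fun _ => rfl) (fun _ => rfl)
      fun _ => rfl
    exact RingQuot.mkAlgHom_rel GroundRing (Or.inr h')

end Presented

end HeckeEnd

end

theorem corollary5p2 {B W : Type*} [Finite B] [Group W] {M : CoxeterMatrix B}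
    (cs : CoxeterSystem M W) :
    (∀ (I : HeckeEnd.Finitary cs) (c : HeckeEnd.Ordering cs I), Nonempty (HeckeEnd.Expansion c)) ∧
    ∃ (incl : ∀ {I J : HeckeEnd.Finitary cs}, I.Below J →
        (HeckeEnd.xIdeal J →ₗ[(HeckeEnd.Hecke M)ᵐᵒᵖ] HeckeEnd.xIdeal I))
      (split : ∀ {I J : HeckeEnd.Finitary cs}, I.Below J →
        (HeckeEnd.xIdeal I →ₗ[(HeckeEnd.Hecke M)ᵐᵒᵖ] HeckeEnd.xIdeal J)),
      (∀ {I J : HeckeEnd.Finitary cs} (h : I.Below J), HeckeEnd.IsInclusion (incl h)) ∧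
      (∀ {I J : HeckeEnd.Finitary cs} (h : I.Below J),
        HeckeEnd.IsLeftMul (HeckeEnd.hElt J I) (split h)) ∧
      ∀ E : (I : HeckeEnd.Finitary cs) → (c : HeckeEnd.Ordering cs I) → HeckeEnd.Expansion c,
        (∃ hbar : HeckeEnd.HasseAlg E ≃ₐ[HeckeEnd.GroundRing] HeckeEnd.RHeckeEndAlg cs,
          (∀ {I J : HeckeEnd.Finitary cs} (h : I.Below J),
            hbar (HeckeEnd.HasseAlg.mk E (HeckeEnd.upsilon h)) = HeckeEnd.uElt (incl h)) ∧
          (∀ {I J : HeckeEnd.Finitary cs} (h : I.Below J),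
            hbar (HeckeEnd.HasseAlg.mk E (HeckeEnd.delta h)) = HeckeEnd.dElt (split h)) ∧
          (∀ K : HeckeEnd.Finitary cs,
            hbar (HeckeEnd.HasseAlg.mk E (HeckeEnd.PathAlgebra.vertex _ K)) =
              HeckeEnd.oneElt K)) ∧
        (∃ φ : HeckeEnd.PresentedAlg E ≃ₐ[HeckeEnd.GroundRing] HeckeEnd.RHeckeEndAlg cs,
          (∀ {I J : HeckeEnd.Finitary cs} (h : I.Below J),
            φ (HeckeEnd.PresentedAlg.gen E (.u h)) = HeckeEnd.uElt (incl h)) ∧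
          (∀ {I J : HeckeEnd.Finitary cs} (h : I.Below J),
            φ (HeckeEnd.PresentedAlg.gen E (.d h)) = HeckeEnd.dElt (split h)) ∧
          (∀ K : HeckeEnd.Finitary cs,
            φ (HeckeEnd.PresentedAlg.gen E (.one K)) = HeckeEnd.oneElt K)) := by
  refine ⟨fun _ c => HeckeEnd.nonempty_expansion c, fun h => HeckeEnd.inclMap h,
    fun h => HeckeEnd.splitMap h, fun h => HeckeEnd.isInclusion_inclMap h,
    fun h => HeckeEnd.isLeftMul_splitMap h, fun E => ⟨?_, ?_⟩⟩
  -- The universal property supplies the homomorphism; it is bijective because the source is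
  -- generated by a family satisfying the same relations. The presented algebra is treated in the
  -- same way.
  · obtain ⟨φ, hu, hd, he⟩ := HeckeEnd.exists_hasseAlg_hom (HeckeEnd.isHasseFamily_endAlg E)
    exact ⟨AlgEquiv.ofBijective φ ((HeckeEnd.isHasseFamily_hasseAlg E).bijective
      (HeckeEnd.adjoin_hasseAlg E) φ hu hd he), fun h => hu h, fun h => hd h, fun K => he K⟩
  · obtain ⟨φ, hu, hd, he⟩ := HeckeEnd.exists_presentedAlg_hom (HeckeEnd.isHasseFamily_endAlg E)
    let _ := HeckeEnd.presentedAlgRing E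
    exact ⟨AlgEquiv.ofBijective φ ((HeckeEnd.isHasseFamily_presentedAlg E).bijective
      (HeckeEnd.adjoin_presentedAlg E) φ hu hd he), fun h => hu h, fun h => hd h, fun K => he K⟩
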